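/- For real numbers $n,m$ consider the magma equation $$\bigl(\phi^m-\partial_z\,\phi^n\,\partial_z\bigr)\bigl[\phi^{-m}\phi_t\bigr]=-(\phi^n)_z,\qquad z\in\mathbb R,\ t\ge 0. \tag{1}$$ Let $k\in\{1,2\}$ and let $H^k=W^{k,2}(\mathbb R)$. A *global $H^k$ solution of (1) with data $\phi_0$* is a function $\phi(z,t)$ on $\mathbb R\times[0,\infty)$, continuous in $z$, with $\phi>0$ everywhere, $\phi-1\in C^1([0,\infty);H^k)$ and $$\phi(\cdot,t)=\phi_0+\int_0^t\phi(\cdot,s)^m\,u(\cdot,s)\,ds\qquad(t\ge 0),$$ where the integral is taken in $H^k$ and, for each $s\ge 0$, $u=u(\cdot,s)\in H^1$ is the weak solution of $$-(\phi^n u_z)_z+\phi^m u=-(\phi^n)_z,\qquad \phi=\phi(\cdot,s).$$ **Theorem.** Assume $n+m\ge 3$, $n+3m\ge 4$ and $n+3m<6$, and let $k=1$ or $k=2$. Let $\phi_0$ satisfy $$\phi_0-1\in H^k,\qquad \Bigl\|\frac1{\phi_0}\Bigr\|_{L^\infty}<\infty$$ (no smallness is assumed). Then there exists a unique global $H^k$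 solution $\phi$ of (1) with data $\phi_0$. Moreover it stays uniformly bounded away from zero: there is $\varepsilon>0$ with $\phi(z,t)\ge\varepsilon$ for all $z\in\mathbb R$ and all $t\ge 0$. -/

import Mathlib

open MeasureTheory Set Filter
open scoped ENNReal ContDiff

namespace Magma

noncomputable section

/-- A test function on the real line: smooth with compact support. -/
def IsTestFunction (γ : ℝ → ℝ) : Prop :=
  ContDiff ℝ ∞ γ ∧ HasCompactSupport γ

/-- `g` is the weak derivative of `f`, for `f` and `g` in `L²(ℝ)`. -/
def IsWeakDeriv (f g : Lp ℝ 2 (volume : Measure ℝ)) : Prop :=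
  ∀ γ : ℝ → ℝ, IsTestFunction γ → ∫ z, f z * deriv γ z = -∫ z, g z * γ z

theorem IsTestFunction.memLp {γ : ℝ → ℝ} (h : IsTestFunction γ) : MemLp γ 2 volume :=
  h.1.continuous.memLp_of_hasCompactSupport h.2

theorem IsTestFunction.memLp_deriv {γ : ℝ → ℝ} (h : IsTestFunction γ) :
    MemLp (deriv γ) 2 volume :=
  (h.1.continuous_deriv (by simp)).memLp_of_hasCompactSupport h.2.deriv

theorem integral_mul_eq_inner (f : Lp ℝ 2 (volume : Measure ℝ)) {γ : ℝ → ℝ}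
    (h : MemLp γ 2 volume) : ∫ z, f z * γ z = inner ℝ (h.toLp γ) f := by
  rw [L2.inner_def]
  refine integral_congr_ae ?_
  filter_upwards [h.coeFn_toLp] with z hz
  simp [hz]

theorem isWeakDeriv_iff (f g : Lp ℝ 2 (volume : Measure ℝ)) :
    IsWeakDeriv f g ↔ ∀ (γ : ℝ → ℝ) (h : IsTestFunction γ),
      inner ℝ (h.memLp_deriv.toLp _) f = -inner ℝ (h.memLp.toLp _) g := by
  refine forall_congr' fun γ => forall_congr' fun h => ?_
  rw [integral_mul_eq_inner f h.memLp_deriv, integral_mul_eq_inner g h.memLp]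

/-- The Sobolev space `H^k(ℝ) = W^{k,2}(ℝ)` of real-valued functions: a function is recorded together
with its weak derivatives of order at most `k`, as a vector `(v, v', …, v⁽ᵏ⁾)` of elements of
`L²(ℝ)`; the norm is `‖v‖² = ∑ j ≤ k, ‖v⁽ʲ⁾‖²` (Euclidean norm of the `L²` norms). -/
def sobolevSubmodule (k : ℕ) :
    Submodule ℝ (PiLp 2 fun _ : Fin (k + 1) => Lp ℝ 2 (volume : Measure ℝ)) where
  carrier := {v | ∀ j : Fin k, IsWeakDeriv (v j.castSucc) (v j.succ)}
  add_mem' := by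
    intro v w hv hw j
    rw [isWeakDeriv_iff]
    intro γ h
    have h₁ := (isWeakDeriv_iff _ _).1 (hv j) γ h
    have h₂ := (isWeakDeriv_iff _ _).1 (hw j) γ h
    simp only [PiLp.add_apply, inner_add_right, h₁, h₂]
    ring
  zero_mem' := by
    intro j
    rw [isWeakDeriv_iff]
    intro γ h
    simp
  smul_mem' := by
    intro c v hv j
    rw [isWeakDeriv_iff]
    intro γ h
    have h₁ := (isWeakDeriv_iff _ _).1 (hv j) γ h
    simp only [PiLp.smul_apply, inner_smul_right, h₁]
    ring

/-- The Sobolev space `H^k(ℝ)`, as a normed space. -/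
abbrev Sobolev (k : ℕ) : Type := sobolevSubmodule k

/-- `H^k(ℝ)` is complete, so that Bochner integrals with values in it are meaningful. -/
instance instCompleteSpaceSobolev (k : ℕ) : CompleteSpace (Sobolev k) := by
  have hc : IsClosed {v : PiLp 2 fun _ : Fin (k + 1) => Lp ℝ 2 (volume : Measure ℝ) |
      ∀ j : Fin k, IsWeakDeriv (v j.castSucc) (v j.succ)} := by
    simp only [isWeakDeriv_iff, Set.ofPred_forall]
    refine isClosed_iInter fun j => isClosed_iInter fun γ => isClosed_iInter fun h => ?_
    exact isClosed_eq (by fun_prop) (by fun_prop)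
  exact hc.completeSpace_coe

/-- The weak derivative of order `j ≤ k` of an element of `H^k(ℝ)` (order `0`: the function). -/
def Sobolev.wderiv {k : ℕ} (v : Sobolev k) (j : Fin (k + 1)) : ℝ → ℝ := v.1 j

/-- The function `f` belongs to the class `v ∈ H^k(ℝ)`, i.e. `f = v` almost everywhere. -/
def Sobolev.Represents {k : ℕ} (v : Sobolev k) (f : ℝ → ℝ) : Prop :=
  v.wderiv 0 =ᵐ[volume] f

/-- `u ∈ H¹(ℝ)` is a weak solution of `L_φ u = -(φⁿ)_z`, where
`L_φ u = -(φⁿ u_z)_z + φᵐ u`, for a given positive function `φ` of the space variable. -/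
def IsEllipticSolution (n m : ℝ) (φ : ℝ → ℝ) (u : Sobolev 1) : Prop :=
  ∀ γ : ℝ → ℝ, IsTestFunction γ →
    ∫ z, (φ z ^ n * u.wderiv 1 z * deriv γ z + φ z ^ m * u.wderiv 0 z * γ z) =
      ∫ z, φ z ^ n * deriv γ z

/-- `φ` (a function of time `t` and space `z`; only `t ≥ 0` matters) is a global solution of class
`C¹([0,∞); H^k)` of the magma equation with data `φ₀`. Here `v t` is `φ(·,t) - 1` as an element of
`H^k`, `u t = L_φ⁻¹[-(φⁿ)_z]` and `F t = φᵐ u`, all at time `t`. The equation is the fixed point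
equation `φ = φ₀ + ∫₀ᵗ φᵐ L_φ⁻¹[-(φⁿ)_z] ds`, with an integral in `H^k`, and
`φ(·,t)` denotes the continuous representative. -/
def IsGlobalSolution (n m : ℝ) (k : ℕ) (φ₀ : ℝ → ℝ) (φ : ℝ → ℝ → ℝ) : Prop :=
  (∀ t, 0 ≤ t → Continuous (φ t)) ∧
  (∀ t, 0 ≤ t → ∀ z, 0 < φ t z) ∧
  ∃ (v₀ : Sobolev k) (v F : ℝ → Sobolev k) (u : ℝ → Sobolev 1),
    v₀.Represents (fun z => φ₀ z - 1) ∧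
    (∀ t, 0 ≤ t → (v t).Represents (fun z => φ t z - 1)) ∧
    ContDiffOn ℝ 1 v (Ici 0) ∧
    (∀ t, 0 ≤ t → IsEllipticSolution n m (φ t) (u t)) ∧
    (∀ t, 0 ≤ t → (F t).Represents (fun z => φ t z ^ m * (u t).wderiv 0 z)) ∧
    (∀ t, 0 ≤ t → IntervalIntegrable F volume 0 t) ∧
    ∀ t, 0 ≤ t → v t = v₀ + ∫ s in (0 : ℝ)..t, F s

end

end Magma

namespace Magma

open scoped Topology NNReal

noncomputable section

/-! ### Indefinite integrals of locally integrable functions -/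

/-! The change of unknown θ = ∫₁^φ r^{-m} dr turns φ_t = φᵐ u into θ_t = U(θ), where u = U(θ) solves
-(a(θ) u_z)_z + b(θ) u = -a(θ)_z with a(θ) = φⁿ and b(θ) = φᵐ. The operator inverts a second order
problem, so U maps H¹ to itself and is Lipschitz on bounded sets: this is an ordinary differential
equation in H¹, not an evolution equation with loss of derivatives. To have uniformly elliptic,
bounded, Lipschitz coefficients on all of H¹, a and b are frozen outside |log φ| ≤ ℓ.

Put q(s) = ∫₀ˢ 1/a. Testing the elliptic equation with q(θ) shows that E(θ) = ½‖θ_z‖² + ∫ P(θ), with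
P' = q b and P(0) = 0, is constant along the flow (`Coeff.energyDeriv_U`). For truncated
coefficients P is bounded below by a multiple of s², so E bounds the H¹ norm and the truncated flow
is global (`Coeff.exists_forall_hasDerivAt`).

The truncation must then be shown inactive. Let B = 2 log(1 + φ) - log φ, which blows up both as φ →
0 and as φ → ∞. The conditions on n and m yield (dB/dθ)² ≤ C P with C independent of ℓ
(`sq_le_potPhi`). By the arithmetic-geometric inequality the variation of B(θ) along the line is at
most ½‖θ_z‖² + (C/2)∫P ≤ (1 + C)E, a bound fixed by the data. Taking ℓ larger than this bound keeps
|log φ| ≤ ℓ for all time (`rep_mem_Icc_of_energy`), which gives existence and the lower bound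
together.

For H², the flux a u_z - (a - 1) has derivative b u, so u_z is itself an H¹ function depending
continuously on θ ∈ H¹. Integrating it in time propagates θ_z ∈ H¹ (`exists_derivative_curve`).

For uniqueness, a solution on [0, T] traces a compact set in H¹, so φ stays between positive
constants there; both solutions become integral curves of one truncated field, Lipschitz on bounded
sets (`IsGlobalSolution.exists_curve`). -/

/-- `f` is an indefinite integral of the locally integrable function `g`. -/
structure IsPrimitive (f g : ℝ → ℝ) : Prop where
  intervalIntegrable : ∀ x y, IntervalIntegrable g volume x y
  sub_eq : ∀ x y, f y - f x = ∫ t in x..y, g t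

namespace IsPrimitive

variable {f g f₁ g₁ : ℝ → ℝ}

theorem absolutelyContinuous (h : IsPrimitive f g) (a b : ℝ) :
    AbsolutelyContinuousOnInterval f a b := by
  have h1 := (h.intervalIntegrable a b).absolutelyContinuousOnInterval_intervalIntegral
    (c := a) (by simp)
  have h2 : AbsolutelyContinuousOnInterval (fun _ : ℝ => f a) a b :=
    (LipschitzWith.const (f a)).lipschitzOnWith.absolutelyContinuousOnInterval
  have h3 : f = fun x => f a + ∫ v in a..x, g v := by
    funext x; rw [← h.sub_eq a x]; ring
  rw [h3]
  exact h2.fun_add h1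

theorem continuous (h : IsPrimitive f g) : Continuous f := by
  rw [continuous_iff_continuousAt]
  intro x
  have := (h.absolutelyContinuous (x - 1) (x + 1)).continuousOn
  rw [uIcc_of_le (by linarith)] at this
  exact this.continuousAt (Icc_mem_nhds (by linarith) (by linarith))

theorem locallyIntegrable (h : IsPrimitive f g) : LocallyIntegrable g := by
  intro x
  refine ⟨Icc (x - 1) (x + 1), Icc_mem_nhds (by linarith) (by linarith), ?_⟩
  exact (intervalIntegrable_iff_integrableOn_Icc_of_le (by linarith)).1
    (h.intervalIntegrable (x - 1) (x + 1))

theorem ae_hasDerivAt (h : IsPrimitive f g) : ∀ᵐ x, HasDerivAt f (g x) x := by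
  filter_upwards [LocallyIntegrable.ae_hasDerivAt_integral h.locallyIntegrable] with x hx
  have h3 : f = fun x => f 0 + ∫ v in (0 : ℝ)..x, g v := by
    funext x; rw [← h.sub_eq 0 x]; ring
  rw [h3]
  exact (hx 0).const_add _

/-- The fundamental theorem for absolutely continuous functions. It reduces sums, products and
compositions to absolute continuity plus an almost everywhere derivative. -/
theorem of_absolutelyContinuous (h : ∀ a b, AbsolutelyContinuousOnInterval f a b)
    (h' : ∀ᵐ x, HasDerivAt f (g x) x) : IsPrimitive f g := by
  have hd : deriv f =ᵐ[volume] g := by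
    filter_upwards [h'] with x hx using hx.deriv
  refine ⟨fun x y => ?_, fun x y => ?_⟩
  · exact (h x y).intervalIntegrable_deriv.congr_ae (ae_restrict_of_ae hd)
  · rw [← (h x y).integral_deriv_eq_sub]
    exact intervalIntegral.integral_congr_ae (by filter_upwards [hd] with x hx _ using hx)

theorem of_hasDerivAt (h : ∀ x, HasDerivAt f (g x) x) (hg : Continuous g) : IsPrimitive f g :=
  ⟨fun x y => hg.intervalIntegrable x y, fun x y =>
    (intervalIntegral.integral_eq_sub_of_hasDerivAt (fun z _ => h z)
      (hg.intervalIntegrable x y)).symm⟩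

theorem add (h : IsPrimitive f g) (h₁ : IsPrimitive f₁ g₁) :
    IsPrimitive (fun x => f x + f₁ x) (fun x => g x + g₁ x) :=
  of_absolutelyContinuous
    (fun a b => (h.absolutelyContinuous a b).fun_add (h₁.absolutelyContinuous a b))
    (by filter_upwards [h.ae_hasDerivAt, h₁.ae_hasDerivAt] with x hx hx1 using hx.add hx1)

theorem const_mul (c : ℝ) (h : IsPrimitive f g) :
    IsPrimitive (fun x => c * f x) (fun x => c * g x) :=
  of_absolutelyContinuous (fun a b => (h.absolutelyContinuous a b).const_mul c)
    (by filter_upwards [h.ae_hasDerivAt] with x hx using hx.const_mul c)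

theorem mul (h : IsPrimitive f g) (h₁ : IsPrimitive f₁ g₁) :
    IsPrimitive (fun x => f x * f₁ x) (fun x => g x * f₁ x + f x * g₁ x) :=
  of_absolutelyContinuous
    (fun a b => (h.absolutelyContinuous a b).fun_mul (h₁.absolutelyContinuous a b))
    (by filter_upwards [h.ae_hasDerivAt, h₁.ae_hasDerivAt] with x hx hx1 using hx.mul hx1)

/-- Since the outer function is differentiable everywhere, the chain rule holds wherever the inner
one is differentiable, hence almost everywhere; the Lipschitz bound preserves absolute continuity.
-/
theorem comp {A κ : ℝ → ℝ} {C : ℝ≥0} (h : IsPrimitive f g) (hA : LipschitzWith C A)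
    (hA' : ∀ s, HasDerivAt A (κ s) s) :
    IsPrimitive (fun x => A (f x)) (fun x => κ (f x) * g x) := by
  refine of_absolutelyContinuous (fun a b => ?_) ?_
  · have h1 := (h.absolutelyContinuous a b)
    refine squeeze_zero (fun t => Finset.sum_nonneg fun i _ => dist_nonneg) (fun t => ?_)
      (by simpa using Tendsto.const_mul (C : ℝ) h1)
    rw [Finset.mul_sum]
    exact Finset.sum_le_sum fun i _ => hA.dist_le_mul _ _
  · filter_upwards [h.ae_hasDerivAt] with x hx using (hA' _).comp x hx

end IsPrimitive

theorem memLp_intervalIntegrable {g : ℝ → ℝ} (hg : MemLp g 2 volume) (x y : ℝ) :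
    IntervalIntegrable g volume x y := by
  rw [intervalIntegrable_iff]
  exact (hg.locallyIntegrable (by norm_num)).integrableOn_isCompact isCompact_uIcc |>.mono_set
    uIoc_subset_uIcc

/-- A local Sobolev inequality: f(z)² ≤ f(y)² + S by integrating (f²)' from z to y, then averaging
over y in a window of length one. -/
theorem IsPrimitive.sq_le {f g : ℝ → ℝ} (h : IsPrimitive f g) (hf : MemLp f 2 volume)
    (hg : MemLp g 2 volume) (z : ℝ) :
    f z ^ 2 ≤ 2 * ∫ t in z..(z + 1), (f t ^ 2 + g t ^ 2) := by
  have hi : Integrable (fun t => f t ^ 2 + g t ^ 2) := hf.integrable_sq.add hg.integrable_sq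
  have hfi : IntervalIntegrable (fun t => f t ^ 2) volume z (z + 1) :=
    hf.integrable_sq.intervalIntegrable
  set S := ∫ t in z..(z + 1), (f t ^ 2 + g t ^ 2) with hS
  have hp := h.mul h
  have key : ∀ y ∈ Icc z (z + 1), f z ^ 2 ≤ f y ^ 2 + S := by
    intro y hy
    have h1 := hp.sub_eq z y
    have h2 : -∫ t in z..y, (g t * f t + f t * g t) ≤ ∫ t in z..y, (f t ^ 2 + g t ^ 2) := by
      rw [← intervalIntegral.integral_neg]
      refine intervalIntegral.integral_mono_on hy.1 (hp.intervalIntegrable _ _).neg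
        hi.intervalIntegrable fun t _ => ?_
      nlinarith [sq_nonneg (f t + g t)]
    have h3 : ∫ t in z..y, (f t ^ 2 + g t ^ 2) ≤ S :=
      intervalIntegral.integral_mono_interval le_rfl hy.1 hy.2
        (Eventually.of_forall fun t => by positivity) hi.intervalIntegrable
    nlinarith
  have h4 : ∫ _ in z..(z + 1), f z ^ 2 ≤ ∫ t in z..(z + 1), (f t ^ 2 + S) :=
    intervalIntegral.integral_mono_on (by linarith) (by simp)
      (hfi.add (by simp)) key
  rw [intervalIntegral.integral_add hfi (by simp)] at h4
  simp only [intervalIntegral.integral_const, add_sub_cancel_left, one_smul] at h4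
  have h5 : ∫ t in z..(z + 1), f t ^ 2 ≤ S :=
    intervalIntegral.integral_mono_on (by linarith) hfi hi.intervalIntegrable
      fun t _ => by nlinarith [sq_nonneg (g t)]
  linarith

/-- A primitive of an `L²` function which is itself in `L²` tends to zero at infinity. -/
theorem IsPrimitive.tendsto_cocompact {f g : ℝ → ℝ} (h : IsPrimitive f g) (hf : MemLp f 2 volume)
    (hg : MemLp g 2 volume) : Tendsto f (cocompact ℝ) (𝓝 0) := by
  have hi : Integrable (fun t => f t ^ 2 + g t ^ 2) := hf.integrable_sq.add hg.integrable_sq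
  have key : ∀ l : Filter ℝ, Tendsto (fun z => ∫ t in z..(z + 1), (f t ^ 2 + g t ^ 2)) l (𝓝 0) →
      Tendsto f l (𝓝 0) := by
    intro l hl
    have h1 : Tendsto (fun z => f z ^ 2) l (𝓝 0) :=
      squeeze_zero (fun z => sq_nonneg _) (h.sq_le hf hg) (by simpa using hl.const_mul 2)
    have h2 := (Real.continuous_sqrt.tendsto 0).comp h1
    simp only [Function.comp_def, Real.sqrt_sq_eq_abs, Real.sqrt_zero] at h2
    exact (tendsto_zero_iff_abs_tendsto_zero _).2 h2
  rw [cocompact_eq_atBot_atTop, tendsto_sup]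
  have hadd : ∀ z, ∫ t in z..(z + 1), (f t ^ 2 + g t ^ 2) =
      (∫ t in (0 : ℝ)..(z + 1), (f t ^ 2 + g t ^ 2)) - ∫ t in (0 : ℝ)..z, (f t ^ 2 + g t ^ 2) :=
    fun z => (intervalIntegral.integral_interval_sub_left hi.intervalIntegrable
      hi.intervalIntegrable).symm
  refine ⟨key _ ?_, key _ ?_⟩
  · simp_rw [hadd]
    have h1 := intervalIntegral_tendsto_integral_Iic (f := fun t => f t ^ 2 + g t ^ 2) 0
      hi.integrableOn tendsto_id
    have h2 := (h1.comp (tendsto_atBot_add_const_right _ (1 : ℝ) tendsto_id)).neg.sub h1.neg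
    rw [sub_self] at h2
    refine h2.congr fun z => ?_
    simp only [Function.comp_def, id, ← intervalIntegral.integral_symm]
  · simp_rw [hadd]
    have h1 := intervalIntegral_tendsto_integral_Ioi (f := fun t => f t ^ 2 + g t ^ 2) 0
      hi.integrableOn tendsto_id
    have h2 := (h1.comp (tendsto_atTop_add_const_right _ (1 : ℝ) tendsto_id)).sub h1
    rw [sub_self] at h2
    exact h2

theorem IsPrimitive.integral_eq_zero {f g : ℝ → ℝ} (h : IsPrimitive f g) (hg : Integrable g)
    (ht : Tendsto f (cocompact ℝ) (𝓝 0)) : ∫ x, g x = 0 := by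
  rw [cocompact_eq_atBot_atTop, tendsto_sup] at ht
  have h1 := intervalIntegral_tendsto_integral hg tendsto_neg_atTop_atBot tendsto_id
  have h2 : Tendsto (fun x : ℝ => ∫ t in (-x)..(id x), g t) atTop (𝓝 (0 - 0)) := by
    simp_rw [← h.sub_eq]
    exact ht.2.sub (ht.1.comp tendsto_neg_atTop_atBot)
  simpa using tendsto_nhds_unique h1 h2

/-! ### Continuous representatives of Sobolev functions -/

/-- The space `L²(ℝ)`. -/
abbrev LTwo : Type := Lp ℝ 2 (volume : Measure ℝ)

theorem IsTestFunction.isPrimitive {γ : ℝ → ℝ} (h : IsTestFunction γ) :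
    IsPrimitive γ (deriv γ) :=
  .of_hasDerivAt (fun x => ((h.1.differentiable (by simp)) x).hasDerivAt)
    (h.1.continuous_deriv (by simp))

theorem IsPrimitive.integral_mul_add_mul_eq_zero {f g f₁ g₁ : ℝ → ℝ} (h : IsPrimitive f g)
    (h₁ : IsPrimitive f₁ g₁) (hf : MemLp f 2 volume) (hg : MemLp g 2 volume)
    (hf₁ : MemLp f₁ 2 volume) (hg₁ : MemLp g₁ 2 volume) :
    ∫ x, (g x * f₁ x + f x * g₁ x) = 0 := by
  refine (h.mul h₁).integral_eq_zero ((hg.integrable_mul hf₁).add (hf.integrable_mul hg₁)) ?_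
  simpa using (h.tendsto_cocompact hf hg).mul (h₁.tendsto_cocompact hf₁ hg₁)

theorem IsPrimitive.isWeakDeriv {f g : ℝ → ℝ} (h : IsPrimitive f g) (hf : MemLp f 2 volume)
    (hg : MemLp g 2 volume) : IsWeakDeriv (hf.toLp f) (hg.toLp g) := by
  intro γ hγ
  have h1 := h.integral_mul_add_mul_eq_zero hγ.isPrimitive hf hg hγ.memLp hγ.memLp_deriv
  have hi1 : Integrable (fun x => g x * γ x) := hg.integrable_mul hγ.memLp
  have hi2 : Integrable (fun x => f x * deriv γ x) := hf.integrable_mul hγ.memLp_deriv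
  rw [integral_add hi1 hi2] at h1
  have h2 : ∫ z, (hf.toLp f) z * deriv γ z = ∫ z, f z * deriv γ z :=
    integral_congr_ae (by filter_upwards [hf.coeFn_toLp] with z hz; rw [hz])
  have h3 : ∫ z, (hg.toLp g) z * γ z = ∫ z, g z * γ z :=
    integral_congr_ae (by filter_upwards [hg.coeFn_toLp] with z hz; rw [hz])
  rw [h2, h3]; linarith

/-- A test function of integral zero is the derivative of a test function. -/
theorem IsTestFunction.exists_deriv_eq {ψ : ℝ → ℝ} (h : IsTestFunction ψ) (h0 : ∫ x, ψ x = 0) :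
    ∃ γ, IsTestFunction γ ∧ deriv γ = ψ := by
  obtain ⟨R, hR0, hR⟩ : ∃ R : ℝ, 0 < R ∧ ∀ x, R ≤ |x| → ψ x = 0 := by
    obtain ⟨R, hR⟩ := h.2.isCompact.isBounded.subset_closedBall 0
    refine ⟨max R 1 + 1, by positivity, fun x hx => ?_⟩
    by_contra hne
    have := hR (subset_tsupport _ hne)
    simp only [Metric.mem_closedBall, dist_zero_right, Real.norm_eq_abs] at this
    linarith [le_max_left R 1]
  have hc := h.1.continuous
  have hd : ∀ x, HasDerivAt (fun x => ∫ t in (-R)..x, ψ t) (ψ x) x := fun x =>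
    intervalIntegral.integral_hasDerivAt_right (hc.intervalIntegrable _ _)
      hc.stronglyMeasurable.stronglyMeasurableAtFilter hc.continuousAt
  have hderiv : deriv (fun x => ∫ t in (-R)..x, ψ t) = ψ := funext fun x => (hd x).deriv
  refine ⟨fun x => ∫ t in (-R)..x, ψ t, ⟨?_, ?_⟩, hderiv⟩
  · rw [contDiff_infty_iff_deriv]
    exact ⟨fun x => (hd x).differentiableAt, by rw [hderiv]; exact h.1⟩
  · refine HasCompactSupport.of_support_subset_isCompact (isCompact_Icc (a := -R) (b := R)) ?_
    intro x hx
    by_contra hx'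
    apply hx
    rw [mem_Icc, not_and_or, not_le, not_le] at hx'
    rcases hx' with hx' | hx'
    · refine intervalIntegral.integral_zero_ae (Eventually.of_forall fun t ht => hR t ?_)
      rw [uIoc_of_ge hx'.le] at ht
      rw [abs_of_neg (by linarith [ht.2])]
      linarith [ht.2]
    -- To the right of the support the integral is already the full one, which vanishes by
    -- hypothesis.
    · have hsub : Function.support ψ ⊆ Ioc (-R) x := by
        intro t ht
        by_contra hne
        rw [mem_Ioc, not_and_or, not_lt, not_le] at hne
        exact ht (hR t (by grind))
      show ∫ t in (-R)..x, ψ t = 0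
      rw [intervalIntegral.integral_eq_integral_of_support_subset hsub, h0]

theorem exists_isTestFunction_integral_eq_one : ∃ η : ℝ → ℝ, IsTestFunction η ∧ ∫ x, η x = 1 := by
  let b : ContDiffBump (0 : ℝ) := ⟨1, 2, one_pos, one_lt_two⟩
  exact ⟨b.normed volume, ⟨b.contDiff_normed, b.hasCompactSupport_normed⟩, b.integral_normed⟩

theorem IsTestFunction.integrable {γ : ℝ → ℝ} (h : IsTestFunction γ) : Integrable γ :=
  h.1.continuous.integrable_of_hasCompactSupport h.2

/-- The lemma of du Bois-Reymond. -/
theorem IsWeakDeriv.exists_isPrimitive {f g : LTwo} (h : IsWeakDeriv f g) :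
    ∃ F : ℝ → ℝ, f =ᵐ[volume] F ∧ IsPrimitive F g := by
  have hg : ∀ x y, IntervalIntegrable g volume x y := memLp_intervalIntegrable (Lp.memLp g)
  have hG : IsPrimitive (fun x => ∫ t in (0 : ℝ)..x, g t) g :=
    ⟨hg, fun x y => intervalIntegral.integral_interval_sub_left (hg _ _) (hg _ _)⟩
  set G : ℝ → ℝ := fun x => ∫ t in (0 : ℝ)..x, g t with hGdef
  have hfl : LocallyIntegrable f := (Lp.memLp f).locallyIntegrable (by norm_num)
  have hdl : LocallyIntegrable (fun x => f x - G x) := hfl.sub hG.continuous.locallyIntegrable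
  have hint : ∀ {γ : ℝ → ℝ}, IsTestFunction γ → Integrable (fun x => (f x - G x) * γ x) := by
    intro γ hγ
    simpa [mul_comm] using hdl.integrable_smul_left_of_hasCompactSupport hγ.1.continuous hγ.2
  have h1 : ∀ γ, IsTestFunction γ → ∫ x, (f x - G x) * deriv γ x = 0 := by
    intro γ hγ
    have hp := hG.mul hγ.isPrimitive
    have hi1 : Integrable (fun x => g x * γ x) := (Lp.memLp g).integrable_mul hγ.memLp
    have hγ' : IsTestFunction (deriv γ) :=
      ⟨by simpa using (contDiff_infty_iff_deriv.1 hγ.1).2, hγ.2.deriv⟩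
    have hi2 : Integrable (fun x => G x * deriv γ x) :=
      (hG.continuous.mul hγ'.1.continuous).integrable_of_hasCompactSupport hγ'.2.mul_left
    have hz := hp.integral_eq_zero (hi1.add hi2) (by
      have : HasCompactSupport (fun x => G x * γ x) := hγ.2.mul_left
      rw [hasCompactSupport_iff_eventuallyEq, coclosedCompact_eq_cocompact] at this
      exact tendsto_nhds_of_eventually_eq this)
    rw [integral_add hi1 hi2] at hz
    have hi3 : Integrable (fun x => f x * deriv γ x) := (Lp.memLp f).integrable_mul hγ.memLp_deriv
    simp_rw [sub_mul]
    rw [integral_sub hi3 hi2, h γ hγ]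
    linarith
  -- The difference f - G annihilates derivatives of test functions, hence every test function of
  -- integral zero. Pairing with η of mass one finds the constant c; a general ψ is corrected by a
  -- multiple of η.
  obtain ⟨η, hη, hη1⟩ := exists_isTestFunction_integral_eq_one
  set c := ∫ x, (f x - G x) * η x with hc
  have h2 : ∀ᵐ x, f x - G x - c = 0 := by
    refine ae_eq_zero_of_integral_contDiff_smul_eq_zero
      (hdl.sub continuous_const.locallyIntegrable) fun ψ hψ1 hψ2 => ?_
    have hψ : IsTestFunction ψ := ⟨hψ1, hψ2⟩
    have hψη : IsTestFunction (fun x => ψ x - (∫ y, ψ y) * η x) :=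
      ⟨hψ1.sub (contDiff_const.mul hη.1), hψ2.sub hη.2.mul_left⟩
    obtain ⟨γ, hγ, hγ'⟩ := hψη.exists_deriv_eq (by
      rw [integral_sub hψ.integrable (hη.integrable.const_mul _), integral_const_mul, hη1]; ring)
    have h3 := h1 γ hγ
    rw [hγ'] at h3
    have h4 : ∀ x, (f x - G x) * (ψ x - (∫ y, ψ y) * η x) =
      (f x - G x) * ψ x - (∫ y, ψ y) * ((f x - G x) * η x) := fun x => by ring
    simp_rw [h4] at h3
    rw [integral_sub (hint hψ) ((hint hη).const_mul _), integral_const_mul, ← hc] at h3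
    have h5 : ∀ x, ψ x • (f x - G x - c) = (f x - G x) * ψ x - c * ψ x := fun x => by
      simp only [smul_eq_mul]; ring
    simp_rw [h5]
    rw [integral_sub (hint hψ) (hψ.integrable.const_mul _), integral_const_mul]
    linarith
  refine ⟨fun x => G x + c, by filter_upwards [h2] with x hx; linarith, hG.intervalIntegrable,
    fun x y => ?_⟩
  rw [← hG.sub_eq]; ring

namespace Sobolev

/-- The weak derivative of order `j`, as a continuous linear map into `L²`. -/
def D {k : ℕ} (j : Fin (k + 1)) : Sobolev k →L[ℝ] LTwo :=
  (PiLp.proj 2 (fun _ : Fin (k + 1) => LTwo) j).comp (sobolevSubmodule k).subtypeL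

theorem norm_sq_eq (v : Sobolev 1) : ‖v‖ ^ 2 = ‖D 0 v‖ ^ 2 + ‖D 1 v‖ ^ 2 := by
  rw [Submodule.coe_norm, PiLp.norm_sq_eq_of_L2, Fin.sum_univ_two]; rfl

theorem norm_D_zero_le (v : Sobolev 1) : ‖D 0 v‖ ≤ ‖v‖ :=
  abs_le_of_sq_le_sq' (by nlinarith [norm_sq_eq v, sq_nonneg ‖D 1 v‖]) (norm_nonneg _) |>.2

theorem norm_D_one_le (v : Sobolev 1) : ‖D 1 v‖ ≤ ‖v‖ :=
  abs_le_of_sq_le_sq' (by nlinarith [norm_sq_eq v, sq_nonneg ‖D 0 v‖]) (norm_nonneg _) |>.2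

theorem norm_le_add (v : Sobolev 1) : ‖v‖ ≤ ‖D 0 v‖ + ‖D 1 v‖ :=
  have h := mul_nonneg (norm_nonneg (D 0 v)) (norm_nonneg (D 1 v))
  abs_le_of_sq_le_sq' (by nlinarith [norm_sq_eq v]) (by positivity) |>.2

theorem exists_rep (v : Sobolev 1) :
    ∃ F : ℝ → ℝ, D 0 v =ᵐ[volume] F ∧ IsPrimitive F (D 1 v) :=
  (v.2 0).exists_isPrimitive

/-- The continuous representative of an element of `H¹`. -/
def rep (v : Sobolev 1) : ℝ → ℝ := (exists_rep v).choose

theorem coe_ae_eq_rep (v : Sobolev 1) : D 0 v =ᵐ[volume] rep v := (exists_rep v).choose_spec.1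

theorem isPrimitive_rep (v : Sobolev 1) : IsPrimitive (rep v) (D 1 v) :=
  (exists_rep v).choose_spec.2

theorem continuous_rep (v : Sobolev 1) : Continuous (rep v) := (isPrimitive_rep v).continuous

theorem memLp_rep (v : Sobolev 1) : MemLp (rep v) 2 volume :=
  (memLp_congr_ae (coe_ae_eq_rep v)).1 (Lp.memLp _)

theorem rep_eq_of_ae {v : Sobolev 1} {f : ℝ → ℝ} (hf : Continuous f)
    (h : D 0 v =ᵐ[volume] f) : rep v = f :=
  Continuous.ae_eq_iff_eq volume (continuous_rep v) hf |>.1 ((coe_ae_eq_rep v).symm.trans h)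

/-- Both weak derivatives are the almost everywhere classical derivative of the same continuous
representative. -/
theorem D_one_eq_of_D_zero_eq {v w : Sobolev 1} (h : D 0 v = D 0 w) : D 1 v = D 1 w := by
  have hr : rep v = rep w := rep_eq_of_ae (continuous_rep w) (h ▸ coe_ae_eq_rep w)
  refine Lp.ext ?_
  filter_upwards [(isPrimitive_rep v).ae_hasDerivAt, (isPrimitive_rep w).ae_hasDerivAt]
    with x hx hy
  rw [hr] at hx
  exact hx.unique hy

theorem ext_D {v w : Sobolev 1} (h0 : D 0 v = D 0 w) (h1 : D 1 v = D 1 w) : v = w := by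
  have : ‖v - w‖ ^ 2 = 0 := by rw [norm_sq_eq, map_sub, map_sub, h0, h1]; simp
  exact sub_eq_zero.1 (norm_eq_zero.1 (pow_eq_zero_iff two_ne_zero |>.1 this))

theorem ext_rep {v w : Sobolev 1} (h : rep v = rep w) : v = w := by
  have h0 : D 0 v = D 0 w :=
    Lp.ext ((coe_ae_eq_rep v).trans (h ▸ (coe_ae_eq_rep w).symm))
  exact ext_D h0 (D_one_eq_of_D_zero_eq h0)

theorem rep_add (v w : Sobolev 1) : rep (v + w) = fun z => rep v z + rep w z := by
  refine rep_eq_of_ae ((continuous_rep v).add (continuous_rep w)) ?_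
  rw [map_add]
  filter_upwards [Lp.coeFn_add (D 0 v) (D 0 w), coe_ae_eq_rep v, coe_ae_eq_rep w] with z h h1 h2
  rw [h, Pi.add_apply, h1, h2]

theorem rep_smul (c : ℝ) (v : Sobolev 1) : rep (c • v) = fun z => c * rep v z := by
  refine rep_eq_of_ae ((continuous_rep v).const_mul c) ?_
  rw [map_smul]
  filter_upwards [Lp.coeFn_smul c (D 0 v), coe_ae_eq_rep v] with z h h1
  rw [h, Pi.smul_apply, h1, smul_eq_mul]

theorem L2_norm_sq_eq (f : LTwo) : ‖f‖ ^ 2 = ∫ x, f x ^ 2 := by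
  rw [← real_inner_self_eq_norm_sq, L2.inner_def]
  simp [sq]

theorem abs_rep_le (v : Sobolev 1) (z : ℝ) : |rep v z| ≤ 2 * ‖v‖ := by
  have h := (isPrimitive_rep v).sq_le (memLp_rep v) (Lp.memLp _) z
  have hi : Integrable (fun t => rep v t ^ 2 + (D 1 v) t ^ 2) :=
    (memLp_rep v).integrable_sq.add (Lp.memLp (D 1 v)).integrable_sq
  have h1 : ∫ t in z..(z + 1), (rep v t ^ 2 + (D 1 v) t ^ 2) ≤ ‖v‖ ^ 2 := by
    rw [intervalIntegral.integral_of_le (by linarith), norm_sq_eq, L2_norm_sq_eq, L2_norm_sq_eq,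
      ← integral_add (Lp.memLp _).integrable_sq (Lp.memLp _).integrable_sq]
    have h2 : ∫ x, ((D 0 v) x ^ 2 + (D 1 v) x ^ 2) = ∫ x, (rep v x ^ 2 + (D 1 v) x ^ 2) :=
      integral_congr_ae (by filter_upwards [coe_ae_eq_rep v] with x hx; rw [hx])
    rw [h2]
    exact setIntegral_le_integral hi (Eventually.of_forall fun t => by positivity)
  exact abs_le_of_sq_le_sq (by nlinarith [sq_nonneg ‖v‖]) (by positivity)

theorem tendsto_rep (v : Sobolev 1) : Tendsto (rep v) (cocompact ℝ) (𝓝 0) :=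
  (isPrimitive_rep v).tendsto_cocompact (memLp_rep v) (Lp.memLp _)

/-- Evaluation at a point, as a continuous linear functional on `H¹`. -/
def ev (z : ℝ) : Sobolev 1 →L[ℝ] ℝ :=
  LinearMap.mkContinuous
    { toFun := fun v => rep v z
      map_add' := fun v w => by rw [rep_add]
      map_smul' := fun c v => by rw [rep_smul]; rfl } 2 fun v => by
    simpa using abs_rep_le v z

@[simp] theorem ev_apply (z : ℝ) (v : Sobolev 1) : ev z v = rep v z := rfl

theorem rep_sub (v w : Sobolev 1) (z : ℝ) : rep (v - w) z = rep v z - rep w z := by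
  simpa using map_sub (ev z) v w

/-- The element of `H¹` with given function and derivative. -/
def ofPair (f g : LTwo) (h : IsWeakDeriv f g) : Sobolev 1 :=
  ⟨WithLp.toLp 2 ![f, g], fun j => by fin_cases j; exact h⟩

@[simp] theorem D_zero_ofPair {f g : LTwo} (h : IsWeakDeriv f g) : D 0 (ofPair f g h) = f := rfl

@[simp] theorem D_one_ofPair {f g : LTwo} (h : IsWeakDeriv f g) : D 1 (ofPair f g h) = g := rfl

/-- The element of `H¹` given by a square integrable primitive of a square integrable function. -/
def ofPrimitive {f g : ℝ → ℝ} (h : IsPrimitive f g) (hf : MemLp f 2 volume)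
    (hg : MemLp g 2 volume) : Sobolev 1 :=
  ofPair _ _ (h.isWeakDeriv hf hg)

theorem D_zero_ofPrimitive {f g : ℝ → ℝ} (h : IsPrimitive f g) (hf : MemLp f 2 volume)
    (hg : MemLp g 2 volume) : D 0 (ofPrimitive h hf hg) =ᵐ[volume] f := hf.coeFn_toLp

theorem D_one_ofPrimitive {f g : ℝ → ℝ} (h : IsPrimitive f g) (hf : MemLp f 2 volume)
    (hg : MemLp g 2 volume) : D 1 (ofPrimitive h hf hg) =ᵐ[volume] g := hg.coeFn_toLp

@[simp] theorem rep_ofPrimitive {f g : ℝ → ℝ} (h : IsPrimitive f g) (hf : MemLp f 2 volume)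
    (hg : MemLp g 2 volume) : rep (ofPrimitive h hf hg) = f :=
  rep_eq_of_ae h.continuous (D_zero_ofPrimitive h hf hg)

/-- Integration by parts in `H¹`. -/
theorem inner_D_one_add_inner_D_zero (v w : Sobolev 1) :
    (inner ℝ (D 0 v) (D 1 w) : ℝ) + inner ℝ (D 1 v) (D 0 w) = 0 := by
  have h := (isPrimitive_rep v).integral_mul_add_mul_eq_zero (isPrimitive_rep w) (memLp_rep v)
    (Lp.memLp _) (memLp_rep w) (Lp.memLp _)
  rw [L2.inner_def, L2.inner_def, ← integral_add (L2.integrable_inner _ _)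
    (L2.integrable_inner _ _),
    ← h]
  refine integral_congr_ae ?_
  filter_upwards [coe_ae_eq_rep v, coe_ae_eq_rep w] with z h1 h2
  simp only [h1, h2, RCLike.inner_apply, conj_trivial]
  ring

end Sobolev

/-! ### Products and compositions in `H¹` -/

theorem memLp_mul_of_bounded {c : ℝ → ℝ} {C : ℝ} (hc : Continuous c) (hC : ∀ z, |c z| ≤ C)
    (f : LTwo) : MemLp (fun z => c z * f z) 2 volume :=
  (Lp.memLp f).of_le_mul (c := C) (hc.aestronglyMeasurable.mul (Lp.memLp f).1)
    (Eventually.of_forall fun z => by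
      rw [norm_mul]; exact mul_le_mul_of_nonneg_right (hC z) (norm_nonneg _))

/-- Multiplication by a bounded continuous function, as an operator on `L²`. -/
def mulCLM (c : ℝ → ℝ) (C : ℝ) (hc : Continuous c) (hC : ∀ z, |c z| ≤ C) : LTwo →L[ℝ] LTwo :=
  LinearMap.mkContinuous
    { toFun := fun f => (memLp_mul_of_bounded hc hC f).toLp _
      map_add' := fun f g => by
        refine Lp.ext ?_
        filter_upwards [(memLp_mul_of_bounded hc hC (f + g)).coeFn_toLp, Lp.coeFn_add f g,
          (memLp_mul_of_bounded hc hC f).coeFn_toLp, (memLp_mul_of_bounded hc hC g).coeFn_toLp,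
          Lp.coeFn_add ((memLp_mul_of_bounded hc hC f).toLp _)
            ((memLp_mul_of_bounded hc hC g).toLp _)] with z h1 h2 h3 h4 h5
        rw [h1, h5, Pi.add_apply, h3, h4, h2, Pi.add_apply, mul_add]
      map_smul' := fun r f => by
        refine Lp.ext ?_
        filter_upwards [(memLp_mul_of_bounded hc hC (r • f)).coeFn_toLp, Lp.coeFn_smul r f,
          (memLp_mul_of_bounded hc hC f).coeFn_toLp,
          Lp.coeFn_smul r ((memLp_mul_of_bounded hc hC f).toLp _)] with z h1 h2 h3 h5
        rw [h1, RingHom.id_apply, h5, Pi.smul_apply, h3, h2, Pi.smul_apply, smul_eq_mul,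
          smul_eq_mul]
        ring } C fun f => by
    refine Lp.norm_le_mul_norm_of_ae_le_mul ?_
    filter_upwards [(memLp_mul_of_bounded hc hC f).coeFn_toLp] with z h1
    simp only [LinearMap.coe_mk, AddHom.coe_mk]
    rw [h1, norm_mul]
    exact mul_le_mul_of_nonneg_right (hC z) (norm_nonneg _)

theorem coeFn_mulCLM {c : ℝ → ℝ} {C : ℝ} (hc : Continuous c) (hC : ∀ z, |c z| ≤ C) (f : LTwo) :
    mulCLM c C hc hC f =ᵐ[volume] fun z => c z * f z :=
  (memLp_mul_of_bounded hc hC f).coeFn_toLp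

theorem norm_mulCLM_le {c : ℝ → ℝ} {C : ℝ} (hc : Continuous c) (hC : ∀ z, |c z| ≤ C) (f : LTwo) :
    ‖mulCLM c C hc hC f‖ ≤ C * ‖f‖ := by
  refine Lp.norm_le_mul_norm_of_ae_le_mul ?_
  filter_upwards [coeFn_mulCLM hc hC f] with z h1
  rw [h1, norm_mul]
  exact mul_le_mul_of_nonneg_right (hC z) (norm_nonneg _)

/-- A bounded Lipschitz function on the line. -/
structure BLip where
  /-- the function -/
  toFun : ℝ → ℝ
  /-- a common bound for the function and its Lipschitz constant -/
  C : ℝ≥0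
  bound : ∀ s, |toFun s| ≤ C
  lip : LipschitzWith C toFun

namespace BLip

instance : CoeFun BLip fun _ => ℝ → ℝ := ⟨toFun⟩

theorem continuous (κ : BLip) : Continuous κ := κ.lip.continuous

/-- The primitive of a bounded Lipschitz function that vanishes at the origin. -/
def A (κ : BLip) (s : ℝ) : ℝ := ∫ r in (0 : ℝ)..s, κ r

theorem hasDerivAt_A (κ : BLip) (s : ℝ) : HasDerivAt κ.A (κ s) s :=
  intervalIntegral.integral_hasDerivAt_right (κ.continuous.intervalIntegrable _ _)
    κ.continuous.stronglyMeasurable.stronglyMeasurableAtFilter κ.continuous.continuousAt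

@[simp] theorem A_zero (κ : BLip) : κ.A 0 = 0 := by simp [A]

theorem lipschitzWith_A (κ : BLip) : LipschitzWith κ.C κ.A :=
  lipschitzWith_of_nnnorm_deriv_le (fun s => (κ.hasDerivAt_A s).differentiableAt) fun s => by
    rw [(κ.hasDerivAt_A s).deriv]; exact κ.bound s

theorem abs_A_le (κ : BLip) (s : ℝ) : |κ.A s| ≤ κ.C * |s| := by
  simpa [Real.dist_eq] using κ.lipschitzWith_A.dist_le_mul s 0

end BLip

namespace Sobolev

/-- Assemble an element of `H^k` from a tuple in `L²`, by orthogonal projection. -/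
def pack (k : ℕ) : (Fin (k + 1) → LTwo) →L[ℝ] Sobolev k :=
  (sobolevSubmodule k).orthogonalProjectionOnto.comp
    (PiLp.continuousLinearEquiv 2 ℝ fun _ : Fin (k + 1) => LTwo).symm.toContinuousLinearMap

/-- A projection fixes its range. As `pack` is linear and continuous on arbitrary tuples, continuity
of maps into H^k can be checked one component at a time. -/
theorem pack_D {k : ℕ} (v : Sobolev k) : pack k (fun j => D j v) = v := by
  have : (PiLp.continuousLinearEquiv 2 ℝ fun _ : Fin (k + 1) => LTwo).symm (fun j => D j v) =
      v.1 := rfl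
  simp only [pack, ContinuousLinearMap.comp_apply, ContinuousLinearEquiv.coe_coe]
  rw [this]
  exact Submodule.orthogonalProjectionOnto_mem_subspace_eq_self v

theorem continuous_of_D {X : Type*} [TopologicalSpace X] {f : X → Sobolev 1}
    (h0 : Continuous fun x => D 0 (f x)) (h1 : Continuous fun x => D 1 (f x)) : Continuous f := by
  have : f = fun x => pack 1 (fun j => D j (f x)) := funext fun x => (pack_D _).symm
  rw [this]
  refine (pack 1).continuous.comp (continuous_pi fun j => ?_)
  fin_cases j
  exacts [h0, h1]

/-- Multiplication by the continuous representative of an element of `H¹`. -/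
def mulRep (v : Sobolev 1) : LTwo →L[ℝ] LTwo :=
  mulCLM (rep v) (2 * ‖v‖) (continuous_rep v) (abs_rep_le v)

theorem coeFn_mulRep (v : Sobolev 1) (f : LTwo) : mulRep v f =ᵐ[volume] fun z => rep v z * f z :=
  coeFn_mulCLM _ _ f

theorem norm_mulRep_le (v : Sobolev 1) (f : LTwo) : ‖mulRep v f‖ ≤ 2 * ‖v‖ * ‖f‖ :=
  norm_mulCLM_le _ _ f

theorem coeFn_mulRep_add (v w : Sobolev 1) :
    (mulRep w (D 1 v) + mulRep v (D 1 w) : LTwo) =ᵐ[volume]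
      fun z => (D 1 v) z * rep w z + rep v z * (D 1 w) z := by
  filter_upwards [Lp.coeFn_add (mulRep w (D 1 v)) (mulRep v (D 1 w)), coeFn_mulRep w (D 1 v),
    coeFn_mulRep v (D 1 w)] with z h1 h2 h3
  rw [h1, Pi.add_apply, h2, h3, mul_comm (rep w z)]

theorem coeFn_mulRep_D_zero (v w : Sobolev 1) :
    mulRep v (D 0 w) =ᵐ[volume] fun z => rep v z * rep w z := by
  filter_upwards [coeFn_mulRep v (D 0 w), coe_ae_eq_rep w] with z h1 h2
  rw [h1, h2]

/-- The product of two elements of `H¹`. -/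
def mulAux (v w : Sobolev 1) : Sobolev 1 :=
  ofPrimitive ((isPrimitive_rep v).mul (isPrimitive_rep w))
    ((memLp_congr_ae (coeFn_mulRep_D_zero v w)).1 (Lp.memLp _))
    ((memLp_congr_ae (coeFn_mulRep_add v w)).1 (Lp.memLp _))

theorem rep_mulAux (v w : Sobolev 1) : rep (mulAux v w) = fun z => rep v z * rep w z :=
  rep_ofPrimitive _ _ _

theorem D_zero_mulAux (v w : Sobolev 1) : D 0 (mulAux v w) = mulRep v (D 0 w) :=
  Lp.ext ((D_zero_ofPrimitive _ _ _).trans (coeFn_mulRep_D_zero v w).symm)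

theorem D_one_mulAux (v w : Sobolev 1) :
    D 1 (mulAux v w) = mulRep w (D 1 v) + mulRep v (D 1 w) :=
  Lp.ext ((D_one_ofPrimitive _ _ _).trans (coeFn_mulRep_add v w).symm)

theorem norm_mulAux_le (v w : Sobolev 1) : ‖mulAux v w‖ ≤ 6 * ‖v‖ * ‖w‖ := by
  refine (norm_le_add _).trans ?_
  rw [D_zero_mulAux, D_one_mulAux]
  have h1 := norm_mulRep_le v (D 0 w)
  have h2 := norm_mulRep_le w (D 1 v)
  have h3 := norm_mulRep_le v (D 1 w)
  have h4 := norm_add_le (mulRep w (D 1 v)) (mulRep v (D 1 w))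
  have h5 := mul_le_mul_of_nonneg_left (norm_D_zero_le w) (norm_nonneg v)
  have h6 := mul_le_mul_of_nonneg_left (norm_D_one_le w) (norm_nonneg v)
  have h7 := mul_le_mul_of_nonneg_left (norm_D_one_le v) (norm_nonneg w)
  nlinarith

/-- Multiplication in the Banach algebra `H¹`. -/
def mulH : Sobolev 1 →L[ℝ] Sobolev 1 →L[ℝ] Sobolev 1 :=
  LinearMap.mkContinuous₂
    (LinearMap.mk₂ ℝ mulAux
      (fun v v' w => ext_rep (by simp only [rep_mulAux, rep_add, add_mul]))
      (fun c v w => ext_rep (by simp only [rep_mulAux, rep_smul, mul_assoc]))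
      (fun v w w' => ext_rep (by simp only [rep_mulAux, rep_add, mul_add]))
      (fun c v w => ext_rep (by
        simp only [rep_mulAux, rep_smul]; funext z; ring))) 6 norm_mulAux_le

theorem rep_mulH (v w : Sobolev 1) : rep (mulH v w) = fun z => rep v z * rep w z :=
  rep_mulAux v w

/-- Multiplication by `κ(θ)`, for a bounded Lipschitz function `κ` and `θ ∈ H¹`. -/
def M (κ : BLip) (θ : Sobolev 1) : LTwo →L[ℝ] LTwo :=
  mulCLM (fun z => κ (rep θ z)) κ.C (κ.continuous.comp (continuous_rep θ)) fun _ => κ.bound _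

theorem coeFn_M (κ : BLip) (θ : Sobolev 1) (f : LTwo) :
    M κ θ f =ᵐ[volume] fun z => κ (rep θ z) * f z := coeFn_mulCLM _ _ f

theorem norm_M_le (κ : BLip) (θ : Sobolev 1) (f : LTwo) : ‖M κ θ f‖ ≤ κ.C * ‖f‖ :=
  norm_mulCLM_le _ _ f

theorem norm_M_sub_le (κ : BLip) (θ η : Sobolev 1) (f : LTwo) :
    ‖M κ θ f - M κ η f‖ ≤ κ.C * (2 * ‖θ - η‖) * ‖f‖ := by
  refine Lp.norm_le_mul_norm_of_ae_le_mul ?_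
  filter_upwards [Lp.coeFn_sub (M κ θ f) (M κ η f), coeFn_M κ θ f, coeFn_M κ η f] with z h1 h2 h3
  rw [h1, Pi.sub_apply, h2, h3, ← sub_mul, norm_mul]
  refine mul_le_mul_of_nonneg_right ?_ (norm_nonneg _)
  have h4 := κ.lip.dist_le_mul (rep θ z) (rep η z)
  rw [Real.dist_eq, Real.dist_eq, ← rep_sub] at h4
  exact h4.trans (mul_le_mul_of_nonneg_left (abs_rep_le _ z) κ.C.2)

theorem continuous_M (κ : BLip) : Continuous (M κ) := by
  have : LipschitzWith (κ.C * 2) (M κ) := LipschitzWith.of_dist_le_mul fun θ η => by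
    rw [dist_eq_norm, dist_eq_norm]
    refine ContinuousLinearMap.opNorm_le_bound _ (by positivity) fun f => ?_
    refine (norm_M_sub_le κ θ η f).trans (le_of_eq ?_)
    push_cast; ring
  exact this.continuous

/-- The composition `s ↦ ∫₀ˢ κ` of an element of `H¹` with the primitive of `κ`. -/
def nem (κ : BLip) (θ : Sobolev 1) : Sobolev 1 :=
  ofPrimitive ((isPrimitive_rep θ).comp κ.lipschitzWith_A κ.hasDerivAt_A)
    (κ.lipschitzWith_A.comp_memLp κ.A_zero (memLp_rep θ))
    ((memLp_congr_ae (coeFn_M κ θ (D 1 θ))).1 (Lp.memLp _))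

@[simp] theorem rep_nem (κ : BLip) (θ : Sobolev 1) : rep (nem κ θ) = fun z => κ.A (rep θ z) :=
  rep_ofPrimitive _ _ _

theorem D_one_nem (κ : BLip) (θ : Sobolev 1) : D 1 (nem κ θ) = M κ θ (D 1 θ) :=
  Lp.ext ((D_one_ofPrimitive _ _ _).trans (coeFn_M κ θ _).symm)

theorem D_zero_nem (κ : BLip) (θ : Sobolev 1) :
    D 0 (nem κ θ) = κ.lipschitzWith_A.compLp κ.A_zero (D 0 θ) := by
  refine Lp.ext ((D_zero_ofPrimitive _ _ _).trans ?_)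
  filter_upwards [κ.lipschitzWith_A.coeFn_compLp κ.A_zero (D 0 θ), coe_ae_eq_rep θ] with z h1 h2
  rw [h1, Function.comp_apply, h2]

theorem continuous_nem (κ : BLip) : Continuous (nem κ) := by
  refine continuous_of_D ?_ ?_
  · simp_rw [D_zero_nem]
    exact (κ.lipschitzWith_A.continuous_compLp κ.A_zero).comp (D 0).continuous
  · simp_rw [D_one_nem]
    exact (continuous_M κ).clm_apply (D 1).continuous

end Sobolev

/-! ### The elliptic problem -/

/-- Bounded Lipschitz coefficients of a uniformly elliptic operator, normalised at the origin. -/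
structure Coeff where
  /-- the coefficient of the second order term -/
  a : BLip
  /-- the coefficient of the zeroth order term -/
  b : BLip
  /-- the ellipticity constant -/
  δ : ℝ
  δ_pos : 0 < δ
  le_a : ∀ s, δ ≤ a s
  le_b : ∀ s, δ ≤ b s
  a_zero : a 0 = 1

namespace Sobolev

theorem le_inner_M {κ : BLip} {δ : ℝ} (h : ∀ s, δ ≤ κ s) (θ : Sobolev 1) (f : LTwo) :
    δ * ‖f‖ ^ 2 ≤ inner ℝ (M κ θ f) f := by
  rw [L2_norm_sq_eq, L2.inner_def, ← integral_const_mul]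
  refine integral_mono_ae ((Lp.memLp f).integrable_sq.const_mul δ) (L2.integrable_inner _ _) ?_
  filter_upwards [coeFn_M κ θ f] with z hz
  simp only [hz, RCLike.inner_apply, conj_trivial]
  nlinarith [mul_nonneg (sub_nonneg.2 (h (rep θ z))) (sq_nonneg (f z))]

end Sobolev

namespace Coeff

open Sobolev

variable (c : Coeff)

theorem lipschitzWith_a_sub_one : LipschitzWith c.a.C fun s => c.a s - 1 :=
  LipschitzWith.of_dist_le_mul fun x y => by simpa using c.a.lip.dist_le_mul x y

theorem a_sub_one_zero : c.a 0 - 1 = 0 := by rw [c.a_zero, sub_self]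

/-- The function `a(θ) - 1` in `L²`. -/
def R (θ : Sobolev 1) : LTwo := c.lipschitzWith_a_sub_one.compLp c.a_sub_one_zero (D 0 θ)

theorem coeFn_R (θ : Sobolev 1) : c.R θ =ᵐ[volume] fun z => c.a (rep θ z) - 1 := by
  filter_upwards [c.lipschitzWith_a_sub_one.coeFn_compLp c.a_sub_one_zero (D 0 θ),
    coe_ae_eq_rep θ] with z h1 h2
  rw [R, h1, Function.comp_apply, h2]

theorem norm_R_le (θ : Sobolev 1) : ‖c.R θ‖ ≤ c.a.C * ‖θ‖ :=
  (c.lipschitzWith_a_sub_one.norm_compLp_le c.a_sub_one_zero _).trans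
    (mul_le_mul_of_nonneg_left (norm_D_zero_le θ) c.a.C.2)

theorem norm_R_sub_le (θ η : Sobolev 1) : ‖c.R θ - c.R η‖ ≤ c.a.C * ‖θ - η‖ := by
  refine (c.lipschitzWith_a_sub_one.norm_compLp_sub_le c.a_sub_one_zero _ _).trans ?_
  rw [← map_sub]
  exact mul_le_mul_of_nonneg_left (norm_D_zero_le _) c.a.C.2

theorem continuous_R : Continuous c.R :=
  (c.lipschitzWith_a_sub_one.continuous_compLp c.a_sub_one_zero).comp (D 0).continuous

/-- The bilinear form of the elliptic operator with coefficients `a(θ)`, `b(θ)`. -/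
def form (θ : Sobolev 1) : Sobolev 1 →L[ℝ] Sobolev 1 →L[ℝ] ℝ :=
  LinearMap.mkContinuous₂
    (LinearMap.mk₂ ℝ (fun u γ => (inner ℝ (M c.a θ (D 1 u)) (D 1 γ) +
        inner ℝ (M c.b θ (D 0 u)) (D 0 γ) : ℝ))
      (fun u v γ => by simp only [map_add, inner_add_left]; ring)
      (fun r u γ => by simp only [map_smul, real_inner_smul_left, smul_eq_mul]; ring)
      (fun u v γ => by simp only [map_add, inner_add_right]; ring)
      (fun r u γ => by simp only [map_smul, real_inner_smul_right, smul_eq_mul]; ring))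
    (c.a.C + c.b.C) fun u γ => by
      rw [LinearMap.mk₂_apply, add_mul, add_mul]
      refine (norm_add_le _ _).trans (add_le_add ?_ ?_)
      · refine (norm_inner_le_norm _ _).trans (mul_le_mul ((norm_M_le _ _ _).trans ?_)
          (norm_D_one_le _) (norm_nonneg _) (by positivity))
        exact mul_le_mul_of_nonneg_left (norm_D_one_le _) c.a.C.2
      · refine (norm_inner_le_norm _ _).trans (mul_le_mul ((norm_M_le _ _ _).trans ?_)
          (norm_D_zero_le _) (norm_nonneg _) (by positivity))
        exact mul_le_mul_of_nonneg_left (norm_D_zero_le _) c.b.C.2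

theorem form_apply (θ u γ : Sobolev 1) : c.form θ u γ =
    inner ℝ (M c.a θ (D 1 u)) (D 1 γ) + inner ℝ (M c.b θ (D 0 u)) (D 0 γ) := rfl

theorem le_form (θ u : Sobolev 1) : c.δ * ‖u‖ ^ 2 ≤ c.form θ u u := by
  rw [form_apply, norm_sq_eq, mul_add, add_comm]
  exact add_le_add (le_inner_M c.le_a θ _) (le_inner_M c.le_b θ _)

theorem isCoercive_form (θ : Sobolev 1) : IsCoercive (c.form θ) :=
  ⟨c.δ, c.δ_pos, fun u => by rw [mul_assoc, ← sq]; exact c.le_form θ u⟩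

/-- The solution `u ∈ H¹` of `-(a(θ) u_z)_z + b(θ) u = -a(θ)_z`. -/
def U (θ : Sobolev 1) : Sobolev 1 :=
  (c.isCoercive_form θ).continuousLinearEquivOfBilin.symm
    ((ContinuousLinearMap.adjoint (D 1 : Sobolev 1 →L[ℝ] LTwo)) (c.R θ))

/-- The datum -a(θ)_z acts as γ ↦ ⟨a(θ) - 1, γ_z⟩, the constant being subtracted to have a factor in
L². Its Riesz representative is the adjoint of `D 1` applied to `c.R θ`, and Lax-Milgram gives `U`.
-/
theorem form_U (θ γ : Sobolev 1) : c.form θ (c.U θ) γ = inner ℝ (c.R θ) (D 1 γ) := by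
  rw [← IsCoercive.continuousLinearEquivOfBilin_apply (c.isCoercive_form θ), U,
    ContinuousLinearEquiv.apply_symm_apply, ContinuousLinearMap.adjoint_inner_left]

theorem eq_U {θ u : Sobolev 1} (h : ∀ γ, c.form θ u γ = inner ℝ (c.R θ) (D 1 γ)) : u = c.U θ := by
  have h1 : c.form θ (u - c.U θ) (u - c.U θ) = 0 := by
    rw [map_sub (c.form θ), _root_.sub_apply, h, form_U, sub_self]
  have h2 := c.le_form θ (u - c.U θ)
  rw [h1] at h2
  have h3 : ‖u - c.U θ‖ ^ 2 ≤ 0 := by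
    by_contra hne
    nlinarith [mul_pos c.δ_pos (not_le.1 hne)]
  exact sub_eq_zero.1 (norm_eq_zero.1
    (pow_eq_zero_iff two_ne_zero |>.1 (le_antisymm h3 (sq_nonneg _))))

theorem norm_le_of_form_le {θ d : Sobolev 1} {K : ℝ} (hK : 0 ≤ K)
    (h : c.form θ d d ≤ K * ‖d‖) : ‖d‖ ≤ K / c.δ := by
  rw [le_div_iff₀ c.δ_pos]
  have h1 := c.le_form θ d
  rcases (norm_nonneg d).eq_or_lt with h0 | h0
  · rw [← h0]; simpa using hK
  · nlinarith

theorem norm_U_le (θ : Sobolev 1) : ‖c.U θ‖ ≤ c.a.C * ‖θ‖ / c.δ := by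
  refine c.norm_le_of_form_le (by positivity) (θ := θ) ?_
  rw [form_U]
  exact (real_inner_le_norm _ _).trans (mul_le_mul (c.norm_R_le θ) (norm_D_one_le _)
    (norm_nonneg _) (by positivity))

/-- Subtract the two weak equations and test with the difference d of the solutions: coercivity at θ
bounds δ‖d‖² by the change in the datum and in the coefficients acting on `c.U η`. -/
theorem norm_U_sub_le (θ η : Sobolev 1) : ‖c.U θ - c.U η‖ ≤
    (c.a.C + 2 * (c.a.C + c.b.C) * ‖c.U η‖) * ‖θ - η‖ / c.δ := by
  refine c.norm_le_of_form_le (by positivity) (θ := θ) ?_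
  set d := c.U θ - c.U η with hd
  have h1 : c.form θ d d = inner ℝ (c.R θ - c.R η) (D 1 d) -
      inner ℝ (M c.a θ (D 1 (c.U η)) - M c.a η (D 1 (c.U η))) (D 1 d) -
      inner ℝ (M c.b θ (D 0 (c.U η)) - M c.b η (D 0 (c.U η))) (D 0 d) := by
    have e1 : c.form θ d d = c.form θ (c.U θ) d - c.form θ (c.U η) d := by
      rw [← _root_.sub_apply, ← map_sub]
    have e2 := c.form_U η d
    rw [e1, form_U, form_apply]
    rw [form_apply] at e2
    simp only [inner_sub_left]
    linarith
  have b1 : inner ℝ (c.R θ - c.R η) (D 1 d) ≤ c.a.C * ‖θ - η‖ * ‖d‖ :=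
    (real_inner_le_norm _ _).trans (mul_le_mul (c.norm_R_sub_le θ η) (norm_D_one_le _)
      (norm_nonneg _) (by positivity))
  have b2 : -inner ℝ (M c.a θ (D 1 (c.U η)) - M c.a η (D 1 (c.U η))) (D 1 d) ≤
      c.a.C * (2 * ‖θ - η‖) * ‖c.U η‖ * ‖d‖ := by
    refine (neg_le_abs _).trans ((abs_real_inner_le_norm _ _).trans ?_)
    refine mul_le_mul ((norm_M_sub_le _ _ _ _).trans ?_) (norm_D_one_le _)
      (norm_nonneg _) (by positivity)
    exact mul_le_mul_of_nonneg_left (norm_D_one_le _) (by positivity)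
  have b3 : -inner ℝ (M c.b θ (D 0 (c.U η)) - M c.b η (D 0 (c.U η))) (D 0 d) ≤
      c.b.C * (2 * ‖θ - η‖) * ‖c.U η‖ * ‖d‖ := by
    refine (neg_le_abs _).trans ((abs_real_inner_le_norm _ _).trans ?_)
    refine mul_le_mul ((norm_M_sub_le _ _ _ _).trans ?_) (norm_D_zero_le _)
      (norm_nonneg _) (by positivity)
    exact mul_le_mul_of_nonneg_left (norm_D_zero_le _) (by positivity)
  rw [h1]
  linarith

/-- On bounded sets of `H¹` the solution operator is Lipschitz. -/
theorem exists_lipschitzOnWith_U (ρ : ℝ) :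
    ∃ K : ℝ≥0, LipschitzOnWith K c.U {θ | ‖θ‖ ≤ ρ} := by
  refine ⟨Real.toNNReal ((c.a.C + 2 * (c.a.C + c.b.C) * (c.a.C * ρ / c.δ)) / c.δ),
    LipschitzOnWith.of_dist_le_mul fun θ _ η hη => ?_⟩
  have hδ := c.δ_pos
  have hρ : 0 ≤ ρ := (norm_nonneg η).trans hη
  rw [Real.coe_toNNReal _ (by positivity), dist_eq_norm, dist_eq_norm]
  refine (c.norm_U_sub_le θ η).trans ?_
  rw [div_mul_eq_mul_div]
  have h1 : ‖c.U η‖ ≤ c.a.C * ρ / c.δ := (c.norm_U_le η).trans (by gcongr; exact hη)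
  gcongr

theorem continuous_U : Continuous c.U := by
  rw [continuous_iff_continuousAt]
  intro θ
  obtain ⟨K, hK⟩ := c.exists_lipschitzOnWith_U (‖θ‖ + 1)
  refine hK.continuousOn.continuousAt ?_
  filter_upwards [(continuous_norm.tendsto θ).eventually (gt_mem_nhds (lt_add_one ‖θ‖))] with η hη
  exact hη.le

/-- The weak equation says that the flux a u_z - (a - 1) has weak derivative b u. The flux is then
in H¹, and integration by parts in H¹ admits every γ ∈ H¹ without a density argument for test
functions. -/
theorem isWeakDeriv_iff_eq_U (θ u : Sobolev 1) :
    IsWeakDeriv (M c.a θ (D 1 u) - c.R θ) (M c.b θ (D 0 u)) ↔ u = c.U θ := by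
  constructor
  · intro h
    refine c.eq_U fun γ => ?_
    have h1 := inner_D_one_add_inner_D_zero (ofPair _ _ h) γ
    rw [D_zero_ofPair, D_one_ofPair, inner_sub_left] at h1
    rw [form_apply]
    linarith
  · rintro rfl
    rw [isWeakDeriv_iff]
    intro γ hγ
    have h1 := c.form_U θ (ofPrimitive hγ.isPrimitive hγ.memLp hγ.memLp_deriv)
    rw [form_apply] at h1
    change (inner ℝ _ (hγ.memLp_deriv.toLp _) : ℝ) + inner ℝ _ (hγ.memLp.toLp _) =
      inner ℝ _ (hγ.memLp_deriv.toLp _) at h1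
    rw [real_inner_comm, real_inner_comm (M c.b θ (D 0 (c.U θ))), inner_sub_left]
    linarith

/-- The solution operator gives exactly the weak solutions of the elliptic equation. -/
theorem isEllipticSolution_iff {n m : ℝ} {φ : ℝ → ℝ} {θ : Sobolev 1} (u : Sobolev 1)
    (ha : ∀ z, c.a (rep θ z) = φ z ^ n) (hb : ∀ z, c.b (rep θ z) = φ z ^ m) :
    IsEllipticSolution n m φ u ↔ u = c.U θ := by
  rw [← c.isWeakDeriv_iff_eq_U, IsEllipticSolution, IsWeakDeriv]
  refine forall_congr' fun γ => forall_congr' fun hγ => ?_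
  have i1 : Integrable fun z => (M c.a θ (D 1 u)) z * deriv γ z :=
    (Lp.memLp _).integrable_mul hγ.memLp_deriv
  have i2 : Integrable fun z => (M c.b θ (D 0 u)) z * γ z := (Lp.memLp _).integrable_mul hγ.memLp
  have i3 : Integrable fun z => (c.R θ) z * deriv γ z :=
    (Lp.memLp _).integrable_mul hγ.memLp_deriv
  have i4 : Integrable (deriv γ) :=
    (hγ.1.continuous_deriv (by simp)).integrable_of_hasCompactSupport hγ.2.deriv
  -- This allows φⁿ to be replaced by φⁿ - 1 on the right-hand side.
  have e0 : ∫ z, deriv γ z = 0 := by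
    refine hγ.isPrimitive.integral_eq_zero i4 ?_
    have := hγ.2
    rw [hasCompactSupport_iff_eventuallyEq, coclosedCompact_eq_cocompact] at this
    exact tendsto_nhds_of_eventually_eq this
  have e1 : ∫ z, (φ z ^ n * u.wderiv 1 z * deriv γ z + φ z ^ m * u.wderiv 0 z * γ z) =
      (∫ z, (M c.a θ (D 1 u)) z * deriv γ z) + ∫ z, (M c.b θ (D 0 u)) z * γ z := by
    rw [← integral_add i1 i2]
    refine integral_congr_ae ?_
    filter_upwards [coeFn_M c.a θ (D 1 u), coeFn_M c.b θ (D 0 u)] with z h1 h2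
    rw [h1, h2, ha, hb]; rfl
  have e2 : ∫ z, φ z ^ n * deriv γ z = ∫ z, (c.R θ) z * deriv γ z := by
    rw [← add_zero (∫ z, (c.R θ) z * deriv γ z), ← e0, ← integral_add i3 i4]
    refine integral_congr_ae ?_
    filter_upwards [c.coeFn_R θ] with z h1
    rw [h1, ha]; ring
  have e3 : ∫ z, (M c.a θ (D 1 u) - c.R θ : LTwo) z * deriv γ z =
      (∫ z, (M c.a θ (D 1 u)) z * deriv γ z) - ∫ z, (c.R θ) z * deriv γ z := by
    rw [← integral_sub i1 i3]
    refine integral_congr_ae ?_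
    filter_upwards [Lp.coeFn_sub (M c.a θ (D 1 u)) (c.R θ)] with z h1
    rw [h1, Pi.sub_apply]; ring
  rw [e1, e2, e3]
  constructor <;> intro h <;> linarith

/-- The flux `a(θ) u_z - (a(θ) - 1)`, an element of `H¹` with derivative `b(θ) u`. -/
def flux (θ : Sobolev 1) : Sobolev 1 :=
  ofPair _ _ ((c.isWeakDeriv_iff_eq_U θ (c.U θ)).2 rfl)

theorem continuous_flux : Continuous c.flux := by
  refine continuous_of_D ?_ ?_
  · exact (((continuous_M c.a).clm_apply ((D 1).continuous.comp c.continuous_U)).sub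
      c.continuous_R)
  · exact ((continuous_M c.b).clm_apply ((D 0).continuous.comp c.continuous_U))

end Coeff

/-! ### The conserved energy -/

/-- A function which vanishes at the origin, decreases before and increases after, is
nonnegative. -/
theorem nonneg_of_deriv_mul_nonneg {f f' : ℝ → ℝ} (h : ∀ s, HasDerivAt f (f' s) s) (h0 : f 0 = 0)
    (hs : ∀ s, 0 ≤ f' s * s) (s : ℝ) : 0 ≤ f s := by
  have hc : Continuous f := continuous_iff_continuousAt.2 fun x => (h x).continuousAt
  rcases le_total 0 s with hs0 | hs0
  · have hm : MonotoneOn f (Ici 0) := by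
      refine monotoneOn_of_deriv_nonneg (convex_Ici 0) hc.continuousOn
        (fun x _ => (h x).differentiableAt.differentiableWithinAt) fun x hx => ?_
      rw [interior_Ici] at hx
      rw [(h x).deriv]
      exact nonneg_of_mul_nonneg_left (hs x) hx
    rw [← h0]
    exact hm self_mem_Ici hs0 hs0
  · have hm : AntitoneOn f (Iic 0) := by
      refine antitoneOn_of_deriv_nonpos (convex_Iic 0) hc.continuousOn
        (fun x _ => (h x).differentiableAt.differentiableWithinAt) fun x hx => ?_
      rw [interior_Iic] at hx
      rw [(h x).deriv]
      by_contra hne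
      exact absurd (hs x) (not_le.2 (mul_neg_of_pos_of_neg (not_le.1 hne) hx))
    rw [← h0]
    exact hm hs0 self_mem_Iic hs0

namespace Coeff

open Sobolev

variable (c : Coeff)

theorem a_pos (s : ℝ) : 0 < c.a s := c.δ_pos.trans_le (c.le_a s)

theorem b_pos (s : ℝ) : 0 < c.b s := c.δ_pos.trans_le (c.le_b s)

/-- The reciprocal of the leading coefficient. -/
def inva : BLip where
  toFun s := (c.a s)⁻¹
  C := Real.toNNReal (c.δ⁻¹ + c.a.C / c.δ ^ 2)
  bound s := by
    have hδ := c.δ_pos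
    rw [Real.coe_toNNReal _ (by positivity), abs_of_pos (inv_pos.2 (c.a_pos s))]
    have h1 : (c.a s)⁻¹ ≤ c.δ⁻¹ := inv_anti₀ c.δ_pos (c.le_a s)
    have h2 : 0 ≤ c.a.C / c.δ ^ 2 := by positivity
    linarith
  lip := LipschitzWith.of_dist_le_mul fun s t => by
    have hδ := c.δ_pos
    rw [Real.coe_toNNReal _ (by positivity), Real.dist_eq,
      inv_sub_inv (c.a_pos s).ne' (c.a_pos t).ne', abs_div,
      abs_of_pos (mul_pos (c.a_pos s) (c.a_pos t))]
    have h1 := c.a.lip.dist_le_mul t s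
    rw [Real.dist_eq, dist_comm] at h1
    have h2 : c.δ ^ 2 ≤ c.a s * c.a t := by
      rw [sq]; exact mul_le_mul (c.le_a s) (c.le_a t) hδ.le (c.a_pos s).le
    calc |c.a t - c.a s| / (c.a s * c.a t) ≤ (c.a.C * dist s t) / c.δ ^ 2 := by gcongr
      _ = c.a.C / c.δ ^ 2 * dist s t := by ring
      _ ≤ _ := by
        have : 0 ≤ c.δ⁻¹ := by positivity
        gcongr
        linarith

theorem inva_apply (s : ℝ) : c.inva s = (c.a s)⁻¹ := rfl

/-- The potential `∫₀ˢ q b` with `q = ∫₀ 1/a`. -/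
def pot (s : ℝ) : ℝ := ∫ r in (0 : ℝ)..s, c.inva.A r * c.b r

theorem continuous_inva_A : Continuous c.inva.A := c.inva.lipschitzWith_A.continuous

theorem hasDerivAt_pot (s : ℝ) : HasDerivAt c.pot (c.inva.A s * c.b s) s := by
  have hc : Continuous fun r => c.inva.A r * c.b r := c.continuous_inva_A.mul c.b.continuous
  exact intervalIntegral.integral_hasDerivAt_right (hc.intervalIntegrable _ _)
    hc.stronglyMeasurable.stronglyMeasurableAtFilter hc.continuousAt

theorem continuous_pot : Continuous c.pot :=
  continuous_iff_continuousAt.2 fun x => (c.hasDerivAt_pot x).continuousAt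

@[simp] theorem pot_zero : c.pot 0 = 0 := by simp [pot]

theorem a_C_pos : 0 < (c.a.C : ℝ) := by
  have := c.a.bound 0
  rw [c.a_zero, abs_one] at this
  linarith

/-- The slope 1/a of q is at least 1/‖a‖∞, so q(s) lies beyond the line of that slope on either side
of the origin. -/
theorem mul_le_inva_A_mul (s : ℝ) : (c.a.C : ℝ)⁻¹ * s ^ 2 ≤ c.inva.A s * s := by
  have hm : Monotone fun s => c.inva.A s - (c.a.C : ℝ)⁻¹ * s := by
    have hd : ∀ s, HasDerivAt (fun s => c.inva.A s - (c.a.C : ℝ)⁻¹ * s)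
        (c.inva s - (c.a.C : ℝ)⁻¹ * 1) s := fun s =>
      (c.inva.hasDerivAt_A s).sub ((hasDerivAt_id s).const_mul _)
    refine monotone_of_deriv_nonneg (fun s => (hd s).differentiableAt) fun s => ?_
    rw [(hd s).deriv, mul_one, sub_nonneg]
    exact inv_anti₀ (c.a_pos s) ((le_abs_self _).trans (c.a.bound s))
  have h0 : c.inva.A 0 - (c.a.C : ℝ)⁻¹ * 0 = 0 := by simp
  rcases le_total 0 s with hs | hs
  · have := hm hs
    simp only [h0] at this
    nlinarith
  · have := hm hs
    simp only [h0] at this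
    nlinarith

/-- The coercivity constant of the energy. -/
def ν : ℝ := c.δ * (c.a.C : ℝ)⁻¹ / 2

theorem ν_pos : 0 < c.ν := by
  have := c.δ_pos; have := c.a_C_pos; unfold ν; positivity

/-- The derivative of the difference, times s, is q(s) b(s) s - 2ν s², and q(s)s ≥ s²/`c.a.C` with b
≥ δ; ν is chosen to make this nonnegative. -/
theorem ν_mul_sq_le_pot (s : ℝ) : c.ν * s ^ 2 ≤ c.pot s := by
  have h := nonneg_of_deriv_mul_nonneg (f := fun s => c.pot s - c.ν * s ^ 2)
    (fun s => (c.hasDerivAt_pot s).sub ((hasDerivAt_pow 2 s).const_mul c.ν)) (by simp)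
    (fun s => ?_) s
  · linarith
  · have h1 := c.mul_le_inva_A_mul s
    have h2 := c.le_b s
    have h3 : 0 ≤ (c.a.C : ℝ)⁻¹ * s ^ 2 := by positivity
    have h4 : c.δ * ((c.a.C : ℝ)⁻¹ * s ^ 2) ≤ c.b s * (c.inva.A s * s) :=
      mul_le_mul h2 h1 h3 (c.b_pos s).le
    have h5 : c.ν * (2 * s) * s = c.δ * ((c.a.C : ℝ)⁻¹ * s ^ 2) := by unfold ν; ring
    simp only [Nat.cast_ofNat, Nat.add_one_sub_one, pow_one]
    nlinarith

theorem pot_nonneg (s : ℝ) : 0 ≤ c.pot s :=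
  (mul_nonneg c.ν_pos.le (sq_nonneg s)).trans (c.ν_mul_sq_le_pot s)

/-- The Taylor expansion of the potential. -/
theorem abs_pot_sub_le (s h : ℝ) : |c.pot (s + h) - c.pot s - c.inva.A s * c.b s * h| ≤
    c.inva.C * c.b.C * (1 + |s|) * h ^ 2 := by
  have hd : ∀ r ∈ uIcc s (s + h), HasDerivWithinAt (fun r => c.pot r - c.inva.A s * c.b s * r)
      (c.inva.A r * c.b r - c.inva.A s * c.b s * 1) (uIcc s (s + h)) r := fun r _ =>
    ((c.hasDerivAt_pot r).sub ((hasDerivAt_id r).const_mul _)).hasDerivWithinAt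
  have hb : ∀ r ∈ uIcc s (s + h), ‖c.inva.A r * c.b r - c.inva.A s * c.b s * 1‖ ≤
      c.inva.C * c.b.C * (1 + |s|) * |h| := by
    intro r hr
    have hrs : |r - s| ≤ |h| := by simpa using abs_sub_left_of_mem_uIcc hr
    have h1 := c.inva.lipschitzWith_A.dist_le_mul r s
    have h2 := c.b.lip.dist_le_mul r s
    rw [Real.dist_eq, Real.dist_eq] at h1 h2
    have h3 := c.inva.abs_A_le s
    have h4 := c.b.bound r
    have h5 : c.inva.A r * c.b r - c.inva.A s * c.b s * 1 =
      (c.inva.A r - c.inva.A s) * c.b r + c.inva.A s * (c.b r - c.b s) := by ring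
    rw [h5, Real.norm_eq_abs]
    calc _ ≤ |c.inva.A r - c.inva.A s| * |c.b r| + |c.inva.A s| * |c.b r - c.b s| := by
          rw [← abs_mul, ← abs_mul]; exact abs_add_le _ _
      _ ≤ (c.inva.C * |h|) * c.b.C + (c.inva.C * |s|) * (c.b.C * |h|) := by
          gcongr
          · exact h1.trans (by gcongr)
          · exact h2.trans (by gcongr)
      _ = _ := by ring
  have := (convex_uIcc s (s + h)).norm_image_sub_le_of_norm_hasDerivWithin_le hd hb
    left_mem_uIcc right_mem_uIcc
  simp only [Real.norm_eq_abs] at this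
  have e : c.pot (s + h) - c.inva.A s * c.b s * (s + h) - (c.pot s - c.inva.A s * c.b s * s) =
    c.pot (s + h) - c.pot s - c.inva.A s * c.b s * h := by ring
  rw [e] at this
  refine this.trans (le_of_eq ?_)
  rw [show s + h - s = h by ring, ← sq_abs h]; ring

theorem pot_le (s : ℝ) : c.pot s ≤ c.inva.C * c.b.C * s ^ 2 := by
  have := c.abs_pot_sub_le 0 s
  simp only [zero_add, pot_zero, BLip.A_zero, zero_mul, sub_zero, abs_zero, add_zero, mul_one]
    at this
  exact (le_abs_self _).trans this

theorem integrable_pot (θ : Sobolev 1) : Integrable fun z => c.pot (rep θ z) :=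
  ((memLp_rep θ).integrable_sq.const_mul (c.inva.C * c.b.C : ℝ)).mono'
    (c.continuous_pot.comp (continuous_rep θ)).aestronglyMeasurable
    (Eventually.of_forall fun z => by
      rw [Real.norm_eq_abs, abs_of_nonneg (c.pot_nonneg _)]; exact c.pot_le _)

/-- The conserved energy. -/
def energy (θ : Sobolev 1) : ℝ := 1 / 2 * ‖D 1 θ‖ ^ 2 + ∫ z, c.pot (rep θ z)

theorem norm_D_zero_sq_eq (θ : Sobolev 1) : ‖D 0 θ‖ ^ 2 = ∫ z, rep θ z ^ 2 := by
  rw [L2_norm_sq_eq]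
  exact integral_congr_ae (by filter_upwards [coe_ae_eq_rep θ] with z hz; rw [hz])

theorem norm_sq_le_energy (θ : Sobolev 1) : min (1 / 2) c.ν * ‖θ‖ ^ 2 ≤ c.energy θ := by
  have h1 : c.ν * ‖D 0 θ‖ ^ 2 ≤ ∫ z, c.pot (rep θ z) := by
    rw [norm_D_zero_sq_eq, ← integral_const_mul]
    exact integral_mono ((memLp_rep θ).integrable_sq.const_mul _) (c.integrable_pot θ)
      fun z => c.ν_mul_sq_le_pot _
  have h2 := mul_le_mul_of_nonneg_right (min_le_left (1 / 2) c.ν) (sq_nonneg ‖D 1 θ‖)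
  have h3 := mul_le_mul_of_nonneg_right (min_le_right (1 / 2) c.ν) (sq_nonneg ‖D 0 θ‖)
  rw [energy, norm_sq_eq]
  linarith

/-- Functions dominated by the potential are controlled along the solution by the energy. -/
theorem abs_A_rep_le_energy {p : BLip} {C : ℝ} (hC : 0 ≤ C) (hp : ∀ s, p s ^ 2 ≤ C * c.pot s)
    (θ : Sobolev 1) (z : ℝ) : |p.A (rep θ z)| ≤ (1 + C) * c.energy θ := by
  have hi1 : Integrable fun z => (D 1 θ) z ^ 2 := (Lp.memLp _).integrable_sq
  have hi : Integrable fun z => 1 / 2 * (D 1 θ) z ^ 2 + C / 2 * c.pot (rep θ z) :=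
    (hi1.const_mul _).add ((c.integrable_pot θ).const_mul _)
  have hI : 0 ≤ ∫ z, c.pot (rep θ z) := integral_nonneg fun z => c.pot_nonneg _
  -- The integrand comes from |p θ_z| ≤ ½ θ_z² + ½ p² with p² ≤ C · pot; it dominates the derivative
  -- of `p.A (rep θ)`.
  have hle : ∫ z, (1 / 2 * (D 1 θ) z ^ 2 + C / 2 * c.pot (rep θ z)) ≤ (1 + C) * c.energy θ := by
    rw [integral_add (hi1.const_mul _) ((c.integrable_pot θ).const_mul _), integral_const_mul,
      integral_const_mul, ← L2_norm_sq_eq, energy]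
    nlinarith [mul_nonneg hC (sq_nonneg ‖D 1 θ‖), mul_nonneg hC hI]
  have hprim := (isPrimitive_rep θ).comp p.lipschitzWith_A p.hasDerivAt_A
  have hdiff : ∀ y, |p.A (rep θ z) - p.A (rep θ y)| ≤ (1 + C) * c.energy θ := by
    intro y
    rw [hprim.sub_eq y z, ← Real.norm_eq_abs]
    refine (intervalIntegral.norm_integral_le_integral_norm_uIoc).trans ?_
    refine le_trans ?_ hle
    refine le_trans (setIntegral_mono_on ?_ hi.integrableOn measurableSet_uIoc fun x _ => ?_)
      (setIntegral_le_integral hi (Eventually.of_forall fun x => ?_))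
    · exact ((intervalIntegrable_iff.1 (hprim.intervalIntegrable y z))).norm
    · have h1 := hp (rep θ x)
      rw [Real.norm_eq_abs, abs_mul]
      nlinarith [sq_nonneg (|p (rep θ x)| - |(D 1 θ) x|), sq_abs (p (rep θ x)), sq_abs ((D 1 θ) x)]
    · have := c.pot_nonneg (rep θ x)
      simp only [Pi.zero_apply]
      positivity
  -- Sending y to infinity removes the reference point, since θ vanishes there and `p.A 0 = 0`.
  have ht : Tendsto (fun y => |p.A (rep θ z) - p.A (rep θ y)|) (cocompact ℝ)
      (𝓝 |p.A (rep θ z) - 0|) := by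
    have := tendsto_rep (nem p θ)
    rw [rep_nem] at this
    exact (tendsto_const_nhds.sub this).abs
  rw [sub_zero] at ht
  exact le_of_tendsto ht (Eventually.of_forall hdiff)

/-- The second order Taylor bound for the potential is uniform in z because |θ| ≤ 2‖θ‖, so the
integrated remainder is O(‖h‖²). -/
theorem integral_pot_hasFDerivAt (θ : Sobolev 1) :
    HasFDerivAt (fun θ => ∫ z, c.pot (rep θ z))
      ((innerSL ℝ (M c.b θ (D 0 (nem c.inva θ)))).comp (D 0)) θ := by
  rw [hasFDerivAt_iff_isLittleO_nhds_zero]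
  refine Asymptotics.IsBigO.trans_isLittleO (g := fun h : Sobolev 1 => ‖h‖ ^ 2) ?_
    (Asymptotics.isLittleO_norm_pow_id one_lt_two)
  refine Asymptotics.IsBigO.of_bound (c.inva.C * c.b.C * (1 + 2 * ‖θ‖)) (Eventually.of_forall
    fun h => ?_)
  have e : ((innerSL ℝ (M c.b θ (D 0 (nem c.inva θ)))).comp (D 0)) h =
      ∫ z, c.inva.A (rep θ z) * c.b (rep θ z) * rep h z := by
    rw [ContinuousLinearMap.comp_apply, innerSL_apply_apply, L2.inner_def]
    refine integral_congr_ae ?_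
    filter_upwards [coeFn_M c.b θ (D 0 (nem c.inva θ)), coe_ae_eq_rep (nem c.inva θ),
      coe_ae_eq_rep h] with z h1 h2 h3
    rw [h1, h2, h3, rep_nem]
    simp only [RCLike.inner_apply, conj_trivial]
    ring
  have hi : Integrable fun z => c.inva.A (rep θ z) * c.b (rep θ z) * rep h z := by
    refine (L2.integrable_inner (𝕜 := ℝ) (M c.b θ (D 0 (nem c.inva θ))) (D 0 h)).congr ?_
    filter_upwards [coeFn_M c.b θ (D 0 (nem c.inva θ)), coe_ae_eq_rep (nem c.inva θ),
      coe_ae_eq_rep h] with z h1 h2 h3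
    rw [h1, h2, h3, rep_nem]
    simp only [RCLike.inner_apply, conj_trivial]
    ring
  have hi2 : Integrable fun z => c.pot (rep (θ + h) z) - c.pot (rep θ z) :=
    (c.integrable_pot _).sub (c.integrable_pot _)
  rw [e, ← integral_sub (c.integrable_pot _) (c.integrable_pot _), ← integral_sub hi2 hi]
  refine (norm_integral_le_integral_norm _).trans ?_
  rw [norm_pow, norm_norm]
  calc _ ≤ ∫ z, c.inva.C * c.b.C * (1 + 2 * ‖θ‖) * rep h z ^ 2 := by
        refine integral_mono_of_nonneg (Eventually.of_forall fun z => norm_nonneg _)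
          ((memLp_rep h).integrable_sq.const_mul _) (Eventually.of_forall fun z => ?_)
        simp only [rep_add, Real.norm_eq_abs]
        refine (c.abs_pot_sub_le _ _).trans ?_
        have := abs_rep_le θ z
        gcongr
    _ ≤ _ := by
        rw [integral_const_mul, ← norm_D_zero_sq_eq]
        have := norm_D_zero_le h
        gcongr

/-- The derivative of the energy. -/
def energyDeriv (θ : Sobolev 1) : Sobolev 1 →L[ℝ] ℝ :=
  (innerSL ℝ (D 1 θ)).comp (D 1) + (innerSL ℝ (M c.b θ (D 0 (nem c.inva θ)))).comp (D 0)

theorem energy_hasFDerivAt (θ : Sobolev 1) : HasFDerivAt c.energy (c.energyDeriv θ) θ := by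
  have h1 : HasFDerivAt (fun θ : Sobolev 1 => 1 / 2 * ‖D 1 θ‖ ^ 2)
      ((innerSL ℝ (D 1 θ)).comp (D 1)) θ := by
    have := ((D 1 : Sobolev 1 →L[ℝ] LTwo).hasFDerivAt (x := θ)).norm_sq.const_mul (1 / 2 : ℝ)
    convert! this using 1
    ext h
    simp
  exact h1.add (c.integral_pot_hasFDerivAt θ)

/-- The integrand (a(θ) - 1) θ_z / a(θ) is the total derivative of θ - q(θ), which vanishes at both
ends. -/
theorem inner_R_M_inva_eq_zero (θ : Sobolev 1) :
    inner ℝ (c.R θ) (M c.inva θ (D 1 θ)) = (0 : ℝ) := by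
  have hp := (isPrimitive_rep θ).add ((isPrimitive_rep (nem c.inva θ)).const_mul (-1))
  have hae : (fun z => (D 1 θ) z + -1 * (D 1 (nem c.inva θ)) z) =ᵐ[volume]
      fun z => inner ℝ ((c.R θ) z) ((M c.inva θ (D 1 θ)) z) := by
    rw [D_one_nem]
    filter_upwards [coeFn_M c.inva θ (D 1 θ), c.coeFn_R θ] with z h1 h2
    rw [h1, h2, inva_apply]
    simp only [RCLike.inner_apply, conj_trivial]
    have := (c.a_pos (rep θ z)).ne'
    field_simp
    ring
  rw [L2.inner_def, ← integral_congr_ae hae]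
  refine hp.integral_eq_zero ((L2.integrable_inner _ _).congr hae.symm) ?_
  simpa using (tendsto_rep θ).add ((tendsto_rep (nem c.inva θ)).const_mul (-1))

theorem inner_M_a_M_inva (θ : Sobolev 1) (f g : LTwo) :
    inner ℝ (M c.a θ f) (M c.inva θ g) = (inner ℝ g f : ℝ) := by
  rw [L2.inner_def, L2.inner_def]
  refine integral_congr_ae ?_
  filter_upwards [coeFn_M c.a θ f, coeFn_M c.inva θ g] with z h1 h2
  rw [h1, h2, inva_apply]
  simp only [RCLike.inner_apply, conj_trivial]
  have := (c.a_pos (rep θ z)).ne'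
  field_simp

theorem inner_M_comm (κ : BLip) (θ : Sobolev 1) (f g : LTwo) :
    inner ℝ (M κ θ f) g = (inner ℝ (M κ θ g) f : ℝ) := by
  rw [L2.inner_def, L2.inner_def]
  refine integral_congr_ae ?_
  filter_upwards [coeFn_M κ θ f, coeFn_M κ θ g] with z h1 h2
  rw [h1, h2]
  simp only [RCLike.inner_apply, conj_trivial]
  ring

/-- Test the elliptic equation with q(θ), whose derivative is θ_z / a(θ): the left side becomes
⟨u_z, θ_z⟩ + ⟨b u, q(θ)⟩, which is the derivative of the energy along u, and the right side is the
integral of a total derivative. -/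
theorem energyDeriv_U (θ : Sobolev 1) : c.energyDeriv θ (c.U θ) = 0 := by
  have h := c.form_U θ (nem c.inva θ)
  rw [form_apply, D_one_nem, inner_R_M_inva_eq_zero, inner_M_a_M_inva, inner_M_comm c.b] at h
  exact h

/-- Conservation of energy, also under a scalar change of the speed. -/
theorem energy_eq_of_hasDerivAt {y : ℝ → Sobolev 1} {r : ℝ → ℝ}
    (hy : ∀ t, HasDerivAt y (r t • c.U (y t)) t) (t : ℝ) : c.energy (y t) = c.energy (y 0) := by
  have hd : ∀ t, HasDerivAt (fun t => c.energy (y t)) 0 t := fun t => by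
    have := (c.energy_hasFDerivAt (y t)).comp_hasDerivAt t (hy t)
    rwa [map_smul, energyDeriv_U, smul_zero] at this
  exact is_const_of_deriv_eq_zero (fun t => (hd t).differentiableAt) (fun t => (hd t).deriv) t 0

end Coeff

/-! ### Global integral curves -/

/-- A bounded Lipschitz autonomous vector field on a Banach space is complete. -/
theorem exists_forall_hasDerivAt_of_bounded {E : Type*} [NormedAddCommGroup E] [NormedSpace ℝ E]
    [CompleteSpace E] {V : E → E} {K L : ℝ≥0} (hV : LipschitzWith K V) (hL : ∀ x, ‖V x‖ ≤ L)
    (x₀ : E) : ∃ y : ℝ → E, y 0 = x₀ ∧ ∀ t, HasDerivAt y (V (y t)) t := by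
  have hex : ∀ N : ℕ, ∃ y : ℝ → E, y 0 = x₀ ∧
      ∀ t ∈ Icc (-(N + 1 : ℝ)) (N + 1),
        HasDerivWithinAt y (V (y t)) (Icc (-(N + 1 : ℝ)) (N + 1)) t := by
    intro N
    have h0 : (0 : ℝ) ∈ Icc (-(N + 1 : ℝ)) (N + 1) :=
      ⟨by linarith [N.cast_nonneg (α := ℝ)], by positivity⟩
    -- A curve of speed at most L travels at most L(N + 1) in this time, so a ball of that radius
    -- gives existence on the whole interval; the intervals exhaust the line as N grows.
    have hPL : IsPicardLindelof (fun _ => V) (⟨0, h0⟩ : Icc (-(N + 1 : ℝ)) (N + 1)) x₀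
        (L * (N + 1)) 0 L K :=
      { lipschitzOnWith := fun t _ => hV.lipschitzOnWith
        continuousOn := fun x _ => continuousOn_const
        norm_le := fun t _ x _ => hL x
        mul_max_le := by simp }
    exact hPL.exists_eq_forall_mem_Icc_hasDerivWithinAt₀
  choose y hy0 hy using hex
  have hyd : ∀ N : ℕ, ∀ t ∈ Ioo (-(N + 1 : ℝ)) (N + 1), HasDerivAt (y N) (V (y N t)) t :=
    fun N t ht => (hy N t (Ioo_subset_Icc_self ht)).hasDerivAt (Icc_mem_nhds ht.1 ht.2)
  have hag : ∀ N N' : ℕ, N ≤ N' → ∀ t ∈ Ioo (-(N + 1 : ℝ)) (N + 1), y N t = y N' t := by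
    intro N N' hNN' t ht
    have hc : (N : ℝ) ≤ N' := by exact_mod_cast hNN'
    exact ODE_solution_unique_of_mem_Ioo (v := fun _ => V) (s := fun _ => univ) (K := K) (t₀ := 0)
      (fun _ _ => hV.lipschitzOnWith) ⟨by linarith [N.cast_nonneg (α := ℝ)], by positivity⟩
      (fun s hs => ⟨hyd N s hs, trivial⟩)
      (fun s hs => ⟨hyd N' s ⟨by linarith [hs.1], by linarith [hs.2]⟩, trivial⟩)
      ((hy0 N).trans (hy0 N').symm) ht
  have hmem : ∀ t : ℝ, t ∈ Ioo (-(⌈|t|⌉₊ + 1 : ℝ)) (⌈|t|⌉₊ + 1) := fun t => by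
    have h1 := Nat.le_ceil |t|
    exact ⟨by linarith [neg_abs_le t], by linarith [le_abs_self t]⟩
  -- Gluing: the index ⌈|t|⌉₊ puts t in the open interval where `hyd` applies, and `hag` makes the
  -- choice of index irrelevant near t.
  refine ⟨fun t => y ⌈|t|⌉₊ t, by simpa using hy0 _, fun t => ?_⟩
  have heq : ∀ s ∈ Ioo (-(⌈|t|⌉₊ + 1 : ℝ)) (⌈|t|⌉₊ + 1), y ⌈|s|⌉₊ s = y ⌈|t|⌉₊ s := by
    intro s hs
    rcases le_total ⌈|s|⌉₊ ⌈|t|⌉₊ with h | h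
    · exact hag _ _ h s (hmem s)
    · exact (hag _ _ h s hs).symm
  refine (hyd _ t (hmem t)).congr_of_eventuallyEq ?_
  filter_upwards [Ioo_mem_nhds (hmem t).1 (hmem t).2] with s hs using heq s hs

/-- The cut-off equal to one on the ball of radius `ρ` and to zero outside that of radius
`ρ + 1`. -/
def cutoff (ρ r : ℝ) : ℝ := max 0 (min 1 (ρ + 1 - r))

theorem cutoff_nonneg (ρ r : ℝ) : 0 ≤ cutoff ρ r := le_max_left _ _

theorem cutoff_le_one (ρ r : ℝ) : cutoff ρ r ≤ 1 := max_le zero_le_one (min_le_left _ _)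

theorem cutoff_eq_one {ρ r : ℝ} (h : r ≤ ρ) : cutoff ρ r = 1 := by
  rw [cutoff, min_eq_left (by linarith), max_eq_right zero_le_one]

theorem cutoff_eq_zero {ρ r : ℝ} (h : ρ + 1 ≤ r) : cutoff ρ r = 0 :=
  max_eq_left ((min_le_right _ _).trans (by linarith))

theorem abs_cutoff_sub_le (ρ r s : ℝ) : |cutoff ρ r - cutoff ρ s| ≤ |r - s| := by
  have h1 := abs_max_sub_max_le_abs (min 1 (ρ + 1 - r)) (min 1 (ρ + 1 - s)) 0
  have h2 := abs_min_sub_min_le_max 1 (ρ + 1 - r) 1 (ρ + 1 - s)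
  rw [cutoff, cutoff, max_comm, max_comm 0]
  refine h1.trans (h2.trans ?_)
  rw [sub_self, abs_zero, max_eq_right (abs_nonneg _), abs_sub_comm r s]
  exact le_of_eq (by congr 1; ring)

/-- Estimate with the bound on V at a point inside the larger ball, the Lipschitz bound being needed
only when both points are inside; by symmetry one such point suffices, and outside the product is
zero. -/
theorem lipschitzWith_cutoff_smul {E : Type*} [NormedAddCommGroup E] [NormedSpace ℝ E]
    {V : E → E} {K L : ℝ≥0} {ρ : ℝ} (hV : LipschitzOnWith K V {x | ‖x‖ ≤ ρ + 1})
    (hL : ∀ x, ‖x‖ ≤ ρ + 1 → ‖V x‖ ≤ L) :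
    LipschitzWith (K + L) fun x => cutoff ρ ‖x‖ • V x := by
  have key : ∀ x y : E, ‖x‖ ≤ ρ + 1 →
      ‖cutoff ρ ‖x‖ • V x - cutoff ρ ‖y‖ • V y‖ ≤ (K + L) * ‖x - y‖ := by
    intro x y hx
    have hχ : |cutoff ρ ‖x‖ - cutoff ρ ‖y‖| ≤ ‖x - y‖ :=
      (abs_cutoff_sub_le _ _ _).trans (abs_norm_sub_norm_le x y)
    have hdec : cutoff ρ ‖x‖ • V x - cutoff ρ ‖y‖ • V y =
        (cutoff ρ ‖x‖ - cutoff ρ ‖y‖) • V x + cutoff ρ ‖y‖ • (V x - V y) := by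
      rw [sub_smul, smul_sub]; abel
    have h1 : ‖(cutoff ρ ‖x‖ - cutoff ρ ‖y‖) • V x‖ ≤ ‖x - y‖ * L := by
      rw [norm_smul, Real.norm_eq_abs]
      exact mul_le_mul hχ (hL x hx) (norm_nonneg _) (norm_nonneg _)
    have h2 : ‖cutoff ρ ‖y‖ • (V x - V y)‖ ≤ K * ‖x - y‖ := by
      rcases le_total ‖y‖ (ρ + 1) with hy | hy
      · rw [norm_smul, Real.norm_eq_abs, abs_of_nonneg (cutoff_nonneg _ _)]
        have h3 := hV.dist_le_mul x hx y hy
        rw [dist_eq_norm, dist_eq_norm] at h3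
        calc _ ≤ 1 * (K * ‖x - y‖) :=
              mul_le_mul (cutoff_le_one _ _) h3 (norm_nonneg _) zero_le_one
          _ = _ := one_mul _
      · rw [cutoff_eq_zero hy, zero_smul, norm_zero]; positivity
    rw [hdec]
    refine (norm_add_le _ _).trans ((add_le_add h1 h2).trans (le_of_eq ?_))
    ring
  refine LipschitzWith.of_dist_le_mul fun x y => ?_
  rw [dist_eq_norm, dist_eq_norm]
  push_cast
  rcases le_total ‖x‖ (ρ + 1) with hx | hx
  · exact key x y hx
  · rcases le_total ‖y‖ (ρ + 1) with hy | hy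
    · rw [norm_sub_rev, norm_sub_rev x y]; exact key y x hy
    · rw [cutoff_eq_zero hx, cutoff_eq_zero hy, zero_smul, zero_smul, sub_zero, norm_zero]
      positivity

namespace Coeff

open Sobolev

/-- Global solvability of `θ_t = U(θ)` in `H¹`, with conserved energy. -/
theorem exists_forall_hasDerivAt (c : Coeff) (θ₀ : Sobolev 1) : ∃ θ : ℝ → Sobolev 1, θ 0 = θ₀ ∧
    (∀ t, HasDerivAt θ (c.U (θ t)) t) ∧ ∀ t, c.energy (θ t) = c.energy θ₀ := by
  have hμ : 0 < min (1 / 2) c.ν := lt_min (by norm_num) c.ν_pos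
  set μ := min (1 / 2) c.ν with hμ_def
  -- The bound μ‖θ‖² ≤ E gives ‖θ‖² ≤ ρ - 1, hence ‖θ‖ ≤ ρ; the added one avoids a square root.
  set ρ := c.energy θ₀ / μ + 1 with hρ
  obtain ⟨K, hK⟩ := c.exists_lipschitzOnWith_U (ρ + 1)
  have hδ := c.δ_pos
  have hE : 0 ≤ c.energy θ₀ := (by positivity : 0 ≤ μ * ‖θ₀‖ ^ 2).trans (c.norm_sq_le_energy θ₀)
  have hρ0 : 0 ≤ ρ := by positivity
  have hL : ∀ x, ‖x‖ ≤ ρ + 1 → ‖c.U x‖ ≤ Real.toNNReal (c.a.C * (ρ + 1) / c.δ) := fun x hx => by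
    rw [Real.coe_toNNReal _ (by positivity)]
    exact (c.norm_U_le x).trans (by gcongr)
  set L := Real.toNNReal (c.a.C * (ρ + 1) / c.δ)
  have hbd : ∀ x : Sobolev 1, ‖cutoff ρ ‖x‖ • c.U x‖ ≤ L := by
    intro x
    rcases le_total ‖x‖ (ρ + 1) with hx | hx
    · rw [norm_smul, Real.norm_eq_abs, abs_of_nonneg (cutoff_nonneg _ _)]
      calc _ ≤ 1 * (L : ℝ) := mul_le_mul (cutoff_le_one _ _) (hL x hx) (norm_nonneg _) zero_le_one
        _ = _ := one_mul _
    · rw [cutoff_eq_zero hx, zero_smul, norm_zero]; exact L.2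
  obtain ⟨θ, h0, hθ⟩ := exists_forall_hasDerivAt_of_bounded
    (lipschitzWith_cutoff_smul hK hL) hbd θ₀
  -- The cut-off only rescales U by a scalar, so energy is conserved for the modified flow too. The
  -- resulting bound keeps the curve where the cut-off equals one.
  have hen : ∀ t, c.energy (θ t) = c.energy θ₀ := fun t => by
    rw [c.energy_eq_of_hasDerivAt hθ t, h0]
  refine ⟨θ, h0, fun t => ?_, hen⟩
  have hle : ‖θ t‖ ≤ ρ := by
    have h1 := c.norm_sq_le_energy (θ t)
    rw [hen, ← le_div_iff₀' hμ] at h1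
    have h2 : 0 ≤ c.energy θ₀ / μ := by positivity
    rw [hρ]
    nlinarith [norm_nonneg (θ t)]
  have h := hθ t
  simp only [cutoff_eq_one hle, one_smul] at h
  exact h

end Coeff

/-! ### Bounded Lipschitz functions from smooth functions on a compact interval -/

/-- Truncation of the argument to the interval `[α, β]`. -/
def clampFun (α β s : ℝ) : ℝ := max α (min s β)

theorem clampFun_mem {α β : ℝ} (h : α ≤ β) (s : ℝ) : clampFun α β s ∈ Icc α β :=
  ⟨le_max_left _ _, max_le h (min_le_right _ _)⟩

theorem clampFun_of_mem {α β s : ℝ} (h : s ∈ Icc α β) : clampFun α β s = s := by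
  rw [clampFun, min_eq_left h.2, max_eq_right h.1]

theorem clampFun_of_ge {α β s : ℝ} (h : α ≤ β) (hs : β ≤ s) : clampFun α β s = β := by
  rw [clampFun, min_eq_right hs, max_eq_right h]

theorem clampFun_of_le {α β s : ℝ} (h : α ≤ β) (hs : s ≤ α) : clampFun α β s = α := by
  rw [clampFun, min_eq_left (hs.trans h), max_eq_left hs]

theorem dist_clampFun_le (α β s t : ℝ) : dist (clampFun α β s) (clampFun α β t) ≤ dist s t := by
  have h1 := abs_max_sub_max_le_abs (min s β) (min t β) α
  have h2 := abs_min_sub_min_le_max s β t β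
  rw [sub_self, abs_zero, max_eq_left (abs_nonneg _)] at h2
  rw [Real.dist_eq, Real.dist_eq, clampFun, clampFun, max_comm α, max_comm α]
  exact h1.trans h2

theorem exists_bound_lipschitzWith_clamp {k : ℝ → ℝ} {α β : ℝ} (h : α ≤ β)
    (hk : ContDiffOn ℝ 1 k (Icc α β)) : ∃ C : ℝ≥0, (∀ s, |k (clampFun α β s)| ≤ C) ∧
      LipschitzWith C fun s => k (clampFun α β s) := by
  obtain ⟨K, hK⟩ := hk.exists_lipschitzOnWith (by decide) (convex_Icc _ _) isCompact_Icc
  obtain ⟨B, hB⟩ := isCompact_Icc.exists_bound_of_continuousOn hk.continuousOn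
  refine ⟨K + Real.toNNReal B, fun s => ?_, LipschitzWith.of_dist_le_mul fun s t => ?_⟩
  · have := hB _ (clampFun_mem h s)
    push_cast
    exact this.trans ((Real.le_coe_toNNReal B).trans (by simp))
  · refine (hK.dist_le_mul _ (clampFun_mem h s) _ (clampFun_mem h t)).trans ?_
    exact mul_le_mul (by simp) (dist_clampFun_le _ _ _ _) dist_nonneg (by positivity)

/-- The bounded Lipschitz function which agrees with `k` on `[α, β]` and is constant on either
side of this interval. -/
def BLip.clamp (k : ℝ → ℝ) {α β : ℝ} (h : α ≤ β) (hk : ContDiffOn ℝ 1 k (Icc α β)) : BLip where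
  toFun s := k (clampFun α β s)
  C := (exists_bound_lipschitzWith_clamp h hk).choose
  bound := (exists_bound_lipschitzWith_clamp h hk).choose_spec.1
  lip := (exists_bound_lipschitzWith_clamp h hk).choose_spec.2

theorem BLip.clamp_apply {k : ℝ → ℝ} {α β : ℝ} (h : α ≤ β) (hk : ContDiffOn ℝ 1 k (Icc α β))
    (s : ℝ) : BLip.clamp k h hk s = k (clampFun α β s) := rfl

theorem BLip.clamp_of_mem {k : ℝ → ℝ} {α β : ℝ} (h : α ≤ β) (hk : ContDiffOn ℝ 1 k (Icc α β))
    {s : ℝ} (hs : s ∈ Icc α β) : BLip.clamp k h hk s = k s := by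
  rw [clamp_apply, clampFun_of_mem hs]

theorem BLip.A_clamp_of_mem {k g : ℝ → ℝ} {α β : ℝ} (h : α ≤ β)
    (hk : ContDiffOn ℝ 1 k (Icc α β)) (h0 : (0 : ℝ) ∈ Icc α β)
    (hg : ∀ r ∈ Icc α β, HasDerivAt g (k r) r) {s : ℝ} (hs : s ∈ Icc α β) :
    (BLip.clamp k h hk).A s = g s - g 0 := by
  refine intervalIntegral.integral_eq_sub_of_hasDerivAt (fun r hr => ?_)
    ((BLip.clamp k h hk).continuous.intervalIntegrable _ _)
  have hr' := uIcc_subset_Icc h0 hs hr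
  rw [clamp_of_mem h hk hr']
  exact hg r hr'

/-! ### The change of variable `θ = ∫₁^φ r^{-m} dr` -/

/-- The new unknown as a function of the porosity. -/
def Theta (m x : ℝ) : ℝ := if m = 1 then Real.log x else (x ^ (1 - m) - 1) / (1 - m)

/-- The porosity as a function of the new unknown. -/
def Phi (m s : ℝ) : ℝ := if m = 1 then Real.exp s else (1 + (1 - m) * s) ^ (1 - m)⁻¹

/-- The range of the new unknown. -/
def thetaRange (m : ℝ) : Set ℝ := {s | 0 < 1 + (1 - m) * s}

theorem isOpen_thetaRange (m : ℝ) : IsOpen (thetaRange m) :=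
  isOpen_lt continuous_const (by fun_prop)

theorem one_add_mul_Theta (m x : ℝ) : 1 + (1 - m) * Theta m x = x ^ (1 - m) := by
  unfold Theta
  split_ifs with h
  · simp [h]
  · have : 1 - m ≠ 0 := fun h' => h (by linarith)
    field_simp
    ring

theorem Theta_mem {m x : ℝ} (hx : 0 < x) : Theta m x ∈ thetaRange m := by
  show 0 < 1 + (1 - m) * Theta m x
  rw [one_add_mul_Theta m x]
  positivity

@[simp] theorem Theta_one (m : ℝ) : Theta m 1 = 0 := by simp [Theta]

theorem hasDerivAt_Theta {m x : ℝ} (hx : 0 < x) : HasDerivAt (Theta m) (x ^ (-m)) x := by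
  unfold Theta
  split_ifs with h
  · rw [h, Real.rpow_neg_one]
    exact Real.hasDerivAt_log hx.ne'
  · have hne : 1 - m ≠ 0 := fun h' => h (by linarith)
    have h1 := ((Real.hasDerivAt_rpow_const (p := 1 - m) (Or.inl hx.ne')).sub_const 1).div_const
      (1 - m)
    convert! h1 using 1
    rw [show 1 - m - 1 = -m by ring]
    field_simp

theorem Phi_pos {m s : ℝ} (hs : s ∈ thetaRange m) : 0 < Phi m s := by
  unfold Phi
  split_ifs with h
  · exact Real.exp_pos s
  · exact Real.rpow_pos_of_pos hs _

theorem Phi_Theta {m x : ℝ} (hx : 0 < x) : Phi m (Theta m x) = x := by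
  unfold Phi
  split_ifs with h
  · simp [Theta, h, Real.exp_log hx]
  · have hne : 1 - m ≠ 0 := fun h' => h (by linarith)
    rw [one_add_mul_Theta m x, ← Real.rpow_mul hx.le, mul_inv_cancel₀ hne, Real.rpow_one]

theorem Theta_Phi {m s : ℝ} (hs : s ∈ thetaRange m) : Theta m (Phi m s) = s := by
  unfold Theta Phi
  split_ifs with h
  · simp
  · have hne : 1 - m ≠ 0 := fun h' => h (by linarith)
    have hs' : 0 < 1 + (1 - m) * s := hs
    rw [← Real.rpow_mul hs'.le, inv_mul_cancel₀ hne, Real.rpow_one]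
    field_simp
    ring

@[simp] theorem Phi_zero (m : ℝ) : Phi m 0 = 1 := by simp [Phi]

theorem hasDerivAt_Phi {m s : ℝ} (hs : s ∈ thetaRange m) :
    HasDerivAt (Phi m) (Phi m s ^ m) s := by
  have hs' : 0 < 1 + (1 - m) * s := hs
  unfold Phi
  split_ifs with h
  · rw [h, Real.rpow_one]; exact Real.hasDerivAt_exp s
  · have hne : 1 - m ≠ 0 := fun h' => h (by linarith)
    have h1 := (((hasDerivAt_id s).const_mul (1 - m)).const_add 1).rpow_const
      (p := (1 - m)⁻¹) (Or.inl hs'.ne')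
    convert! h1 using 1
    simp only [id]
    rw [← Real.rpow_mul hs'.le]
    have e : (1 - m)⁻¹ * m = (1 - m)⁻¹ - 1 := by field_simp; ring
    rw [e]
    field_simp

theorem contDiffOn_Phi (m : ℝ) : ContDiffOn ℝ ∞ (Phi m) (thetaRange m) := by
  unfold Phi
  split_ifs with h
  · exact Real.contDiff_exp.contDiffOn
  · refine ContDiffOn.rpow_const_of_ne (by fun_prop) fun s hs => ?_
    exact (show 0 < 1 + (1 - m) * s from hs).ne'

theorem Theta_strictMonoOn (m : ℝ) : StrictMonoOn (Theta m) (Ioi 0) := by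
  refine strictMonoOn_of_deriv_pos (convex_Ioi 0)
    (fun x hx => (hasDerivAt_Theta hx).continuousAt.continuousWithinAt) fun x hx => ?_
  rw [interior_Ioi] at hx
  rw [(hasDerivAt_Theta hx).deriv]
  exact Real.rpow_pos_of_pos hx _

/-- Powers of the porosity are smooth functions of the new unknown. -/
theorem contDiffOn_Phi_rpow (m r : ℝ) : ContDiffOn ℝ ∞ (fun s => Phi m s ^ r) (thetaRange m) :=
  (contDiffOn_Phi m).rpow_const_of_ne fun _ hs => (Phi_pos hs).ne'

theorem hasDerivAt_Phi_rpow {m s : ℝ} (r : ℝ) (hs : s ∈ thetaRange m) :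
    HasDerivAt (fun s => Phi m s ^ r) (r * Phi m s ^ (r + m - 1)) s := by
  convert! (hasDerivAt_Phi hs).rpow_const (p := r) (Or.inl (Phi_pos hs).ne') using 1
  rw [show r + m - 1 = m + (r - 1) by ring, Real.rpow_add (Phi_pos hs)]
  ring

/-! ### Truncation to the values with |log φ| ≤ ℓ -/

/-- The lower end of the interval of values of the unknown for which `|log φ| ≤ ℓ`. -/
def lo (m ℓ : ℝ) : ℝ := Theta m (Real.exp (-ℓ))

/-- The upper end of the interval of values of the unknown for which `|log φ| ≤ ℓ`. -/
def hi (m ℓ : ℝ) : ℝ := Theta m (Real.exp ℓ)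

theorem lo_le_zero (m : ℝ) {ℓ : ℝ} (hℓ : 0 ≤ ℓ) : lo m ℓ ≤ 0 := by
  rw [← Theta_one m]
  exact (Theta_strictMonoOn m).monotoneOn (Real.exp_pos _) (mem_Ioi.2 one_pos)
    (Real.exp_le_one_iff.2 (by linarith))

theorem zero_le_hi (m : ℝ) {ℓ : ℝ} (hℓ : 0 ≤ ℓ) : 0 ≤ hi m ℓ := by
  rw [← Theta_one m]
  exact (Theta_strictMonoOn m).monotoneOn (mem_Ioi.2 one_pos) (Real.exp_pos _) (Real.one_le_exp hℓ)

theorem lo_le_hi (m : ℝ) {ℓ : ℝ} (hℓ : 0 ≤ ℓ) : lo m ℓ ≤ hi m ℓ :=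
  (lo_le_zero m hℓ).trans (zero_le_hi m hℓ)

theorem zero_mem_Icc (m : ℝ) {ℓ : ℝ} (hℓ : 0 ≤ ℓ) : (0 : ℝ) ∈ Icc (lo m ℓ) (hi m ℓ) :=
  ⟨lo_le_zero m hℓ, zero_le_hi m hℓ⟩

theorem Icc_subset_thetaRange (m ℓ : ℝ) : Icc (lo m ℓ) (hi m ℓ) ⊆ thetaRange m := by
  intro s hs
  have h1 : 0 < 1 + (1 - m) * lo m ℓ := Theta_mem (Real.exp_pos _)
  have h2 : 0 < 1 + (1 - m) * hi m ℓ := Theta_mem (Real.exp_pos _)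
  show 0 < 1 + (1 - m) * s
  rcases le_total 0 (1 - m) with h | h
  · nlinarith [mul_le_mul_of_nonneg_left hs.1 h]
  · nlinarith [mul_le_mul_of_nonpos_left hs.2 h]

theorem Phi_mem_Icc {m ℓ s : ℝ} (hs : s ∈ Icc (lo m ℓ) (hi m ℓ)) :
    Phi m s ∈ Icc (Real.exp (-ℓ)) (Real.exp ℓ) := by
  have hJ := Icc_subset_thetaRange m ℓ hs
  have h1 := Theta_Phi hJ
  have hm := Theta_strictMonoOn m
  constructor
  · by_contra h
    have := hm (Phi_pos hJ) (Real.exp_pos _) (not_le.1 h)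
    rw [h1] at this
    exact absurd hs.1 (not_le.2 this)
  · by_contra h
    have := hm (Real.exp_pos _) (Phi_pos hJ) (not_le.1 h)
    rw [h1] at this
    exact absurd hs.2 (not_le.2 this)

theorem Theta_mem_Icc {m ℓ x : ℝ} (hx : x ∈ Icc (Real.exp (-ℓ)) (Real.exp ℓ)) :
    Theta m x ∈ Icc (lo m ℓ) (hi m ℓ) := by
  have hx0 : 0 < x := (Real.exp_pos _).trans_le hx.1
  exact ⟨(Theta_strictMonoOn m).monotoneOn (Real.exp_pos _) hx0 hx.1,
    (Theta_strictMonoOn m).monotoneOn hx0 (Real.exp_pos _) hx.2⟩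

/-- The truncation of a smooth function of the unknown to the values with `|log φ| ≤ ℓ`. -/
def trunc (m : ℝ) {ℓ : ℝ} (hℓ : 0 ≤ ℓ) (k : ℝ → ℝ) (hk : ContDiffOn ℝ ∞ k (thetaRange m)) : BLip :=
  BLip.clamp k (lo_le_hi m hℓ) ((hk.mono (Icc_subset_thetaRange m ℓ)).of_le (by simp))

theorem trunc_of_mem {m ℓ : ℝ} (hℓ : 0 ≤ ℓ) {k : ℝ → ℝ} (hk : ContDiffOn ℝ ∞ k (thetaRange m))
    {s : ℝ} (hs : s ∈ Icc (lo m ℓ) (hi m ℓ)) : trunc m hℓ k hk s = k s :=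
  BLip.clamp_of_mem _ _ hs

theorem trunc_A_of_mem {m ℓ : ℝ} (hℓ : 0 ≤ ℓ) {k g : ℝ → ℝ}
    (hk : ContDiffOn ℝ ∞ k (thetaRange m)) (hg : ∀ s ∈ thetaRange m, HasDerivAt g (k s) s)
    {s : ℝ} (hs : s ∈ Icc (lo m ℓ) (hi m ℓ)) : (trunc m hℓ k hk).A s = g s - g 0 :=
  BLip.A_clamp_of_mem _ _ (zero_mem_Icc m hℓ)
    (fun r hr => hg r (Icc_subset_thetaRange m ℓ hr)) hs

/-- The truncated powers of the porosity. -/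
def powB (m : ℝ) {ℓ : ℝ} (hℓ : 0 ≤ ℓ) (r : ℝ) : BLip :=
  trunc m hℓ (fun s => Phi m s ^ r) (contDiffOn_Phi_rpow m r)

theorem powB_of_mem {m ℓ : ℝ} (hℓ : 0 ≤ ℓ) (r : ℝ) {s : ℝ} (hs : s ∈ Icc (lo m ℓ) (hi m ℓ)) :
    powB m hℓ r s = Phi m s ^ r := trunc_of_mem hℓ _ hs

theorem powB_A_of_mem {m ℓ : ℝ} (hℓ : 0 ≤ ℓ) {s : ℝ} (hs : s ∈ Icc (lo m ℓ) (hi m ℓ)) :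
    (powB m hℓ m).A s = Phi m s - 1 := by
  rw [powB, trunc_A_of_mem hℓ _ (fun s hs => hasDerivAt_Phi hs) hs, Phi_zero]

theorem le_rpow_of_mem {ℓ x : ℝ} (hx : x ∈ Icc (Real.exp (-ℓ)) (Real.exp ℓ)) (r : ℝ) :
    Real.exp (-(|r| * ℓ)) ≤ x ^ r := by
  have hx0 : 0 < x := (Real.exp_pos _).trans_le hx.1
  rw [Real.rpow_def_of_pos hx0, Real.exp_le_exp]
  have h1 : |Real.log x| ≤ ℓ := abs_le.2
    ⟨(Real.le_log_iff_exp_le hx0).2 hx.1, (Real.log_le_iff_le_exp hx0).2 hx.2⟩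
  have h2 : |Real.log x * r| ≤ |r| * ℓ := by
    rw [abs_mul, mul_comm]; exact mul_le_mul_of_nonneg_left h1 (abs_nonneg r)
  linarith [neg_abs_le (Real.log x * r)]

/-- The truncated coefficients `φⁿ`, `φᵐ` as functions of the unknown. -/
def coeff (n m : ℝ) {ℓ : ℝ} (hℓ : 0 ≤ ℓ) : Coeff where
  a := powB m hℓ n
  b := powB m hℓ m
  δ := Real.exp (-((|n| + |m|) * ℓ))
  δ_pos := Real.exp_pos _
  le_a s := by
    refine le_trans (Real.exp_le_exp.2 ?_)
      (le_rpow_of_mem (Phi_mem_Icc (clampFun_mem (lo_le_hi m hℓ) s)) n)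
    nlinarith [mul_nonneg (abs_nonneg m) hℓ]
  le_b s := by
    refine le_trans (Real.exp_le_exp.2 ?_)
      (le_rpow_of_mem (Phi_mem_Icc (clampFun_mem (lo_le_hi m hℓ) s)) m)
    nlinarith [mul_nonneg (abs_nonneg n) hℓ]
  a_zero := by rw [powB_of_mem hℓ n (zero_mem_Icc m hℓ)]; simp

theorem coeff_a_of_mem (n : ℝ) {m ℓ : ℝ} (hℓ : 0 ≤ ℓ) {s : ℝ} (hs : s ∈ Icc (lo m ℓ) (hi m ℓ)) :
    (coeff n m hℓ).a s = Phi m s ^ n := powB_of_mem hℓ n hs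

theorem coeff_b_of_mem (n : ℝ) {m ℓ : ℝ} (hℓ : 0 ≤ ℓ) {s : ℝ} (hs : s ∈ Icc (lo m ℓ) (hi m ℓ)) :
    (coeff n m hℓ).b s = Phi m s ^ m := powB_of_mem hℓ m hs

/-! ### The potential energy in terms of the porosity -/

/-- The potential energy density as a function of the porosity, with `q = n + m - 2`. -/
def potPhi (q x : ℝ) : ℝ := (x ^ (-q) - 1 + q * (x - 1)) / (q * (q + 1))

theorem coeff_inva_A_of_mem {n m ℓ : ℝ} (hnm : 3 ≤ n + m) (hℓ : 0 ≤ ℓ) {s : ℝ}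
    (hs : s ∈ Icc (lo m ℓ) (hi m ℓ)) :
    (coeff n m hℓ).inva.A s = (1 - Phi m s ^ (1 - n - m)) / (n + m - 1) := by
  have hne : n + m - 1 ≠ 0 := by linarith
  have hd : ∀ r ∈ uIcc 0 s, HasDerivAt (fun s => -(Phi m s ^ (1 - n - m)) / (n + m - 1))
      ((coeff n m hℓ).inva r) r := by
    intro r hr
    have hr' := uIcc_subset_Icc (zero_mem_Icc m hℓ) hs hr
    have hJ := Icc_subset_thetaRange m ℓ hr'
    convert! ((hasDerivAt_Phi_rpow (1 - n - m) hJ).neg).div_const (n + m - 1) using 1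
    rw [Coeff.inva_apply, coeff_a_of_mem n hℓ hr', ← Real.rpow_neg (Phi_pos hJ).le,
      show 1 - n - m + m - 1 = -n by ring]
    field_simp
    ring
  rw [BLip.A, intervalIntegral.integral_eq_sub_of_hasDerivAt hd
    ((coeff n m hℓ).inva.continuous.intervalIntegrable _ _), Phi_zero, Real.one_rpow]
  ring

theorem coeff_pot_of_mem {n m ℓ : ℝ} (hnm : 3 ≤ n + m) (hℓ : 0 ≤ ℓ) {s : ℝ}
    (hs : s ∈ Icc (lo m ℓ) (hi m ℓ)) :
    (coeff n m hℓ).pot s = potPhi (n + m - 2) (Phi m s) := by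
  have hne : n + m - 1 ≠ 0 := by linarith
  have hne2 : n + m - 2 ≠ 0 := by linarith
  have hne3 : n + m - 2 + 1 ≠ 0 := by linarith
  have hd : ∀ r ∈ uIcc 0 s, HasDerivAt (fun s => potPhi (n + m - 2) (Phi m s))
      ((coeff n m hℓ).inva.A r * (coeff n m hℓ).b r) r := by
    intro r hr
    have hr' := uIcc_subset_Icc (zero_mem_Icc m hℓ) hs hr
    have hJ := Icc_subset_thetaRange m ℓ hr'
    have h1 := (((hasDerivAt_Phi_rpow (-(n + m - 2)) hJ).sub_const 1).add
      (((hasDerivAt_Phi hJ).sub_const 1).const_mul (n + m - 2))).div_const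
        ((n + m - 2) * (n + m - 2 + 1))
    convert! h1 using 1
    rw [coeff_inva_A_of_mem hnm hℓ hr', coeff_b_of_mem n hℓ hr',
      show -(n + m - 2) + m - 1 = (1 - n - m) + m by ring, Real.rpow_add (Phi_pos hJ),
      show n + m - 2 + 1 = n + m - 1 by ring]
    field_simp
    ring
  have hc : Continuous fun r => (coeff n m hℓ).inva.A r * (coeff n m hℓ).b r :=
    (coeff n m hℓ).continuous_inva_A.mul (coeff n m hℓ).b.continuous
  rw [Coeff.pot, intervalIntegral.integral_eq_sub_of_hasDerivAt hd (hc.intervalIntegrable _ _),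
    Phi_zero]
  simp [potPhi]

/-- The coercivity of the potential energy. -/
theorem sq_le_potPhi {q m x : ℝ} (hq : 1 ≤ q) (hm1 : 2 - q ≤ 2 * m) (hm2 : 2 * m ≤ 3)
    (hx : 0 < x) :
    ((x - 1) / (x * (x + 1)) * x ^ m) ^ 2 ≤ q * (q + 1) * potPhi q x := by
  have hq1 : 0 < q * (q + 1) := by positivity
  have hpot : q * (q + 1) * potPhi q x = x ^ (-q) - 1 + q * (x - 1) := by
    unfold potPhi; field_simp
  have hlhs : ((x - 1) / (x * (x + 1)) * x ^ m) ^ 2 =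
      x ^ (2 * m - 2) * ((x - 1) ^ 2 / (x + 1) ^ 2) := by
    have e : x ^ (2 * m - 2) = (x ^ m) ^ 2 / x ^ 2 := by
      rw [Real.rpow_sub hx, mul_comm 2 m, Real.rpow_mul hx.le]; norm_cast
    rw [e]; field_simp
  have hfrac : (x - 1) ^ 2 / (x + 1) ^ 2 ≤ (x - 1) ^ 2 / x ^ 2 := by gcongr; linarith
  have hfrac1 : (x - 1) ^ 2 / (x + 1) ^ 2 ≤ (x - 1) ^ 2 :=
    div_le_self (sq_nonneg _) (by nlinarith)
  rw [hpot, hlhs]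
  rcases le_total 1 x with h1 | h1
  -- For x ≥ 1 the exponent 2m - 2 is at most 1. Bernoulli's inequality at 1/x bounds the right side
  -- below by q (x - 1)²/x.
  · have hp : x ^ (2 * m - 2) ≤ x := by
      calc x ^ (2 * m - 2) ≤ x ^ (1 : ℝ) := Real.rpow_le_rpow_of_exponent_le h1 (by linarith)
        _ = x := Real.rpow_one x
    have hb : 1 + q * (x⁻¹ - 1) ≤ x ^ (-q) := by
      have := one_add_mul_self_le_rpow_one_add (s := x⁻¹ - 1) (by
        have := inv_pos.2 hx; linarith) hq
      rwa [add_sub_cancel, Real.inv_rpow hx.le, ← Real.rpow_neg hx.le] at this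
    calc x ^ (2 * m - 2) * ((x - 1) ^ 2 / (x + 1) ^ 2) ≤ x * ((x - 1) ^ 2 / x ^ 2) := by
          gcongr
      _ = (x - 1) ^ 2 / x := by field_simp
      _ ≤ q * ((x - 1) ^ 2 / x) := le_mul_of_one_le_left (by positivity) hq
      _ = q * (x⁻¹ - 1) + q * (x - 1) := by field_simp; ring
      _ ≤ _ := by linarith
  -- For x ≤ 1 the exponent 2m - 2 is at least -q. It remains to show x^{-q} x (2 - x) ≥ 1 + q(1 -
  -- x), which follows by multiplying `hb` by 2 - x = 1 + (1 - x) and dropping (q - 1)(1 - x)².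
  · have hp : x ^ (2 * m - 2) ≤ x ^ (-q) :=
      Real.rpow_le_rpow_of_exponent_ge hx h1 (by linarith)
    have hb : 1 + (q - 1) * (1 - x) ≤ x ^ (1 - q) := by
      rw [Real.rpow_def_of_pos hx]
      have h2 := Real.add_one_le_exp (Real.log x * (1 - q))
      have h3 := Real.log_le_sub_one_of_pos hx
      nlinarith
    have hmul : x ^ (1 - q) = x * x ^ (-q) := by
      rw [show 1 - q = 1 + -q by ring, Real.rpow_add hx, Real.rpow_one]
    have hA : 0 < x ^ (-q) := Real.rpow_pos_of_pos hx _
    calc x ^ (2 * m - 2) * ((x - 1) ^ 2 / (x + 1) ^ 2) ≤ x ^ (-q) * (x - 1) ^ 2 := by gcongr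
      _ ≤ _ := by
        rw [hmul] at hb
        have h4 : (1 + (q - 1) * (1 - x)) * (2 - x) ≤ x * x ^ (-q) * (2 - x) :=
          mul_le_mul_of_nonneg_right hb (by linarith)
        nlinarith [mul_nonneg (sub_nonneg.2 hq) (sq_nonneg (1 - x))]

open Sobolev

/-! ### A priori bounds from the energy -/

/-- The derivative q b of the potential has the sign of s, so moving s towards an interval
containing the origin lowers the potential. -/
theorem Coeff.pot_clampFun_le (c : Coeff) {α β : ℝ} (hα : α ≤ 0) (hβ : 0 ≤ β) (s : ℝ) :
    c.pot (clampFun α β s) ≤ c.pot s := by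
  have hαβ := hα.trans hβ
  have hsign : ∀ s, 0 ≤ (c.inva.A s * c.b s) * s := fun s => by
    have h1 := c.mul_le_inva_A_mul s
    have h2 : 0 ≤ (c.a.C : ℝ)⁻¹ * s ^ 2 := by positivity
    nlinarith [mul_nonneg (h2.trans h1) (c.b_pos s).le]
  rcases le_total s α with h | h
  · rw [clampFun_of_le hαβ h]
    have hm : AntitoneOn c.pot (Iic 0) := by
      refine antitoneOn_of_deriv_nonpos (convex_Iic 0) c.continuous_pot.continuousOn
        (fun x _ => (c.hasDerivAt_pot x).differentiableAt.differentiableWithinAt) fun x hx => ?_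
      rw [interior_Iic] at hx
      rw [(c.hasDerivAt_pot x).deriv]
      by_contra hne
      exact absurd (hsign x) (not_le.2 (mul_neg_of_pos_of_neg (not_le.1 hne) hx))
    exact hm (h.trans hα) hα h
  rcases le_total s β with h' | h'
  · rw [clampFun_of_mem ⟨h, h'⟩]
  · rw [clampFun_of_ge hαβ h']
    have hm : MonotoneOn c.pot (Ici 0) := by
      refine monotoneOn_of_deriv_nonneg (convex_Ici 0) c.continuous_pot.continuousOn
        (fun x _ => (c.hasDerivAt_pot x).differentiableAt.differentiableWithinAt) fun x hx => ?_
      rw [interior_Ici] at hx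
      rw [(c.hasDerivAt_pot x).deriv]
      exact nonneg_of_mul_nonneg_left (hsign x) hx
    exact hm hβ (hβ.trans h') h'

/-- The derivative of `2 log (1 + φ) - log φ` with respect to the unknown. -/
def barrier (m s : ℝ) : ℝ := (Phi m s - 1) / (Phi m s * (Phi m s + 1)) * Phi m s ^ m

theorem contDiffOn_barrier (m : ℝ) : ContDiffOn ℝ ∞ (barrier m) (thetaRange m) := by
  refine ContDiffOn.mul (ContDiffOn.div ((contDiffOn_Phi m).sub contDiffOn_const)
    ((contDiffOn_Phi m).mul ((contDiffOn_Phi m).add contDiffOn_const)) fun s hs => ?_)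
    (contDiffOn_Phi_rpow m m)
  have := Phi_pos hs
  positivity

/-- The truncated barrier function. -/
def barrierB (m : ℝ) {ℓ : ℝ} (hℓ : 0 ≤ ℓ) : BLip := trunc m hℓ (barrier m) (contDiffOn_barrier m)

theorem barrierB_A_of_mem {m ℓ : ℝ} (hℓ : 0 ≤ ℓ) {s : ℝ} (hs : s ∈ Icc (lo m ℓ) (hi m ℓ)) :
    (barrierB m hℓ).A s = 2 * Real.log (1 + Phi m s) - Real.log (Phi m s) - 2 * Real.log 2 := by
  have hg : ∀ s ∈ thetaRange m, HasDerivAt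
      (fun s => 2 * Real.log (1 + Phi m s) - Real.log (Phi m s)) (barrier m s) s := by
    intro s hs
    have hp := Phi_pos hs
    have h1 := ((((hasDerivAt_Phi hs).const_add 1).log (by positivity)).const_mul 2).sub
      ((hasDerivAt_Phi hs).log hp.ne')
    convert! h1 using 1
    unfold barrier
    field_simp
    ring
  rw [barrierB, trunc_A_of_mem hℓ _ hg hs, Phi_zero, Real.log_one]
  norm_num

/-- With q = n + m - 2, the hypotheses are q ≥ 1, 2 - q ≤ 2m and, by subtraction, 2m < 3. The
constant does not depend on ℓ, which is what allows ℓ to be chosen afterwards. -/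
theorem barrierB_sq_le {n m ℓ : ℝ} (hnm : 3 ≤ n + m) (hlow : 4 ≤ n + 3 * m)
    (hup : n + 3 * m < 6) (hℓ : 0 ≤ ℓ) (s : ℝ) :
    barrierB m hℓ s ^ 2 ≤
      ((n + m - 2) * (n + m - 2 + 1)) * (coeff n m hℓ).pot s := by
  have hmem := clampFun_mem (lo_le_hi m hℓ) s
  have h1 : barrierB m hℓ s = barrier m (clampFun (lo m ℓ) (hi m ℓ) s) := rfl
  have hC : 0 ≤ (n + m - 2) * (n + m - 2 + 1) := by nlinarith
  refine le_trans ?_ (mul_le_mul_of_nonneg_left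
    ((coeff n m hℓ).pot_clampFun_le (lo_le_zero m hℓ) (zero_le_hi m hℓ) s) hC)
  rw [coeff_pot_of_mem hnm hℓ hmem, h1]
  exact sq_le_potPhi (by linarith) (by linarith) (by linarith)
    (Phi_pos (Icc_subset_thetaRange m ℓ hmem))

theorem barrierB_nonneg {m ℓ : ℝ} (hℓ : 0 ≤ ℓ) {s : ℝ} (hs : 0 ≤ s) : 0 ≤ barrierB m hℓ s := by
  have h0 := zero_le_hi m hℓ
  have hmem := clampFun_mem (lo_le_hi m hℓ) s
  have h1 : barrierB m hℓ s = barrier m (clampFun (lo m ℓ) (hi m ℓ) s) := rfl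
  have h2 : 0 ≤ clampFun (lo m ℓ) (hi m ℓ) s := le_max_of_le_right (le_min hs h0)
  have hJ := Icc_subset_thetaRange m ℓ hmem
  have hp := Phi_pos hJ
  have h3 : 1 ≤ Phi m (clampFun (lo m ℓ) (hi m ℓ) s) := by
    by_contra hlt
    have := Theta_strictMonoOn m hp (mem_Ioi.2 one_pos) (not_le.1 hlt)
    rw [Theta_Phi hJ, Theta_one] at this
    linarith
  rw [h1, barrier]
  have := sub_nonneg.2 h3
  positivity

theorem barrierB_nonpos {m ℓ : ℝ} (hℓ : 0 ≤ ℓ) {s : ℝ} (hs : s ≤ 0) : barrierB m hℓ s ≤ 0 := by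
  have h0 := lo_le_zero m hℓ
  have hmem := clampFun_mem (lo_le_hi m hℓ) s
  have h1 : barrierB m hℓ s = barrier m (clampFun (lo m ℓ) (hi m ℓ) s) := rfl
  have h2 : clampFun (lo m ℓ) (hi m ℓ) s ≤ 0 := max_le h0 ((min_le_left _ _).trans hs)
  have hJ := Icc_subset_thetaRange m ℓ hmem
  have hp := Phi_pos hJ
  have h3 : Phi m (clampFun (lo m ℓ) (hi m ℓ) s) ≤ 1 := by
    by_contra hlt
    have := Theta_strictMonoOn m (mem_Ioi.2 one_pos) hp (not_le.1 hlt)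
    rw [Theta_Phi hJ, Theta_one] at this
    linarith
  rw [h1, barrier]
  refine mul_nonpos_of_nonpos_of_nonneg (div_nonpos_of_nonpos_of_nonneg (by linarith) ?_) ?_ <;>
    positivity

/-- A bound on the energy keeps the porosity away from zero and infinity. -/
theorem rep_mem_Icc_of_energy {n m ℓ : ℝ} (hnm : 3 ≤ n + m) (hlow : 4 ≤ n + 3 * m)
    (hup : n + 3 * m < 6) (hℓ : 0 ≤ ℓ) {θ : Sobolev 1}
    (hE : (1 + (n + m - 2) * (n + m - 2 + 1)) * (coeff n m hℓ).energy θ < ℓ - 2 * Real.log 2)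
    (z : ℝ) : rep θ z ∈ Icc (lo m ℓ) (hi m ℓ) := by
  have hC : 0 ≤ (n + m - 2) * (n + m - 2 + 1) := by nlinarith
  have hA := (coeff n m hℓ).abs_A_rep_le_energy hC (barrierB_sq_le hnm hlow hup hℓ) θ z
  set p := barrierB m hℓ with hp
  have hc : Continuous p.A := p.lipschitzWith_A.continuous
  have hmono : MonotoneOn p.A (Ici 0) := by
    refine monotoneOn_of_deriv_nonneg (convex_Ici 0) hc.continuousOn
      (fun x _ => (p.hasDerivAt_A x).differentiableAt.differentiableWithinAt) fun x hx => ?_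
    rw [interior_Ici] at hx
    rw [(p.hasDerivAt_A x).deriv]
    exact barrierB_nonneg hℓ (le_of_lt hx)
  have hanti : AntitoneOn p.A (Iic 0) := by
    refine antitoneOn_of_deriv_nonpos (convex_Iic 0) hc.continuousOn
      (fun x _ => (p.hasDerivAt_A x).differentiableAt.differentiableWithinAt) fun x hx => ?_
    rw [interior_Iic] at hx
    rw [(p.hasDerivAt_A x).deriv]
    exact barrierB_nonpos hℓ (le_of_lt hx)
  have hbd : p.A (rep θ z) < ℓ - 2 * Real.log 2 := (le_abs_self _).trans_lt (hA.trans_lt hE)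
  have hlo := lo_le_zero m hℓ
  have hhi := zero_le_hi m hℓ
  constructor
  · by_contra h
    -- At φ = e^{-ℓ} the barrier is 2 log(1 + e^{-ℓ}) + ℓ - 2 log 2 ≥ ℓ - 2 log 2, and it is no
    -- smaller further out.
    have h1 := hanti ((not_le.1 h).le.trans hlo) hlo (not_le.1 h).le
    rw [barrierB_A_of_mem hℓ ⟨le_rfl, lo_le_hi m hℓ⟩, lo, Phi_Theta (Real.exp_pos _),
      Real.log_exp] at h1
    have h2 : 0 ≤ Real.log (1 + Real.exp (-ℓ)) := Real.log_nonneg (by linarith [Real.exp_pos (-ℓ)])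
    linarith
  · by_contra h
    -- At φ = e^ℓ the barrier is 2 log(1 + e^ℓ) - ℓ - 2 log 2, again at least ℓ - 2 log 2.
    have h1 := hmono hhi (hhi.trans (not_le.1 h).le) (not_le.1 h).le
    rw [barrierB_A_of_mem hℓ ⟨lo_le_hi m hℓ, le_rfl⟩, hi, Phi_Theta (Real.exp_pos _),
      Real.log_exp] at h1
    have h2 : ℓ ≤ Real.log (1 + Real.exp ℓ) := by
      rw [Real.le_log_iff_exp_le (by positivity)]; linarith
    linarith

/-- The energy of data with values in the untruncated range does not depend on the truncation. -/
theorem energy_coeff_eq {n m ℓ ℓ' : ℝ} (hnm : 3 ≤ n + m) (hℓ : 0 ≤ ℓ) (hℓ' : 0 ≤ ℓ')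
    {θ : Sobolev 1} (h : ∀ z, rep θ z ∈ Icc (lo m ℓ) (hi m ℓ))
    (h' : ∀ z, rep θ z ∈ Icc (lo m ℓ') (hi m ℓ')) :
    (coeff n m hℓ).energy θ = (coeff n m hℓ').energy θ := by
  simp only [Coeff.energy, coeff_pot_of_mem hnm hℓ (h _), coeff_pot_of_mem hnm hℓ' (h' _)]

theorem Icc_lo_hi_subset {m ℓ ℓ' : ℝ} (h : ℓ ≤ ℓ') :
    Icc (lo m ℓ) (hi m ℓ) ⊆ Icc (lo m ℓ') (hi m ℓ') :=
  Icc_subset_Icc ((Theta_strictMonoOn m).monotoneOn (Real.exp_pos _) (Real.exp_pos _)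
      (Real.exp_le_exp.2 (by linarith)))
    ((Theta_strictMonoOn m).monotoneOn (Real.exp_pos _) (Real.exp_pos _) (Real.exp_le_exp.2 h))

/-! ### Composition along curves in `H¹` -/

theorem hasDerivWithinAt_integral_of_continuousOn {E : Type*} [NormedAddCommGroup E]
    [NormedSpace ℝ E] [CompleteSpace E] {a b : ℝ} (hab : a ≤ b) {G : ℝ → E}
    (hG : ContinuousOn G (Icc a b)) (w : E) {t : ℝ} (ht : t ∈ Icc a b) :
    HasDerivWithinAt (fun t => w + ∫ s in a..t, G s) (G t) (Icc a b) t := by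
  -- Extending G by its end values makes it continuous on the line, where the two-sided fundamental
  -- theorem applies.
  have hc : Continuous (IccExtend hab ((Icc a b).domRestrict G)) :=
    (continuousOn_iff_continuous_domRestrict.1 hG).Icc_extend'
  have h1 := (intervalIntegral.integral_hasDerivAt_right (hc.intervalIntegrable a t)
    hc.stronglyMeasurable.stronglyMeasurableAtFilter hc.continuousAt).const_add w
  rw [IccExtend_of_mem hab _ ht] at h1
  have heq : ∀ r ∈ Icc a b, w + ∫ s in a..r, G s =
      w + ∫ s in a..r, IccExtend hab ((Icc a b).domRestrict G) s := fun r hr => by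
    congr 1
    refine intervalIntegral.integral_congr fun s hs => ?_
    rw [uIcc_of_le hr.1] at hs
    rw [IccExtend_of_mem hab _ ⟨hs.1, hs.2.trans hr.2⟩]
    rfl
  exact h1.hasDerivWithinAt.congr heq (heq t ht)

theorem hasDerivWithinAt_Ici_of_Icc {E : Type*} [NormedAddCommGroup E] [NormedSpace ℝ E]
    {f : ℝ → E} {f' : E} {a b t : ℝ} (h : HasDerivWithinAt f f' (Icc a b) t) (ht : t ∈ Ico a b) :
    HasDerivWithinAt f f' (Ici t) t :=
  h.mono_of_mem_nhdsWithin (mem_of_superset (Icc_mem_nhdsGE ht.2) (Icc_subset_Icc_left ht.1))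

/-- The derivative of the composition `∫₀^θ κ` along a curve in `H¹`. -/
def nemDeriv (κ κ' : BLip) (y dy : Sobolev 1) : Sobolev 1 := κ 0 • dy + mulH (nem κ' y) dy

/-- The function κ(y) need not be in H¹ when κ(0) ≠ 0, hence the split into κ(0) and a primitive.
The hypothesis is imposed at each value because, for truncations, it is guaranteed only on the
truncation interval. -/
theorem rep_nemDeriv {κ κ' : BLip} {y : Sobolev 1} (dy : Sobolev 1) {z : ℝ}
    (h : κ (rep y z) = κ 0 + κ'.A (rep y z)) :
    rep (nemDeriv κ κ' y dy) z = κ (rep y z) * rep dy z := by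
  rw [nemDeriv, rep_add, rep_smul, rep_mulH, rep_nem, h]
  ring

theorem continuous_nemDeriv (κ κ' : BLip) :
    Continuous fun p : Sobolev 1 × Sobolev 1 => nemDeriv κ κ' p.1 p.2 := by
  unfold nemDeriv
  have h1 : Continuous fun p : Sobolev 1 × Sobolev 1 => κ 0 • p.2 :=
    continuous_snd.fun_const_smul _
  have h2 : Continuous fun p : Sobolev 1 × Sobolev 1 => nem κ' p.1 :=
    (continuous_nem κ').comp continuous_fst
  have h3 : Continuous fun q : Sobolev 1 × Sobolev 1 => mulH q.1 q.2 := mulH.continuous₂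
  have h4 : Continuous fun p : Sobolev 1 × Sobolev 1 => mulH (nem κ' p.1) p.2 :=
    Continuous.comp (f := fun p : Sobolev 1 × Sobolev 1 => (nem κ' p.1, p.2)) h3
      (h2.prodMk continuous_snd)
  exact h1.fun_add h4

/-- No differentiability of the composition operator on H¹ is needed: the expected derivative is a
continuous curve in H¹, so its integral W is differentiable there. Evaluation at each z is a
continuous functional, and the scalar chain rule identifies W with the composition. -/
theorem hasDerivWithinAt_nem {κ κ' : BLip} {y dy : ℝ → Sobolev 1} {a b : ℝ} (hab : a ≤ b)
    (hy : ∀ t ∈ Icc a b, HasDerivWithinAt y (dy t) (Icc a b) t) (hdy : ContinuousOn dy (Icc a b))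
    (hκ : ∀ t ∈ Icc a b, ∀ z, κ (rep (y t) z) = κ 0 + κ'.A (rep (y t) z)) :
    ∀ t ∈ Icc a b, HasDerivWithinAt (fun t => nem κ (y t)) (nemDeriv κ κ' (y t) (dy t))
      (Icc a b) t := by
  have hyc : ContinuousOn y (Icc a b) := fun t ht => (hy t ht).continuousWithinAt
  have hG : ContinuousOn (fun t => nemDeriv κ κ' (y t) (dy t)) (Icc a b) := by
    have := (continuous_nemDeriv κ κ').comp_continuousOn (hyc.prodMk hdy)
    exact this
  set W : ℝ → Sobolev 1 := fun t => nem κ (y a) + ∫ s in a..t, nemDeriv κ κ' (y s) (dy s)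
  have hWa : W a = nem κ (y a) := by simp [W]
  have hW : ∀ t ∈ Icc a b, HasDerivWithinAt W (nemDeriv κ κ' (y t) (dy t)) (Icc a b) t :=
    fun t ht => hasDerivWithinAt_integral_of_continuousOn hab hG _ ht
  have heq : ∀ t ∈ Icc a b, nem κ (y t) = W t := by
    intro t ht
    refine ext_rep (funext fun z => ?_)
    have hev : ∀ {x : ℝ → Sobolev 1} {d : Sobolev 1} {s : ℝ}, HasDerivWithinAt x d (Icc a b) s →
        HasDerivWithinAt (fun t => rep (x t) z) (rep d z) (Icc a b) s := fun h =>
      (ev z).hasFDerivAt.comp_hasDerivWithinAt _ h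
    have hd1 : ∀ s ∈ Icc a b, HasDerivWithinAt (fun t => rep (nem κ (y t)) z)
        (rep (nemDeriv κ κ' (y s) (dy s)) z) (Icc a b) s := fun s hs => by
      simp only [rep_nem]
      rw [rep_nemDeriv _ (hκ s hs z)]
      exact (κ.hasDerivAt_A _).comp_hasDerivWithinAt s (hev (hy s hs))
    have hd2 := fun s hs => hev (hW s hs)
    exact eq_of_has_deriv_right_eq
      (fun s hs => hasDerivWithinAt_Ici_of_Icc (hd1 s (Ico_subset_Icc_self hs)) hs)
      (fun s hs => hasDerivWithinAt_Ici_of_Icc (hd2 s (Ico_subset_Icc_self hs)) hs)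
      (fun s hs => (hd1 s hs).continuousWithinAt) (fun s hs => (hd2 s hs).continuousWithinAt)
      (by rw [hWa]) t ht
  exact fun t ht => (hW t ht).congr heq (heq t ht)

theorem hasDerivAt_nem {κ κ' : BLip} {y dy : ℝ → Sobolev 1}
    (hy : ∀ t, HasDerivAt y (dy t) t) (hdy : Continuous dy)
    (hκ : ∀ t z, κ (rep (y t) z) = κ 0 + κ'.A (rep (y t) z)) (t : ℝ) :
    HasDerivAt (fun t => nem κ (y t)) (nemDeriv κ κ' (y t) (dy t)) t :=
  (hasDerivWithinAt_nem (a := t - 1) (b := t + 1) (by linarith)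
    (fun s _ => (hy s).hasDerivWithinAt) hdy.continuousOn (fun s _ z => hκ s z) t
    ⟨by linarith, by linarith⟩).hasDerivAt (Icc_mem_nhds (by linarith) (by linarith))

/-! ### Relations between the spaces H^k, and bounds on compact sets of H¹ -/

namespace Sobolev

theorem D_zero_represents {k : ℕ} {v : Sobolev k} {f : ℝ → ℝ} (h : v.Represents f) :
    D 0 v =ᵐ[volume] f := h

theorem D_zero_eq_iff_ae {k k' : ℕ} {v : Sobolev k} {w : Sobolev k'} {f : ℝ → ℝ}
    (hv : v.Represents f) (hw : w.Represents f) : D 0 v = D 0 w :=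
  Lp.ext ((D_zero_represents hv).trans (D_zero_represents hw).symm)

theorem ext_all {k : ℕ} {v w : Sobolev k} (h : ∀ j, D j v = D j w) : v = w := by
  rw [← pack_D v, ← pack_D w]
  congr 1
  exact funext h

theorem ext_D_zero {k : ℕ} {v w : Sobolev k} (h : D 0 v = D 0 w) : v = w := by
  refine ext_all fun j => ?_
  induction j using Fin.induction with
  | zero => exact h
  | succ j ih =>
    have h1 := D_one_eq_of_D_zero_eq (v := ofPair (D j.castSucc v) (D j.succ v) (v.2 j))
      (w := ofPair (D j.castSucc w) (D j.succ w) (w.2 j)) ih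
    exact h1

/-- The inclusion of `H^{k+1}` into `H¹`. -/
def res (k : ℕ) : Sobolev (k + 1) →L[ℝ] Sobolev 1 :=
  (pack 1).comp (ContinuousLinearMap.pi ![D 0, D 1])

theorem res_eq {k : ℕ} (v : Sobolev (k + 1)) : res k v = ofPair (D 0 v) (D 1 v) (v.2 0) := by
  rw [← pack_D (ofPair (D 0 v) (D 1 v) (v.2 0))]
  refine congrArg (pack 1) (funext fun j => ?_)
  fin_cases j <;> rfl

theorem D_zero_res {k : ℕ} (v : Sobolev (k + 1)) : D 0 (res k v) = D 0 v := by rw [res_eq]; rfl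

/-- The pair of an `H¹` function and its derivative, if the latter is in `H¹`, as an element of
`H²`. -/
def join : Sobolev 1 × Sobolev 1 →L[ℝ] Sobolev 2 :=
  (pack 2).comp (ContinuousLinearMap.pi
    ![(D 0).comp (ContinuousLinearMap.fst ℝ _ _), (D 1).comp (ContinuousLinearMap.fst ℝ _ _),
      (D 1).comp (ContinuousLinearMap.snd ℝ _ _)])

/-- The hypothesis puts (v, v', w') in the Sobolev subspace, so the projection inside `join` leaves
it unchanged. -/
theorem D_zero_join {v w : Sobolev 1} (h : D 0 w = D 1 v) : D 0 (join (v, w)) = D 0 v := by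
  have hmem : ∀ j : Fin 2, IsWeakDeriv (![D 0 v, D 1 v, D 1 w] j.castSucc)
      (![D 0 v, D 1 v, D 1 w] j.succ) := by
    intro j
    fin_cases j
    · exact v.2 0
    · have h1 : IsWeakDeriv (D 0 w) (D 1 w) := w.2 0
      rw [h] at h1
      exact h1
  set x : Sobolev 2 := ⟨WithLp.toLp 2 ![D 0 v, D 1 v, D 1 w], hmem⟩ with hx
  have : join (v, w) = x := by
    rw [← pack_D x]
    refine congrArg (pack 2) (funext fun j => ?_)
    fin_cases j <;> rfl
  rw [this]
  rfl

/-- The derivative of an element of `H²`, as an element of `H¹`. -/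
def shift (v : Sobolev 2) : Sobolev 1 := ofPair (D 1 v) (D 2 v) (v.2 1)

theorem D_zero_shift (v : Sobolev 2) : D 0 (shift v) = D 1 v := rfl

/-- Near infinity 1 + w exceeds 1/2 because w tends to zero; on the remaining compact set the
minimum is attained. -/
theorem exists_pos_le_one_add_rep {w : Sobolev 1} (h : ∀ z, 0 < 1 + rep w z) :
    ∃ ε : ℝ, 0 < ε ∧ ∀ z, ε ≤ 1 + rep w z := by
  have h1 : ∀ᶠ z in cocompact ℝ, -(1 / 2) < rep w z :=
    (tendsto_rep w).eventually (lt_mem_nhds (by norm_num))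
  obtain ⟨K, hK, hKs⟩ := mem_cocompact.1 h1
  rcases K.eq_empty_or_nonempty with rfl | hne
  · refine ⟨1 / 2, by norm_num, fun z => ?_⟩
    have : -(1 / 2) < rep w z := hKs (by simp)
    linarith
  · obtain ⟨z₀, -, hz₀⟩ := hK.exists_isMinOn hne
      ((continuous_const.add (continuous_rep w)).continuousOn (s := K) (f := fun z => 1 + rep w z))
    refine ⟨min (1 / 2) (1 + rep w z₀), lt_min (by norm_num) (h z₀), fun z => ?_⟩
    by_cases hz : z ∈ K
    · exact (min_le_right _ _).trans (hz₀ hz)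
    · have : -(1 / 2) < rep w z := hKs hz
      exact (min_le_left _ _).trans (by linarith)

/-- Uniform bounds for the porosity on compact sets of `H¹`. -/
theorem exists_log_bound {K : Set (Sobolev 1)} (hK : IsCompact K)
    (h : ∀ w ∈ K, ∀ z, 0 < 1 + rep w z) : ∃ ℓ₀ : ℝ, 0 ≤ ℓ₀ ∧ ∀ ℓ, ℓ₀ ≤ ℓ → ∀ w ∈ K, ∀ z,
      1 + rep w z ∈ Icc (Real.exp (-ℓ)) (Real.exp ℓ) := by
  obtain ⟨ε, hε, hlow⟩ : ∃ ε : ℝ, 0 < ε ∧ ∀ w ∈ K, ∀ z, ε ≤ 1 + rep w z := by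
    refine hK.induction_on (p := fun s => ∃ ε : ℝ, 0 < ε ∧ ∀ w ∈ s, ∀ z, ε ≤ 1 + rep w z)
      ⟨1, one_pos, by simp⟩ ?_ ?_ ?_
    · rintro s t hst ⟨ε, hε, ht⟩
      exact ⟨ε, hε, fun w hw => ht w (hst hw)⟩
    · rintro s t ⟨ε, hε, hs⟩ ⟨ε', hε', ht⟩
      refine ⟨min ε ε', lt_min hε hε', fun w hw z => ?_⟩
      rcases hw with hw | hw
      · exact (min_le_left _ _).trans (hs w hw z)
      · exact (min_le_right _ _).trans (ht w hw z)
    · intro w hw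
      obtain ⟨ε, hε, hb⟩ := exists_pos_le_one_add_rep (h w hw)
      -- The embedding constant 2 turns a distance ε/4 in H¹ into a pointwise change of at most ε/2.
      refine ⟨Metric.ball w (ε / 4),
        mem_nhdsWithin_of_mem_nhds (Metric.ball_mem_nhds w (by positivity)),
        ε / 2, by positivity, fun x hx z => ?_⟩
      have h1 := abs_rep_le (x - w) z
      rw [rep_sub] at h1
      rw [Metric.mem_ball, dist_eq_norm] at hx
      linarith [hb z, neg_abs_le (rep x z - rep w z)]
  obtain ⟨B, hB⟩ := hK.isBounded.exists_norm_le
  refine ⟨max 0 (max (-Real.log ε) (2 * B)), le_max_left _ _, fun ℓ hℓ w hw z => ⟨?_, ?_⟩⟩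
  · refine le_trans ?_ (hlow w hw z)
    rw [← Real.le_log_iff_exp_le hε]
    linarith [le_max_left (-Real.log ε) (2 * B), le_max_right 0 (max (-Real.log ε) (2 * B))]
  · have h1 := (le_abs_self _).trans (abs_rep_le w z)
    have h2 := hB w hw
    have h3 := Real.add_one_le_exp ℓ
    linarith [le_max_right (-Real.log ε) (2 * B), le_max_right 0 (max (-Real.log ε) (2 * B))]

end Sobolev

/-! ### Truncated functions and their derivatives -/

theorem BLip.clamp_eq_add {k : ℝ → ℝ} {α β : ℝ} (h : α ≤ β) (hk : ContDiffOn ℝ 1 k (Icc α β))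
    (hk' : ContDiffOn ℝ 1 (deriv k) (Icc α β)) (hd : ∀ s ∈ Icc α β, DifferentiableAt ℝ k s)
    (h0 : (0 : ℝ) ∈ Icc α β) {s : ℝ} (hs : s ∈ Icc α β) :
    BLip.clamp k h hk s = BLip.clamp k h hk 0 + (BLip.clamp (deriv k) h hk').A s := by
  rw [BLip.A_clamp_of_mem h hk' h0 (fun r hr => (hd r hr).hasDerivAt) hs, BLip.clamp_of_mem h hk hs,
    BLip.clamp_of_mem h hk h0]
  ring

theorem contDiffOn_deriv_thetaRange {m : ℝ} {k : ℝ → ℝ} (hk : ContDiffOn ℝ ∞ k (thetaRange m)) :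
    ContDiffOn ℝ ∞ (deriv k) (thetaRange m) :=
  hk.deriv_of_isOpen (isOpen_thetaRange m) (by simp)

theorem trunc_eq_add {m ℓ : ℝ} (hℓ : 0 ≤ ℓ) {k : ℝ → ℝ} (hk : ContDiffOn ℝ ∞ k (thetaRange m))
    {s : ℝ} (hs : s ∈ Icc (lo m ℓ) (hi m ℓ)) :
    trunc m hℓ k hk s = trunc m hℓ k hk 0 +
      (trunc m hℓ (deriv k) (contDiffOn_deriv_thetaRange hk)).A s :=
  BLip.clamp_eq_add _ _ _ (fun r hr => (hk.differentiableOn (by simp)).differentiableAt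
    ((isOpen_thetaRange m).mem_nhds (Icc_subset_thetaRange m ℓ hr))) (zero_mem_Icc m hℓ) hs

/-- The derivative of the truncated powers of the porosity. -/
def dpowB (m : ℝ) {ℓ : ℝ} (hℓ : 0 ≤ ℓ) (r : ℝ) : BLip :=
  trunc m hℓ (deriv fun s => Phi m s ^ r) (contDiffOn_deriv_thetaRange (contDiffOn_Phi_rpow m r))

/-- The second derivative of the truncated powers of the porosity. -/
def ddpowB (m : ℝ) {ℓ : ℝ} (hℓ : 0 ≤ ℓ) (r : ℝ) : BLip :=
  trunc m hℓ (deriv (deriv fun s => Phi m s ^ r))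
    (contDiffOn_deriv_thetaRange (contDiffOn_deriv_thetaRange (contDiffOn_Phi_rpow m r)))

theorem powB_eq_add {m ℓ : ℝ} (hℓ : 0 ≤ ℓ) (r : ℝ) {s : ℝ} (hs : s ∈ Icc (lo m ℓ) (hi m ℓ)) :
    powB m hℓ r s = powB m hℓ r 0 + (dpowB m hℓ r).A s := trunc_eq_add hℓ _ hs

theorem dpowB_eq_add {m ℓ : ℝ} (hℓ : 0 ≤ ℓ) (r : ℝ) {s : ℝ} (hs : s ∈ Icc (lo m ℓ) (hi m ℓ)) :
    dpowB m hℓ r s = dpowB m hℓ r 0 + (ddpowB m hℓ r).A s := trunc_eq_add hℓ _ hs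

theorem dpowB_A_of_mem {m ℓ : ℝ} (hℓ : 0 ≤ ℓ) (r : ℝ) {s : ℝ} (hs : s ∈ Icc (lo m ℓ) (hi m ℓ)) :
    (dpowB m hℓ r).A s = Phi m s ^ r - 1 := by
  have h1 := powB_eq_add hℓ r hs
  rw [powB_of_mem hℓ r hs, powB_of_mem hℓ r (zero_mem_Icc m hℓ), Phi_zero, Real.one_rpow] at h1
  linarith

/-! ### Truncated powers of 1 + s, for the passage from φ - 1 to θ -/

theorem contDiffOn_one_add_rpow (r : ℝ) :
    ContDiffOn ℝ ∞ (fun s : ℝ => (1 + s) ^ r) (Ioi (-1)) :=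
  ContDiffOn.rpow_const_of_ne (by fun_prop) fun s hs => by
    have : -1 < s := hs
    linarith

theorem exp_sub_one_le {ℓ : ℝ} (hℓ : 0 ≤ ℓ) : Real.exp (-ℓ) - 1 ≤ Real.exp ℓ - 1 := by
  have := Real.exp_le_exp.2 (show -ℓ ≤ ℓ by linarith)
  linarith

theorem Icc_exp_sub_one_subset (ℓ : ℝ) : Icc (Real.exp (-ℓ) - 1) (Real.exp ℓ - 1) ⊆ Ioi (-1) :=
  fun s hs => by
    have := Real.exp_pos (-ℓ)
    exact mem_Ioi.2 (by linarith [hs.1])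

theorem zero_mem_Icc_exp {ℓ : ℝ} (hℓ : 0 ≤ ℓ) :
    (0 : ℝ) ∈ Icc (Real.exp (-ℓ) - 1) (Real.exp ℓ - 1) :=
  ⟨by linarith [Real.exp_le_one_iff.2 (show -ℓ ≤ 0 by linarith)],
    by linarith [Real.one_le_exp hℓ]⟩

/-- The truncated powers of `1 + s`. -/
def shiftB {ℓ : ℝ} (hℓ : 0 ≤ ℓ) (r : ℝ) : BLip :=
  BLip.clamp (fun s : ℝ => (1 + s) ^ r) (exp_sub_one_le hℓ)
    (((contDiffOn_one_add_rpow r).mono (Icc_exp_sub_one_subset ℓ)).of_le (by simp))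

/-- The derivative of the truncated powers of `1 + s`. -/
def dshiftB {ℓ : ℝ} (hℓ : 0 ≤ ℓ) (r : ℝ) : BLip :=
  BLip.clamp (deriv fun s : ℝ => (1 + s) ^ r) (exp_sub_one_le hℓ)
    ((((contDiffOn_one_add_rpow r).deriv_of_isOpen isOpen_Ioi (m := ∞) (by simp)).mono
      (Icc_exp_sub_one_subset ℓ)).of_le (by simp))

theorem shiftB_of_mem {ℓ : ℝ} (hℓ : 0 ≤ ℓ) (r : ℝ) {s : ℝ}
    (hs : 1 + s ∈ Icc (Real.exp (-ℓ)) (Real.exp ℓ)) : shiftB hℓ r s = (1 + s) ^ r :=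
  BLip.clamp_of_mem _ _ ⟨by linarith [hs.1], by linarith [hs.2]⟩

theorem shiftB_eq_add {ℓ : ℝ} (hℓ : 0 ≤ ℓ) (r : ℝ) {s : ℝ}
    (hs : 1 + s ∈ Icc (Real.exp (-ℓ)) (Real.exp ℓ)) :
    shiftB hℓ r s = shiftB hℓ r 0 + (dshiftB hℓ r).A s :=
  BLip.clamp_eq_add _ _ _ (fun _ hr =>
    ((contDiffOn_one_add_rpow r).differentiableOn (by simp)).differentiableAt
      (isOpen_Ioi.mem_nhds (Icc_exp_sub_one_subset ℓ hr))) (zero_mem_Icc_exp hℓ)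
    ⟨by linarith [hs.1], by linarith [hs.2]⟩

theorem shiftB_A_of_mem {ℓ : ℝ} (hℓ : 0 ≤ ℓ) (m : ℝ) {s : ℝ}
    (hs : 1 + s ∈ Icc (Real.exp (-ℓ)) (Real.exp ℓ)) :
    (shiftB hℓ (-m)).A s = Theta m (1 + s) := by
  rw [shiftB, BLip.A_clamp_of_mem (g := fun s => Theta m (1 + s)) _ _ (zero_mem_Icc_exp hℓ)
    (fun r hr => ?_) ⟨by linarith [hs.1], by linarith [hs.2]⟩]
  · simp
  · have : 0 < 1 + r := by linarith [Real.exp_pos (-ℓ), hr.1]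
    have h1 := (hasDerivAt_Theta (m := m) this).comp r ((hasDerivAt_id r).const_add 1)
    rw [mul_one] at h1
    exact h1

theorem Sobolev.D_zero_nemDeriv {κ κ' : BLip} {y : Sobolev 1} (dy : Sobolev 1)
    (h : ∀ z, κ (rep y z) = κ 0 + κ'.A (rep y z)) :
    D 0 (nemDeriv κ κ' y dy) = M κ y (D 0 dy) := by
  refine Lp.ext ?_
  filter_upwards [coe_ae_eq_rep (nemDeriv κ κ' y dy), coeFn_M κ y (D 0 dy), coe_ae_eq_rep dy]
    with z h1 h2 h3
  rw [h1, h2, h3, rep_nemDeriv dy (h z)]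

theorem hasDerivAt_integral_of_continuous {E : Type*} [NormedAddCommGroup E] [NormedSpace ℝ E]
    [CompleteSpace E] {G : ℝ → E} (hG : Continuous G) (w : E) (t : ℝ) :
    HasDerivAt (fun t => w + ∫ s in (0 : ℝ)..t, G s) (G t) t :=
  (intervalIntegral.integral_hasDerivAt_right (hG.intervalIntegrable _ _)
    hG.stronglyMeasurable.stronglyMeasurableAtFilter hG.continuousAt).const_add w

theorem hasDerivAt_bilinear {E : Type*} [NormedAddCommGroup E] [NormedSpace ℝ E]
    (B : E →L[ℝ] E →L[ℝ] E) {f g : ℝ → E} {f' g' : E} {t : ℝ} (hf : HasDerivAt f f' t)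
    (hg : HasDerivAt g g' t) :
    HasDerivAt (fun t => B (f t) (g t)) (B f' (g t) + B (f t) g') t := by
  have h : HasDerivAt (fun t => B (f t)) (B f') t := B.hasFDerivAt.comp_hasDerivAt t hf
  exact h.clm_apply hg

theorem continuous_nemDeriv_comp {X : Type*} [TopologicalSpace X] (κ κ' : BLip)
    {f g : X → Sobolev 1} (hf : Continuous f) (hg : Continuous g) :
    Continuous fun x => nemDeriv κ κ' (f x) (g x) :=
  Continuous.comp (g := fun q : Sobolev 1 × Sobolev 1 => nemDeriv κ κ' q.1 q.2)
    (f := fun x => (f x, g x)) (continuous_nemDeriv κ κ') (hf.prodMk hg)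

/-! ### Uniqueness -/

theorem IsGlobalSolution.of_succ {n m : ℝ} {k : ℕ} {φ₀ : ℝ → ℝ} {φ : ℝ → ℝ → ℝ}
    (h : IsGlobalSolution n m (k + 1) φ₀ φ) : IsGlobalSolution n m 1 φ₀ φ := by
  obtain ⟨hc, hpos, v₀, v, F, u, hv₀, hv, hC1, hu, hF, hFi, heq⟩ := h
  have hrep : ∀ {w : Sobolev (k + 1)} {f : ℝ → ℝ}, w.Represents f → (res k w).Represents f :=
    fun {w f} hw => by
      show D 0 (res k w) =ᵐ[volume] f
      rw [D_zero_res]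
      exact hw
  refine ⟨hc, hpos, res k v₀, fun t => res k (v t), fun t => res k (F t), u, hrep hv₀,
    fun t ht => hrep (hv t ht), (res k).contDiff.comp_contDiffOn hC1, hu,
    fun t ht => hrep (hF t ht), fun t ht => ?_, fun t ht => ?_⟩
  · have := hFi t ht
    exact ⟨(res k).integrable_comp this.1, (res k).integrable_comp this.2⟩
  · show res k (v t) = res k v₀ + ∫ s in (0 : ℝ)..t, res k (F s)
    rw [heq t ht, map_add, ContinuousLinearMap.intervalIntegral_comp_comm _ (hFi t ht)]

/-- A solution of the magma equation gives an integral curve of the elliptic solution operator. -/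
theorem IsGlobalSolution.exists_curve {n m : ℝ} {φ₀ : ℝ → ℝ} {φ : ℝ → ℝ → ℝ}
    (h : IsGlobalSolution n m 1 φ₀ φ) {T : ℝ} (hT : 0 ≤ T) :
    ∃ ℓ₀ : ℝ, 0 ≤ ℓ₀ ∧ ∀ ℓ, ℓ₀ ≤ ℓ → ∀ hℓ : 0 ≤ ℓ, ∃ θ : ℝ → Sobolev 1,
      (∀ t ∈ Icc 0 T, ∀ z, rep (θ t) z = Theta m (φ t z)) ∧
      ∀ t ∈ Icc 0 T, HasDerivWithinAt θ ((coeff n m hℓ).U (θ t)) (Icc 0 T) t := by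
  obtain ⟨hc, hpos, v₀, v, F, u, hv₀, hv, hC1, hu, hF, hFi, heq⟩ := h
  have hvrep : ∀ t, 0 ≤ t → ∀ z, 1 + rep (v t) z = φ t z := fun t ht z => by
    rw [rep_eq_of_ae (f := fun z => φ t z - 1) ((hc t ht).sub continuous_const) (hv t ht)]
    ring
  have hvc : ContinuousOn v (Icc 0 T) := hC1.continuousOn.mono fun t ht => ht.1
  -- The solution is only assumed positive; compactness of its trace in H¹ over [0, T] supplies the
  -- bounds on log φ that make a truncation harmless.
  obtain ⟨ℓ₀, hℓ₀, hbd⟩ := exists_log_bound (isCompact_Icc.image_of_continuousOn hvc) (by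
    rintro w ⟨t, ht, rfl⟩ z
    rw [hvrep t ht.1]
    exact hpos t ht.1 z)
  refine ⟨ℓ₀, hℓ₀, fun ℓ hle hℓ => ?_⟩
  have hb : ∀ t ∈ Icc 0 T, ∀ z, 1 + rep (v t) z ∈ Icc (Real.exp (-ℓ)) (Real.exp ℓ) :=
    fun t ht z => hbd ℓ hle _ (mem_image_of_mem v ht) z
  set θ : ℝ → Sobolev 1 := fun t => nem (shiftB hℓ (-m)) (v t) with hθ
  have hθrep : ∀ t ∈ Icc 0 T, ∀ z, rep (θ t) z = Theta m (φ t z) := fun t ht z => by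
    simp only [hθ, rep_nem]
    rw [shiftB_A_of_mem hℓ m (hb t ht z), hvrep t ht.1]
  have hmem : ∀ t ∈ Icc 0 T, ∀ z, rep (θ t) z ∈ Icc (lo m ℓ) (hi m ℓ) := fun t ht z => by
    rw [hθrep t ht]
    refine Theta_mem_Icc ?_
    rw [← hvrep t ht.1]
    exact hb t ht z
  have hPhi : ∀ t ∈ Icc 0 T, ∀ z, Phi m (rep (θ t) z) = φ t z := fun t ht z => by
    rw [hθrep t ht, Phi_Theta (hpos t ht.1 z)]
  have hU : ∀ t ∈ Icc 0 T, u t = (coeff n m hℓ).U (θ t) := fun t ht =>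
    ((coeff n m hℓ).isEllipticSolution_iff (u t)
      (fun z => by rw [coeff_a_of_mem n hℓ (hmem t ht z), hPhi t ht])
      (fun z => by rw [coeff_b_of_mem n hℓ (hmem t ht z), hPhi t ht])).1 (hu t ht.1)
  have hθc : ContinuousOn θ (Icc 0 T) := (continuous_nem _).comp_continuousOn hvc
  -- The integrand F is only assumed interval integrable. Identifying it with a continuous function
  -- of θ makes it continuous, so that the integral equation can be differentiated.
  have hFeq : ∀ t ∈ Icc 0 T, F t =
      nemDeriv (powB m hℓ m) (dpowB m hℓ m) (θ t) ((coeff n m hℓ).U (θ t)) := by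
    intro t ht
    refine ext_D_zero ?_
    rw [D_zero_nemDeriv _ fun z => powB_eq_add hℓ m (hmem t ht z), ← hU t ht]
    refine Lp.ext ((hF t ht.1 : D 0 (F t) =ᵐ[volume] _).trans ?_)
    filter_upwards [coeFn_M (powB m hℓ m) (θ t) (D 0 (u t))] with z hz
    rw [hz, powB_of_mem hℓ m (hmem t ht z), hPhi t ht]
    rfl
  have hFc : ContinuousOn F (Icc 0 T) := by
    refine ContinuousOn.congr ?_ hFeq
    have h1 : ContinuousOn (fun t => (coeff n m hℓ).U (θ t)) (Icc 0 T) :=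
      (coeff n m hℓ).continuous_U.comp_continuousOn hθc
    rw [continuousOn_iff_continuous_domRestrict] at hθc h1 ⊢
    exact continuous_nemDeriv_comp (powB m hℓ m) (dpowB m hℓ m) hθc h1
  have hvd : ∀ t ∈ Icc 0 T, HasDerivWithinAt v (F t) (Icc 0 T) t := fun t ht =>
    (hasDerivWithinAt_integral_of_continuousOn hT hFc v₀ ht).congr
      (fun s hs => heq s hs.1) (heq t ht.1)
  refine ⟨θ, hθrep, fun t ht => ?_⟩
  have hd := hasDerivWithinAt_nem (κ := shiftB hℓ (-m)) (κ' := dshiftB hℓ (-m)) hT hvd hFc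
    (fun t ht z => shiftB_eq_add hℓ (-m) (hb t ht z)) t ht
  -- The chain rule multiplies F = φᵐ u by φ^{-m}, leaving u.
  have he : nemDeriv (shiftB hℓ (-m)) (dshiftB hℓ (-m)) (v t) (F t) = (coeff n m hℓ).U (θ t) := by
    refine ext_rep (funext fun z => ?_)
    rw [rep_nemDeriv _ (shiftB_eq_add hℓ (-m) (hb t ht z)), shiftB_of_mem hℓ _ (hb t ht z),
      hFeq t ht, rep_nemDeriv _ (powB_eq_add hℓ m (hmem t ht z)),
      powB_of_mem hℓ m (hmem t ht z), hPhi t ht, hvrep t ht.1, ← mul_assoc,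
      ← Real.rpow_add (hpos t ht.1 z), neg_add_cancel, Real.rpow_zero, one_mul]
  rwa [he] at hd

/-- At the larger of the two truncation levels both solutions are integral curves of the same field;
on a ball containing both traces it is Lipschitz, so the curves agree, and `Theta m` is injective on
positive values. -/
theorem IsGlobalSolution.unique {n m : ℝ} {φ₀ : ℝ → ℝ} {φ φ' : ℝ → ℝ → ℝ}
    (h : IsGlobalSolution n m 1 φ₀ φ) (h' : IsGlobalSolution n m 1 φ₀ φ') {t : ℝ} (ht : 0 ≤ t)
    (z : ℝ) : φ t z = φ' t z := by
  obtain ⟨ℓ₁, hℓ₁, H⟩ := h.exists_curve ht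
  obtain ⟨ℓ₂, hℓ₂, H'⟩ := h'.exists_curve ht
  have hℓ : 0 ≤ max ℓ₁ ℓ₂ := le_max_of_le_left hℓ₁
  obtain ⟨θ, hr, hd⟩ := H _ (le_max_left _ _) hℓ
  obtain ⟨θ', hr', hd'⟩ := H' _ (le_max_right _ _) hℓ
  have hinit : φ 0 = φ' 0 := by
    obtain ⟨hc, hpos, v₀, v, F, u, hv₀, hv, hC1, hu, hF, hFi, heq⟩ := h
    obtain ⟨hc', hpos', v₀', v', F', u', hv₀', hv', hC1', hu', hF', hFi', heq'⟩ := h'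
    have e : v 0 = v' 0 := by
      rw [heq 0 le_rfl, heq' 0 le_rfl, intervalIntegral.integral_same,
        intervalIntegral.integral_same, add_zero, add_zero]
      exact ext_D_zero (D_zero_eq_iff_ae hv₀ hv₀')
    have e1 := rep_eq_of_ae (f := fun z => φ 0 z - 1) ((hc 0 le_rfl).sub continuous_const)
      (hv 0 le_rfl)
    have e2 := rep_eq_of_ae (f := fun z => φ' 0 z - 1) ((hc' 0 le_rfl).sub continuous_const)
      (hv' 0 le_rfl)
    rw [e, e2] at e1
    funext x
    have : φ' 0 x - 1 = φ 0 x - 1 := congrFun e1 x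
    linarith
  have h0 : (0 : ℝ) ∈ Icc 0 t := ⟨le_rfl, ht⟩
  have hθ0 : θ 0 = θ' 0 := ext_rep (funext fun x => by rw [hr 0 h0, hr' 0 h0, hinit])
  have hθc : ContinuousOn θ (Icc 0 t) := fun s hs => (hd s hs).continuousWithinAt
  have hθc' : ContinuousOn θ' (Icc 0 t) := fun s hs => (hd' s hs).continuousWithinAt
  obtain ⟨B, hB⟩ := isCompact_Icc.exists_bound_of_continuousOn hθc
  obtain ⟨B', hB'⟩ := isCompact_Icc.exists_bound_of_continuousOn hθc'
  obtain ⟨K, hK⟩ := (coeff n m hℓ).exists_lipschitzOnWith_U (max B B')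
  have heq := ODE_solution_unique_of_mem_Icc_right (v := fun _ => (coeff n m hℓ).U)
    (s := fun _ => {x : Sobolev 1 | ‖x‖ ≤ max B B'}) (K := K) (fun _ _ => hK) hθc
    (fun s hs => hasDerivWithinAt_Ici_of_Icc (hd s (Ico_subset_Icc_self hs)) hs)
    (fun s hs => (hB s (Ico_subset_Icc_self hs)).trans (le_max_left _ _)) hθc'
    (fun s hs => hasDerivWithinAt_Ici_of_Icc (hd' s (Ico_subset_Icc_self hs)) hs)
    (fun s hs => (hB' s (Ico_subset_Icc_self hs)).trans (le_max_right _ _)) hθ0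
  have htt : t ∈ Icc 0 t := ⟨ht, le_rfl⟩
  have h1 : Theta m (φ t z) = Theta m (φ' t z) := by rw [← hr t htt, ← hr' t htt, heq htt]
  rw [← Phi_Theta (m := m) (h.2.1 t ht z), h1, Phi_Theta (h'.2.1 t ht z)]

/-! ### Existence -/

/-- Global existence in `H¹` for the transformed equation, with values in a compact range. -/
theorem exists_global_curve {n m : ℝ} (hnm : 3 ≤ n + m) (hlow : 4 ≤ n + 3 * m)
    (hup : n + 3 * m < 6) {ℓ₀ : ℝ} (hℓ₀ : 0 ≤ ℓ₀) {θ₀ : Sobolev 1}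
    (h₀ : ∀ z, rep θ₀ z ∈ Icc (lo m ℓ₀) (hi m ℓ₀)) :
    ∃ (ℓ : ℝ) (hℓ : 0 ≤ ℓ) (θ : ℝ → Sobolev 1), θ 0 = θ₀ ∧
      (∀ t, HasDerivAt θ ((coeff n m hℓ).U (θ t)) t) ∧
      ∀ t z, rep (θ t) z ∈ Icc (lo m ℓ) (hi m ℓ) := by
  set C := (1 + (n + m - 2) * (n + m - 2 + 1)) * (coeff n m hℓ₀).energy θ₀
  -- The constant C uses the energy at level ℓ₀. By `energy_coeff_eq` the energy of θ₀ is the same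
  -- at level ℓ, so the choice is not circular; the final one gives the strict inequality.
  set ℓ := max ℓ₀ (C + 2 * Real.log 2 + 1)
  have hle : ℓ₀ ≤ ℓ := le_max_left _ _
  have hℓ : 0 ≤ ℓ := hℓ₀.trans hle
  obtain ⟨θ, h0, hd, hen⟩ := (coeff n m hℓ).exists_forall_hasDerivAt θ₀
  refine ⟨ℓ, hℓ, θ, h0, hd, fun t z => rep_mem_Icc_of_energy hnm hlow hup hℓ ?_ z⟩
  rw [hen, energy_coeff_eq hnm hℓ hℓ₀ (fun z => Icc_lo_hi_subset hle (h₀ z)) h₀]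
  have : C + 2 * Real.log 2 + 1 ≤ ℓ := le_max_right _ _
  linarith

/-- A smooth curve in `H^k` which represents `Φ(θ) - 1` gives a solution of the magma equation. -/
theorem isGlobalSolution_of_curve {n m ℓ : ℝ} (hℓ : 0 ≤ ℓ) {k : ℕ} {φ₀ : ℝ → ℝ}
    {θ : ℝ → Sobolev 1} (hθ : ∀ t, HasDerivAt θ ((coeff n m hℓ).U (θ t)) t)
    (hmem : ∀ t z, rep (θ t) z ∈ Icc (lo m ℓ) (hi m ℓ)) {v₀ : Sobolev k}
    (hv₀ : v₀.Represents fun z => φ₀ z - 1) {V F : ℝ → Sobolev k} (hV : ∀ t, HasDerivAt V (F t) t)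
    (hF : Continuous F) (hVθ : ∀ t, D 0 (V t) = D 0 (nem (powB m hℓ m) (θ t)))
    (hV0 : V 0 = v₀) :
    IsGlobalSolution n m k φ₀ fun t z => Phi m (rep (θ t) z) := by
  have hJ : ∀ t z, rep (θ t) z ∈ thetaRange m := fun t z => Icc_subset_thetaRange m ℓ (hmem t z)
  have hUc : Continuous fun t => (coeff n m hℓ).U (θ t) := (coeff n m hℓ).continuous_U.comp
    (continuous_iff_continuousAt.2 fun t => (hθ t).continuousAt)
  -- Both curves have the same image in L², so uniqueness of the derivative there identifies F,
  -- whatever k is.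
  have hdF : ∀ t, D 0 (F t) = M (powB m hℓ m) (θ t) (D 0 ((coeff n m hℓ).U (θ t))) := by
    intro t
    have h1 := (D 0 : Sobolev k →L[ℝ] LTwo).hasFDerivAt.comp_hasDerivAt t (hV t)
    have h2 := (D 0 : Sobolev 1 →L[ℝ] LTwo).hasFDerivAt.comp_hasDerivAt t
      (hasDerivAt_nem (κ := powB m hℓ m) (κ' := dpowB m hℓ m) hθ hUc
        (fun t z => powB_eq_add hℓ m (hmem t z)) t)
    rw [D_zero_nemDeriv _ fun z => powB_eq_add hℓ m (hmem t z)] at h2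
    have h3 : (D 0 : Sobolev k →L[ℝ] LTwo) ∘ V =
        (D 0 : Sobolev 1 →L[ℝ] LTwo) ∘ fun t => nem (powB m hℓ m) (θ t) := funext hVθ
    rw [h3] at h1
    exact h1.unique h2
  refine ⟨fun t _ => ?_, fun t _ z => Phi_pos (hJ t z), v₀, V, F,
    fun t => (coeff n m hℓ).U (θ t), hv₀, fun t _ => ?_, ?_, fun t _ => ?_, fun t _ => ?_,
    fun t _ => hF.intervalIntegrable _ _, fun t _ => ?_⟩
  · exact (contDiffOn_Phi m).continuousOn.comp_continuous (continuous_rep _) (hJ t)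
  · show D 0 (V t) =ᵐ[volume] _
    rw [hVθ]
    filter_upwards [coe_ae_eq_rep (nem (powB m hℓ m) (θ t))] with z hz
    rw [hz, rep_nem]
    exact powB_A_of_mem hℓ (hmem t z)
  · refine ContDiff.contDiffOn (contDiff_one_iff_deriv.2 ⟨fun t => (hV t).differentiableAt, ?_⟩)
    rw [show deriv V = F from funext fun t => (hV t).deriv]
    exact hF
  · exact ((coeff n m hℓ).isEllipticSolution_iff _
      (fun z => coeff_a_of_mem n hℓ (hmem t z)) (fun z => coeff_b_of_mem n hℓ (hmem t z))).2 rfl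
  · show D 0 (F t) =ᵐ[volume] _
    rw [hdF]
    filter_upwards [coeFn_M (powB m hℓ m) (θ t) (D 0 ((coeff n m hℓ).U (θ t)))] with z hz
    rw [hz, powB_of_mem hℓ m (hmem t z)]
    rfl
  · rw [intervalIntegral.integral_eq_sub_of_hasDerivAt (fun s _ => hV s)
      (hF.intervalIntegrable _ _), hV0]
    abel

/-! ### Propagation of H² regularity -/

/-- The derivative `u_z` of the solution of the elliptic problem, as an element of `H¹`. -/
def slope (n m : ℝ) {ℓ : ℝ} (hℓ : 0 ≤ ℓ) (θ : Sobolev 1) : Sobolev 1 :=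
  (coeff n m hℓ).flux θ + mulH (nem (dpowB m hℓ (-n)) θ) ((coeff n m hℓ).flux θ) -
    nem (dpowB m hℓ (-n)) θ

/-- Solve the flux relation f = a u_z - (a - 1) for u_z = f + (a⁻¹ - 1) f - (a⁻¹ - 1). Here f and
a⁻¹ - 1 are in H¹, so u_z gains a derivative. -/
theorem D_zero_slope {n m ℓ : ℝ} (hℓ : 0 ≤ ℓ) {θ : Sobolev 1}
    (h : ∀ z, rep θ z ∈ Icc (lo m ℓ) (hi m ℓ)) :
    D 0 (slope n m hℓ θ) = D 1 ((coeff n m hℓ).U θ) := by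
  refine Lp.ext ?_
  set c := coeff n m hℓ
  have hfl : D 0 (c.flux θ) = M c.a θ (D 1 (c.U θ)) - c.R θ := rfl
  filter_upwards [coe_ae_eq_rep (slope n m hℓ θ), coe_ae_eq_rep (c.flux θ),
    Lp.coeFn_sub (M c.a θ (D 1 (c.U θ))) (c.R θ), coeFn_M c.a θ (D 1 (c.U θ)),
    c.coeFn_R θ] with z h1 h2 h3 h4 h5
  rw [hfl, h3, Pi.sub_apply, h4, h5, coeff_a_of_mem n hℓ (h z)] at h2
  have hp := Phi_pos (Icc_subset_thetaRange m ℓ (h z))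
  have hpn := Real.rpow_pos_of_pos hp n
  rw [h1, slope, rep_sub, rep_add, rep_mulH]
  simp only [rep_nem]
  rw [dpowB_A_of_mem hℓ _ (h z), ← h2, Real.rpow_neg hp.le]
  field_simp
  ring

theorem continuous_mulH_comp {X : Type*} [TopologicalSpace X] {f g : X → Sobolev 1}
    (hf : Continuous f) (hg : Continuous g) : Continuous fun x => mulH (f x) (g x) :=
  Continuous.comp (g := fun q : Sobolev 1 × Sobolev 1 => mulH q.1 q.2)
    (f := fun x => (f x, g x)) mulH.continuous₂ (hf.prodMk hg)

theorem continuous_slope (n m : ℝ) {ℓ : ℝ} (hℓ : 0 ≤ ℓ) : Continuous (slope n m hℓ) := by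
  have h1 := (coeff n m hℓ).continuous_flux
  have h2 := continuous_nem (dpowB m hℓ (-n))
  exact (h1.fun_add (continuous_mulH_comp h2 h1)).fun_sub h2

/-- Propagation of `H²` regularity: the derivative of the porosity is a smooth curve in `H¹`. -/
theorem exists_derivative_curve {n m ℓ : ℝ} (hℓ : 0 ≤ ℓ) {θ : ℝ → Sobolev 1}
    (hθ : ∀ t, HasDerivAt θ ((coeff n m hℓ).U (θ t)) t)
    (hmem : ∀ t z, rep (θ t) z ∈ Icc (lo m ℓ) (hi m ℓ)) {W₀ : Sobolev 1}
    (hW₀ : D 0 W₀ = D 1 (θ 0)) : ∃ Z Z' : ℝ → Sobolev 1, (∀ t, HasDerivAt Z (Z' t) t) ∧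
      Continuous Z' ∧ ∀ t, D 0 (Z t) = D 1 (nem (powB m hℓ m) (θ t)) := by
  have hθc : Continuous θ := continuous_iff_continuousAt.2 fun t => (hθ t).continuousAt
  have hUc : Continuous fun t => (coeff n m hℓ).U (θ t) := (coeff n m hℓ).continuous_U.comp hθc
  have hsc : Continuous fun t => slope n m hℓ (θ t) := (continuous_slope n m hℓ).comp hθc
  set W : ℝ → Sobolev 1 := fun t => W₀ + ∫ s in (0 : ℝ)..t, slope n m hℓ (θ s) with hWdef
  have hW : ∀ t, HasDerivAt W (slope n m hℓ (θ t)) t := fun t =>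
    hasDerivAt_integral_of_continuous hsc W₀ t
  have hWc : Continuous W := continuous_iff_continuousAt.2 fun t => (hW t).continuousAt
  -- The curves W and θ_z have the same derivative in L² and the same initial value, so W lifts θ_z
  -- to H¹.
  have hDW : ∀ t, D 0 (W t) = D 1 (θ t) := by
    have hd : ∀ t, HasDerivAt (fun t => D 0 (W t) - D 1 (θ t)) 0 t := fun t => by
      have h1 := ((D 0 : Sobolev 1 →L[ℝ] LTwo).hasFDerivAt.comp_hasDerivAt t (hW t)).sub
        ((D 1 : Sobolev 1 →L[ℝ] LTwo).hasFDerivAt.comp_hasDerivAt t (hθ t))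
      rw [D_zero_slope hℓ (hmem t), sub_self] at h1
      exact h1
    intro t
    have h2 := is_const_of_deriv_eq_zero (fun t => (hd t).differentiableAt)
      (fun t => (hd t).deriv) t 0
    have h3 : W 0 = W₀ := by simp [hWdef]
    rw [h3, hW₀, sub_self] at h2
    exact sub_eq_zero.1 h2
  set N : ℝ → Sobolev 1 := fun t => nem (dpowB m hℓ m) (θ t)
  set N' : ℝ → Sobolev 1 := fun t =>
    nemDeriv (dpowB m hℓ m) (ddpowB m hℓ m) (θ t) ((coeff n m hℓ).U (θ t))
  have hN : ∀ t, HasDerivAt N (N' t) t := fun t =>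
    hasDerivAt_nem (κ := dpowB m hℓ m) (κ' := ddpowB m hℓ m) hθ hUc
      (fun t z => dpowB_eq_add hℓ m (hmem t z)) t
  have hNc : Continuous N := (continuous_nem _).comp hθc
  have hN'c : Continuous N' :=
    continuous_nemDeriv_comp (dpowB m hℓ m) (ddpowB m hℓ m) hθc hUc
  refine ⟨fun t => nemDeriv (powB m hℓ m) (dpowB m hℓ m) (θ t) (W t),
    fun t => powB m hℓ m 0 • slope n m hℓ (θ t) +
      (mulH (N' t) (W t) + mulH (N t) (slope n m hℓ (θ t))), fun t => ?_, ?_, fun t => ?_⟩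
  · exact ((hW t).const_smul (powB m hℓ m 0)).add (hasDerivAt_bilinear mulH (hN t) (hW t))
  · exact (hsc.fun_const_smul _).fun_add
      ((continuous_mulH_comp hN'c hWc).fun_add (continuous_mulH_comp hNc hsc))
  · rw [D_zero_nemDeriv _ fun z => powB_eq_add hℓ m (hmem t z), hDW, D_one_nem]

/-! ### Initial data -/

/-- Data which are bounded away from zero have a positive continuous representative. -/
theorem one_add_rep_pos {w : Sobolev 1} {φ₀ : ℝ → ℝ} (hw : w.Represents fun z => φ₀ z - 1)
    (h : essSup (fun z => ‖φ₀ z‖ₑ⁻¹) volume < ⊤) (z : ℝ) : 0 < 1 + rep w z := by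
  set C := essSup (fun z => ‖φ₀ z‖ₑ⁻¹) volume
  have hc : Continuous fun z => 1 + rep w z := continuous_const.add (continuous_rep w)
  have hae : ∀ᵐ z ∂volume, 1 ≤ C.toReal * |1 + rep w z| := by
    filter_upwards [ae_le_essSup (μ := volume) (f := fun z => ‖φ₀ z‖ₑ⁻¹), D_zero_represents hw,
      coe_ae_eq_rep w] with x h1 h2 h3
    rw [h3] at h2
    have h4 : 1 + rep w x = φ₀ x := by rw [h2]; ring
    have h5 : ‖φ₀ x‖ₑ ≠ 0 := fun h0 => by
      rw [h0, ENNReal.inv_zero] at h1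
      exact (h1.trans_lt h).ne rfl
    have h6 : 1 ≤ C * ‖φ₀ x‖ₑ := by
      rw [← ENNReal.inv_mul_cancel h5 enorm_ne_top]
      exact mul_le_mul_left h1 _
    have h7 := ENNReal.toReal_mono (ENNReal.mul_ne_top h.ne enorm_ne_top) h6
    rw [ENNReal.toReal_mul, toReal_enorm, Real.norm_eq_abs, ENNReal.toReal_one] at h7
    rwa [h4]
  -- The almost everywhere bound holds on a dense set, and the set where it holds is closed by
  -- continuity.
  have hall : ∀ x, 1 ≤ C.toReal * |1 + rep w x| := by
    have hcl : IsClosed {x | 1 ≤ C.toReal * |1 + rep w x|} :=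
      isClosed_le continuous_const (continuous_const.mul hc.abs)
    have hd : Dense {x | 1 ≤ C.toReal * |1 + rep w x|} := Measure.dense_of_ae hae
    intro x
    have : x ∈ closure {x | 1 ≤ C.toReal * |1 + rep w x|} := hd x
    rwa [hcl.closure_eq] at this
  -- The hypothesis bounds only |φ₀| from below. A nonpositive value would force a zero by the
  -- intermediate value theorem, as the representative tends to 1 at infinity.
  by_contra hz
  have h1 : ∀ᶠ x in cocompact ℝ, -1 < rep w x :=
    (tendsto_rep w).eventually (lt_mem_nhds (by norm_num))
  obtain ⟨b, hb⟩ := h1.exists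
  obtain ⟨x, hx⟩ := mem_range_of_exists_le_of_exists_ge hc (c := 0) ⟨z, not_lt.1 hz⟩
    ⟨b, by linarith⟩
  have := hall x
  simp only at hx
  rw [hx, abs_zero, mul_zero] at this
  linarith

/-- Data for the transformed equation. -/
theorem exists_transformed_data (m : ℝ) {w : Sobolev 1} (hw : ∀ z, 0 < 1 + rep w z) :
    ∃ (ℓ₀ : ℝ) (hℓ₀ : 0 ≤ ℓ₀), (∀ z, 1 + rep w z ∈ Icc (Real.exp (-ℓ₀)) (Real.exp ℓ₀)) ∧
      ∀ z, rep (nem (shiftB hℓ₀ (-m)) w) z = Theta m (1 + rep w z) := by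
  obtain ⟨ℓ₀, hℓ₀, hb⟩ := exists_log_bound (isCompact_singleton (x := w))
    (by rintro _ rfl z; exact hw z)
  have hb' := hb ℓ₀ le_rfl w rfl
  refine ⟨ℓ₀, hℓ₀, hb', fun z => ?_⟩
  rw [rep_nem]
  exact shiftB_A_of_mem hℓ₀ m (hb' z)

theorem nem_powB_eq {m ℓ : ℝ} (hℓ : 0 ≤ ℓ) {w θ : Sobolev 1} (hw : ∀ z, 0 < 1 + rep w z)
    (hθ : ∀ z, rep θ z = Theta m (1 + rep w z)) (hmem : ∀ z, rep θ z ∈ Icc (lo m ℓ) (hi m ℓ)) :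
    nem (powB m hℓ m) θ = w := by
  refine ext_rep (funext fun z => ?_)
  rw [rep_nem]
  show (powB m hℓ m).A (rep θ z) = rep w z
  rw [powB_A_of_mem hℓ (hmem z), hθ, Phi_Theta (hw z)]
  ring

/-! ### Global solutions -/

theorem exists_solution_one {n m : ℝ} (hnm : 3 ≤ n + m) (hlow : 4 ≤ n + 3 * m)
    (hup : n + 3 * m < 6) {φ₀ : ℝ → ℝ} {v₀ : Sobolev 1}
    (hv₀ : v₀.Represents fun z => φ₀ z - 1) (h : essSup (fun z => ‖φ₀ z‖ₑ⁻¹) volume < ⊤) :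
    ∃ φ : ℝ → ℝ → ℝ, IsGlobalSolution n m 1 φ₀ φ ∧ ∃ ε : ℝ, 0 < ε ∧ ∀ t z, ε ≤ φ t z := by
  have hw := one_add_rep_pos hv₀ h
  obtain ⟨ℓ₀, hℓ₀, hb, hr⟩ := exists_transformed_data m hw
  obtain ⟨ℓ, hℓ, θ, h0, hθ, hmem⟩ := exists_global_curve hnm hlow hup hℓ₀
    (θ₀ := nem (shiftB hℓ₀ (-m)) v₀) fun z => by rw [hr]; exact Theta_mem_Icc (hb z)
  have hθc : Continuous θ := continuous_iff_continuousAt.2 fun t => (hθ t).continuousAt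
  have hUc : Continuous fun t => (coeff n m hℓ).U (θ t) := (coeff n m hℓ).continuous_U.comp hθc
  refine ⟨_, isGlobalSolution_of_curve hℓ hθ hmem hv₀
    (V := fun t => nem (powB m hℓ m) (θ t))
    (F := fun t => nemDeriv (powB m hℓ m) (dpowB m hℓ m) (θ t) ((coeff n m hℓ).U (θ t)))
    (hasDerivAt_nem hθ hUc fun t z => powB_eq_add hℓ m (hmem t z))
    (continuous_nemDeriv_comp _ _ hθc hUc) (fun _ => rfl)
    (nem_powB_eq hℓ hw (fun z => by rw [h0, hr]) (hmem 0)),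
    Real.exp (-ℓ), Real.exp_pos _, fun t z => (Phi_mem_Icc (hmem t z)).1⟩

theorem exists_solution_two {n m : ℝ} (hnm : 3 ≤ n + m) (hlow : 4 ≤ n + 3 * m)
    (hup : n + 3 * m < 6) {φ₀ : ℝ → ℝ} {v₀ : Sobolev 2}
    (hv₀ : v₀.Represents fun z => φ₀ z - 1) (h : essSup (fun z => ‖φ₀ z‖ₑ⁻¹) volume < ⊤) :
    ∃ φ : ℝ → ℝ → ℝ, IsGlobalSolution n m 2 φ₀ φ ∧ ∃ ε : ℝ, 0 < ε ∧ ∀ t z, ε ≤ φ t z := by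
  set w : Sobolev 1 := res 1 v₀ with hwdef
  have hwrep : w.Represents fun z => φ₀ z - 1 := by
    show D 0 w =ᵐ[volume] _
    rw [hwdef, D_zero_res]
    exact hv₀
  have hw := one_add_rep_pos hwrep h
  obtain ⟨ℓ₀, hℓ₀, hb, hr⟩ := exists_transformed_data m hw
  obtain ⟨ℓ, hℓ, θ, h0, hθ, hmem⟩ := exists_global_curve hnm hlow hup hℓ₀
    (θ₀ := nem (shiftB hℓ₀ (-m)) w) fun z => by rw [hr]; exact Theta_mem_Icc (hb z)
  have hθc : Continuous θ := continuous_iff_continuousAt.2 fun t => (hθ t).continuousAt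
  have hUc : Continuous fun t => (coeff n m hℓ).U (θ t) := (coeff n m hℓ).continuous_U.comp hθc
  -- The initial slope θ_z = φ₀^{-m} (φ₀)_z is in H¹ because (φ₀)_z is.
  obtain ⟨Z, Z', hZ, hZ'c, hDZ⟩ := exists_derivative_curve hℓ hθ hmem
    (W₀ := nemDeriv (shiftB hℓ₀ (-m)) (dshiftB hℓ₀ (-m)) w (shift v₀)) (by
      rw [D_zero_nemDeriv _ fun z => shiftB_eq_add hℓ₀ (-m) (hb z), h0, D_one_nem, D_zero_shift,
        hwdef, res_eq]
      rfl)
  have hV : ∀ t, HasDerivAt (fun t => nem (powB m hℓ m) (θ t))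
      (nemDeriv (powB m hℓ m) (dpowB m hℓ m) (θ t) ((coeff n m hℓ).U (θ t))) t :=
    hasDerivAt_nem hθ hUc fun t z => powB_eq_add hℓ m (hmem t z)
  refine ⟨_, isGlobalSolution_of_curve hℓ hθ hmem hv₀
    (V := fun t => join (nem (powB m hℓ m) (θ t), Z t))
    (F := fun t => join
      (nemDeriv (powB m hℓ m) (dpowB m hℓ m) (θ t) ((coeff n m hℓ).U (θ t)), Z' t))
    (fun t => join.hasFDerivAt.comp_hasDerivAt t ((hV t).prodMk (hZ t)))
    (join.continuous.comp ((continuous_nemDeriv_comp _ _ hθc hUc).prodMk hZ'c))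
    (fun t => D_zero_join (hDZ t)) (ext_D_zero ?_),
    Real.exp (-ℓ), Real.exp_pos _, fun t z => (Phi_mem_Icc (hmem t z)).1⟩
  rw [D_zero_join (hDZ 0), nem_powB_eq hℓ hw (fun z => by rw [h0, hr]) (hmem 0), hwdef, D_zero_res]

end

end Magma

/-! ### The main theorem -/

theorem mainTheorem6 (n m : ℝ) (hnm : 3 ≤ n + m) (hlow : 4 ≤ n + 3 * m) (hup : n + 3 * m < 6)
    (k : ℕ) (hk : k = 1 ∨ k = 2) (φ₀ : ℝ → ℝ)
    (hφ₀ : ∃ v₀ : Magma.Sobolev k, v₀.Represents (fun z => φ₀ z - 1))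
    (hφ₀_inv : essSup (fun z => ‖φ₀ z‖ₑ⁻¹) volume < ⊤) :
    ∃ φ : ℝ → ℝ → ℝ,
      Magma.IsGlobalSolution n m k φ₀ φ ∧
      (∀ φ' : ℝ → ℝ → ℝ, Magma.IsGlobalSolution n m k φ₀ φ' → ∀ t, 0 ≤ t → ∀ z, φ' t z = φ t z) ∧
      ∃ ε : ℝ, 0 < ε ∧ ∀ t, 0 ≤ t → ∀ z, ε ≤ φ t z := by
  obtain ⟨v₀, hv₀⟩ := hφ₀
  rcases hk with rfl | rfl
  · obtain ⟨φ, hφ, ε, hε, hb⟩ := Magma.exists_solution_one hnm hlow hup hv₀ hφ₀_inv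
    exact ⟨φ, hφ, fun φ' hφ' t ht z => hφ'.unique hφ ht z, ε, hε, fun t _ => hb t⟩
  · obtain ⟨φ, hφ, ε, hε, hb⟩ := Magma.exists_solution_two hnm hlow hup hv₀ hφ₀_inv
    -- An H² solution is an H¹ solution by continuity of the inclusion, so uniqueness in H¹
    -- suffices.
    exact ⟨φ, hφ, fun φ' hφ' t ht z => hφ'.of_succ.unique hφ.of_succ ht z, ε, hε, fun t _ => hb t⟩
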